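/- Let $d\ge 1$ be an integer, $\beta>-1$ and $a>0$. On $\mathbb{R}^d$ let $U_{\beta,a}(x)=(a^2-|x|^2)^{\beta}$ if $|x|<a$ and $U_{\beta,a}(x)=0$ if $|x|\ge a$, and let $u_{\beta,a}(x)=\sum_{m\in\mathbb{Z}^d}U_{\beta,a}(x+m)$ be its periodization, regarded as a function on $\mathbb{T}^d=(-1/2,1/2]^d$. For $\lambda>0$ let $$S_\lambda(u)(x)=\sum_{m\in\mathbb{Z}^d,\,|m|<\lambda}\hat u(m)e^{2\pi i m\cdot x},\quad \hat u(m)=\int_{\mathbb{T}^d}u(x)e^{-2\pi i m\cdot x}\,dx,$$ $$\sigma_\lambda(U)(x)=\int_{|\xi|<\lambda}\hat U(\xi)e^{2\pi i\xi\cdot x}\,d\xi,\quad \hat U(\xi)=\int_{\mathbb{R}^d}U(x)e^{-2\pi i\xi\cdot x}\,dx,$$ where $|\cdot|$ is the Euclidean norm. Let $r_d(a:0)$ be the number of $m\in\mathbb{Z}^d$ with $|m|=a$, and let $$P^{[d]}_{\beta,a}=\frac{\Gamma(\beta+1)}{\Gamma(d/2)}\,a^{\frac{d-3}2+\beta}\,\pi^{\frac{d-4}2-\beta},\qquad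 L_{\beta,a}=\frac{\Gamma(\beta+1)}2\left(\frac a\pi\right)^{\beta}\frac{\sin(\beta\pi/2)}{\beta\pi/2},$$ where the last quotient is read as $1$ if $\beta=0$. (i) If $d\ge1$ and $\beta>(d-3)/2$, then, as $\lambda\to\infty$, $$S_\lambda(u_{\beta,a})(0)=u_{\beta,a}(0)+r_d(a:0)\bigl(L_{\beta,a}+o(1)\bigr)\lambda^{-\beta}+O\bigl(\lambda^{\frac{d-3}2-\beta}\bigr).$$ (ii) If $d\ge2$ and $-1<\beta\le(d-3)/2$, then $S_\lambda(u_{\beta,a})$ reveals the Pinsky phenomenon: $S_\lambda(u_{\beta,a})(0)$ does not converge as $\lambda\to\infty$. More precisely, as $\lambda\to\infty$, $$S_\lambda(u_{\beta,a})(0)=u_{\beta,a}(0)+\bigl(\sigma_\lambda(U_{\beta,a})(0)-U_{\beta,a}(0)\bigr)+r_d(a:0)\bigl(L_{\beta,a}+o(1)\bigr)\lambda^{-\beta}+o\bigl(\lambda^{\frac{d-3}2-\beta}\bigr),$$ where $$\sigma_\lambda(U_{\beta,a})(0)-U_{\beta,a}(0)=-P^{[d]}_{\beta,a}\cos\Bigl(2\pi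 a\lambda-\frac{d-1+2\beta}4\pi\Bigr)\lambda^{\frac{d-3}2-\beta}+O\bigl(\lambda^{\frac{d-5}2-\beta}\bigr).$$ -/

import Mathlib

open MeasureTheory Filter Topology Asymptotics
open scoped FourierTransform

noncomputable section

namespace BallFourier

/-- `ℝ^d` with the Euclidean norm. -/
abbrev E (d : ℕ) : Type := EuclideanSpace ℝ (Fin d)

/-- An integer vector as a point of `ℝ^d`. -/
def latticePt {d : ℕ} (m : Fin d → ℤ) : E d := WithLp.toLp 2 (fun i => (m i : ℝ))

/-- The torus `ℝ^d / ℤ^d`, identified with the cube `(-1/2, 1/2]^d`. -/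
def torus (d : ℕ) : Set (E d) := {x | ∀ i, x i ∈ Set.Ioc (-1 / 2 : ℝ) (1 / 2)}

theorem finite_lattice_ball (d : ℕ) (R : ℝ) :
    {m : Fin d → ℤ | ‖latticePt m‖ < R}.Finite := by
  refine (Set.Finite.pi' (t := fun _ : Fin d => Set.Icc (-⌈R⌉) ⌈R⌉)
    (fun _ => Set.finite_Icc _ _)).subset ?_
  intro m hm i
  have h1 : ‖(latticePt m) i‖ ≤ ‖latticePt m‖ := PiLp.norm_apply_le _ i
  have h2 : |(m i : ℝ)| ≤ ⌈R⌉ := by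
    have h3 : ‖latticePt m‖ < R := hm
    have h4 : (latticePt m) i = (m i : ℝ) := rfl
    rw [h4, Real.norm_eq_abs] at h1
    exact h1.trans (h3.le.trans (Int.le_ceil R))
  exact abs_le.mp (by exact_mod_cast h2)

/-- The integer vectors `m` with `|m| < R`. -/
def latticeBall (d : ℕ) (R : ℝ) : Finset (Fin d → ℤ) := (finite_lattice_ball d R).toFinset

/-- `U_{β,a}(x) = (a² - |x|²)^β` for `|x| < a`, and `0` otherwise. -/
def bump {d : ℕ} (β a : ℝ) (x : E d) : ℝ :=
  if ‖x‖ < a then (a ^ 2 - ‖x‖ ^ 2) ^ β else 0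

/-- The periodization `x ↦ ∑_{m ∈ ℤ^d} F(x + m)`. -/
def periodization {d : ℕ} (F : E d → ℝ) (x : E d) : ℝ :=
  ∑' m : Fin d → ℤ, F (x + latticePt m)

/-- `u_{β,a}`, the periodization of `U_{β,a}`. -/
def perBump {d : ℕ} (β a : ℝ) : E d → ℝ := periodization (bump β a)

/-- The Fourier coefficient of a function on the torus. -/
def fourierCoefficient {d : ℕ} (f : E d → ℝ) (m : Fin d → ℤ) : ℂ :=
  ∫ x in torus d,
    (f x : ℂ) * Complex.exp (-2 * Real.pi * Complex.I * (inner ℝ (latticePt m) x : ℝ))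

/-- The spherical partial sum `S_R(f)(x) = ∑_{|m| < R} f^(m) e^{2πi m·x}`. -/
def partialSum {d : ℕ} (R : ℝ) (f : E d → ℝ) (x : E d) : ℂ :=
  ∑ m ∈ latticeBall d R, fourierCoefficient f m *
    Complex.exp (2 * Real.pi * Complex.I * (inner ℝ (latticePt m) x : ℝ))

/-- The spherical partial integral `σ_R(F)(x) = ∫_{|ξ| < R} F^(ξ) e^{2πi ξ·x} dξ`. -/
def partialIntegral {d : ℕ} (R : ℝ) (F : E d → ℝ) (x : E d) : ℂ :=
  ∫ ξ in Metric.ball (0 : E d) R, 𝓕 (fun y : E d => (F y : ℂ)) ξ *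
    Complex.exp (2 * Real.pi * Complex.I * (inner ℝ ξ x : ℝ))

/-- `r_d(a : x)`, the number of `m ∈ ℤ^d` with `|x - m| = a`. -/
def sphereCount {d : ℕ} (a : ℝ) (x : E d) : ℕ :=
  {m : Fin d → ℤ | ‖x - latticePt m‖ = a}.ncard

/-- The amplitude `P_{β,a}^{[d]}`. -/
def pinskyConst (d : ℕ) (β a : ℝ) : ℝ :=
  Real.Gamma (β + 1) / Real.Gamma ((d : ℝ) / 2) *
    a ^ (((d : ℝ) - 3) / 2 + β) * Real.pi ^ (((d : ℝ) - 4) / 2 - β)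

/-- The constant `L_{β,a}`; `Real.sinc t` is `sin t / t`, and `1` at `t = 0`. -/
def sphereConst (β a : ℝ) : ℝ :=
  Real.Gamma (β + 1) / 2 * (a / Real.pi) ^ β * Real.sinc (β * Real.pi / 2)

end BallFourier

end

/-! The Fourier transform of the bump is explicit: a constant times `Λ_{d/2+β}(π²a²|ξ|²)`, where
`Λ_ν` is the entire function behind `J_ν`. The partial sum at the origin adds its values over `|m| <
λ`. Poisson summation formally turns this into the sum over lattice points `n` of the partial
integrals `σ_λ(U)(n)`, and the error `S_λ(u)(0) - u(0)` into the sum of `σ_λ(U)(n) - U(n)`. The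
point `n = 0` gives the Pinsky term, each `n` with `|n| = a` gives `(L + o(1)) λ^{-β}`, and
everything else is collected in `sumErr`.

The first tool is a Green identity (`lamInt_green`, `sigmaErr_green`): `a² - ρ²` times the error at
distance `ρ` is the error for `β + 1` plus a boundary term made of products of two Bessel functions.
At `ρ = 0` the boundary term is a single Bessel function, whose asymptotics give the Pinsky term. At
`ρ = a` one integral drops out and the other is known in closed form when `β ≠ 0`; the case `β = 0`
uses a recursion in the dimension. At the other lattice points off the origin `|a² - ρ²| ≥ c ρ²`,
because `|n|²` is an integer, so the identity can be iterated until the transform is integrable and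
Fourier inversion bounds the error.

The second tool makes the sum over `n` absolutely convergent. The radius is replaced by `√(l² + lτ)`
and averaged against a smooth weight in `τ`; repeated integration by parts then gives any required
decay in `n`, and the averaged remainder is `O(l^{-β-1})` (`exists_radAvg_sumErr_bound`). Undoing
the average over `0 ≤ τ ≤ ε` costs the lattice points of a thin shell. Poisson summation counts at
most `C₀ ε l^{d-1} + C_ε l^{(d-1)/2}` of them, with `C₀` independent of `ε`, and each carries a
coefficient `O(l^{-(d+1)/2-β})`. Hence `sumErr` is at most `C₀ ε l^{(d-3)/2-β} + C_ε l^{-β-1}`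
(`exists_sumErr_bound`), which is `O(l^{(d-3)/2-β})`, and `o` of it once `d ≥ 2`.

Divergence for `β ≤ (d-3)/2` comes from the non-vanishing cosine of the Pinsky term. The exception
is `d = 2` with lattice points on the sphere: there `λ^{-β}` dominates and is itself unbounded. -/

namespace BallFourier

/-! ### The entire function behind the Bessel functions -/

/-- The coefficients of `besselLam`. -/
noncomputable def lamCoeff (ν : ℝ) (k : ℕ) : ℝ :=
  (-1) ^ k / (k.factorial * Real.Gamma (ν + k + 1))

/-- The entire function `Λ_ν(x) = ∑ (-x)^k / (k! Γ(ν + k + 1))`, so that the Bessel function of the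
first kind is `J_ν(z) = (z / 2)^ν Λ_ν(z² / 4)`. -/
noncomputable def besselLam (ν x : ℝ) : ℝ := ∑' k : ℕ, lamCoeff ν k * x ^ k

/-- `Real.Gamma` is 0 at its poles, so its inverse is the entire function `1/Γ` and the functional
equation has no exceptions. This lets the recurrences below hold for every real order. -/
theorem inv_Gamma_eq_mul_inv_Gamma (s : ℝ) :
    (Real.Gamma s)⁻¹ = s * (Real.Gamma (s + 1))⁻¹ := by
  rcases eq_or_ne s 0 with rfl | hs
  · simp
  · rw [Real.Gamma_add_one hs, mul_inv, ← mul_assoc, mul_inv_cancel₀ hs, one_mul]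

theorem exists_bound_inv_Gamma (ν : ℝ) :
    ∃ C : ℝ, ∀ k : ℕ, |(Real.Gamma (ν + k + 1))⁻¹| ≤ C := by
  obtain ⟨N, hN⟩ := exists_nat_ge (|ν|)
  -- Beyond `N ≥ |ν|` the factor `ν + N + k + 1` relating consecutive values is at least 1, so the
  -- reciprocals can only shrink.
  have hdec : ∀ k : ℕ, |(Real.Gamma (ν + (N + k : ℕ) + 1))⁻¹| ≤ |(Real.Gamma (ν + N + 1))⁻¹| := by
    intro k
    induction k with
    | zero => simp
    | succ k ih =>
      refine le_trans ?_ ih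
      have h := inv_Gamma_eq_mul_inv_Gamma (ν + (N + k : ℕ) + 1)
      have h2 : ν + (N + (k + 1) : ℕ) + 1 = ν + (N + k : ℕ) + 1 + 1 := by push_cast; ring
      rw [h2, h, abs_mul]
      have h3 : (1 : ℝ) ≤ |ν + (N + k : ℕ) + 1| := by
        refine le_trans ?_ (le_abs_self _)
        push_cast
        have := neg_abs_le ν
        have : (0 : ℝ) ≤ k := Nat.cast_nonneg k
        linarith
      exact le_mul_of_one_le_left (abs_nonneg _) h3
  refine ⟨∑ j ∈ Finset.range (N + 1), |(Real.Gamma (ν + j + 1))⁻¹|, fun k => ?_⟩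
  rcases le_or_gt k N with h | h
  · exact Finset.single_le_sum (f := fun j : ℕ => |(Real.Gamma (ν + j + 1))⁻¹|)
      (fun _ _ => abs_nonneg _) (by simp; omega)
  · obtain ⟨j, rfl⟩ := Nat.exists_eq_add_of_lt h
    refine (hdec (j + 1)).trans ?_
    exact Finset.single_le_sum (f := fun j : ℕ => |(Real.Gamma (ν + j + 1))⁻¹|)
      (fun _ _ => abs_nonneg _) (by simp)

theorem summable_abs_lamCoeff (ν R : ℝ) :
    Summable (fun k : ℕ => |lamCoeff ν k| * |R| ^ k) := by
  obtain ⟨C, hC⟩ := exists_bound_inv_Gamma ν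
  refine Summable.of_nonneg_of_le (fun k => by positivity) (fun k => ?_)
    ((Real.summable_pow_div_factorial |R|).mul_left C)
  have h1 : |lamCoeff ν k| = |(Real.Gamma (ν + k + 1))⁻¹| / k.factorial := by
    rw [lamCoeff, abs_div, abs_pow, abs_neg, abs_one, one_pow, abs_mul, abs_inv,
      Nat.abs_cast]
    field_simp
  rw [h1, div_mul_eq_mul_div, mul_div_assoc]
  exact mul_le_mul_of_nonneg_right (hC k) (by positivity)

theorem summable_besselLam (ν x : ℝ) : Summable (fun k : ℕ => lamCoeff ν k * x ^ k) := by
  refine Summable.of_norm ?_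
  simpa only [norm_mul, norm_pow, Real.norm_eq_abs] using summable_abs_lamCoeff ν x

theorem lamCoeff_succ (ν : ℝ) (k : ℕ) :
    lamCoeff ν (k + 1) * (k + 1) = - lamCoeff (ν + 1) k := by
  have : ν + (k + 1 : ℕ) + 1 = ν + 1 + k + 1 := by push_cast; ring
  rw [lamCoeff, lamCoeff, this, Nat.factorial_succ, pow_succ]
  push_cast
  rw [div_mul_eq_mul_div, mul_assoc ((k : ℝ) + 1), mul_comm _ ((k : ℝ) + 1),
    mul_div_mul_left _ _ (by positivity)]
  ring

theorem lamCoeff_pred (ν : ℝ) (k : ℕ) : lamCoeff (ν - 1) k = lamCoeff ν k * (ν + k) := by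
  have h := inv_Gamma_eq_mul_inv_Gamma (ν + k)
  have : ν - 1 + k + 1 = ν + k := by ring
  rw [lamCoeff, lamCoeff, this, div_eq_mul_inv, mul_inv, h, div_eq_mul_inv, mul_inv]
  ring

/-- Termwise differentiation, dominated on a ball around 0 containing `x`. Together with
`besselLam_pred`, this rule drives the later integrations by parts and exact derivatives. -/
theorem hasDerivAt_besselLam (ν x : ℝ) :
    HasDerivAt (besselLam ν) (-besselLam (ν + 1) x) x := by
  set R : ℝ := |x| + 1 with hR
  have hR0 : 0 ≤ R := by positivity
  have key : ∀ (k : ℕ) (y : ℝ), lamCoeff ν k * (k * y ^ (k - 1)) =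
      if k = 0 then 0 else -(lamCoeff (ν + 1) (k - 1) * y ^ (k - 1)) := by
    intro k y
    cases k with
    | zero => simp
    | succ k =>
      have := lamCoeff_succ ν k
      simp only [Nat.add_sub_cancel, Nat.succ_ne_zero, if_false]
      push_cast
      rw [← mul_assoc, this]; ring
  have hu : Summable (fun k : ℕ => |lamCoeff ν k * (k * R ^ (k - 1))|) := by
    rw [← summable_nat_add_iff 1]
    refine (summable_abs_lamCoeff (ν + 1) R).congr fun k => ?_
    rw [key]
    simp [abs_mul, abs_pow]
  have h := hasDerivAt_tsum_of_isPreconnected (g := fun k y => lamCoeff ν k * y ^ k)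
    (g' := fun k y => lamCoeff ν k * (k * y ^ (k - 1))) (t := Metric.ball (0 : ℝ) R) (y₀ := x)
    (y := x) hu Metric.isOpen_ball (convex_ball _ _).isPreconnected
    (fun k y _ => (hasDerivAt_pow k y).const_mul _) ?_ (by simp [hR]) (summable_besselLam ν x)
    (by simp [hR])
  · refine h.congr_deriv ?_
    have hs : Summable (fun k : ℕ => lamCoeff ν k * (k * x ^ (k - 1))) := by
      rw [← summable_nat_add_iff 1]
      refine (summable_besselLam (ν + 1) x).neg.congr fun k => ?_
      rw [key]; simp
    rw [hs.tsum_eq_zero_add, besselLam, ← tsum_neg]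
    simp only [Nat.cast_zero, zero_mul, mul_zero, zero_add]
    refine tsum_congr fun k => ?_
    rw [key]; simp
  · intro k y hy
    rw [Real.norm_eq_abs, abs_mul, abs_mul, abs_mul, abs_mul]
    have : |y ^ (k - 1)| ≤ |R ^ (k - 1)| := by
      rw [abs_pow, abs_pow]
      rw [mem_ball_zero_iff, Real.norm_eq_abs] at hy
      exact pow_le_pow_left₀ (abs_nonneg _) (hy.le.trans (le_abs_self R)) _
    gcongr

theorem continuous_besselLam (ν : ℝ) : Continuous (besselLam ν) :=
  continuous_iff_continuousAt.2 fun x => (hasDerivAt_besselLam ν x).continuousAt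

/-- The three-term recurrence. -/
theorem besselLam_pred (ν x : ℝ) :
    besselLam (ν - 1) x = ν * besselLam ν x - x * besselLam (ν + 1) x := by
  -- Lowering the order multiplies the `k`-th coefficient by `ν + k`; the part with `k` cancels
  -- against `k!` and shifts the series to order `ν + 1`.
  have hs1 : Summable (fun k : ℕ => k * lamCoeff ν k * x ^ k) := by
    rw [← summable_nat_add_iff 1]
    refine ((summable_besselLam (ν + 1) x).mul_left (-x)).congr fun k => ?_
    have := lamCoeff_succ ν k
    push_cast
    rw [mul_comm ((k : ℝ) + 1), this]; ring
  have h2 : ∑' k : ℕ, k * lamCoeff ν k * x ^ k = - x * besselLam (ν + 1) x := by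
    rw [hs1.tsum_eq_zero_add, besselLam, ← tsum_mul_left]
    simp only [Nat.cast_zero, zero_mul, zero_add]
    refine tsum_congr fun k => ?_
    have := lamCoeff_succ ν k
    push_cast
    rw [mul_comm ((k : ℝ) + 1), this]; ring
  have h3 : besselLam (ν - 1) x = ∑' k : ℕ, (ν * (lamCoeff ν k * x ^ k) +
      k * lamCoeff ν k * x ^ k) := tsum_congr fun k => by rw [lamCoeff_pred]; ring
  rw [h3, ((summable_besselLam ν x).mul_left ν).tsum_add hs1, h2, tsum_mul_left, ← besselLam]
  ring

theorem besselLam_zero_right (ν : ℝ) : besselLam ν 0 = (Real.Gamma (ν + 1))⁻¹ := by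
  rw [besselLam, tsum_eq_single 0]
  · simp [lamCoeff]
  · intro k hk; simp [hk]


/-! ### Beta integrals -/

theorem integral_Ioo_rpow_mul_one_sub_rpow {u v : ℝ} (hu : 0 < u) (hv : 0 < v) :
    ∫ x in Set.Ioo (0 : ℝ) 1, x ^ (u - 1) * (1 - x) ^ (v - 1) =
      Real.Gamma u * Real.Gamma v / Real.Gamma (u + v) := by
  have h := ProbabilityTheory.beta_eq_betaIntegralReal u v hu hv
  rw [ProbabilityTheory.beta] at h
  rw [h, Complex.betaIntegral, intervalIntegral.integral_of_le zero_le_one,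
    integral_Ioc_eq_integral_Ioo]
  have : ∫ x in Set.Ioo (0 : ℝ) 1, (x : ℂ) ^ ((u : ℂ) - 1) * (1 - (x : ℂ)) ^ ((v : ℂ) - 1) =
      ∫ x in Set.Ioo (0 : ℝ) 1, (((x ^ (u - 1) * (1 - x) ^ (v - 1) : ℝ)) : ℂ) := by
    refine setIntegral_congr_fun measurableSet_Ioo fun x hx => ?_
    have h1 : (0 : ℝ) ≤ 1 - x := by linarith [hx.2]
    simp only [Complex.ofReal_mul, Complex.ofReal_cpow hx.1.le, Complex.ofReal_cpow h1]
    push_cast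
    rfl
  rw [this, integral_complex_ofReal, Complex.ofReal_re]

/-- The substitution `x = (r/a)²` reduces this to a Beta integral. -/
theorem integral_ball_rpow_mul_pow {β a : ℝ} (hβ : -1 < β) (ha : 0 < a) (n : ℕ) :
    ∫ r in Set.Ioo (0 : ℝ) a, (a ^ 2 - r ^ 2) ^ β * r ^ n =
      a ^ (2 * β + n + 1) / 2 * (Real.Gamma (β + 1) * Real.Gamma (((n : ℝ) + 1) / 2) /
        Real.Gamma (β + 1 + ((n : ℝ) + 1) / 2)) := by
  have hw : (0 : ℝ) < ((n : ℝ) + 1) / 2 := by positivity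
  have hb := integral_Ioo_rpow_mul_one_sub_rpow hw (by linarith : 0 < β + 1)
  have himg : (fun r : ℝ => (r / a) ^ 2) '' Set.Ioo 0 a = Set.Ioo 0 1 := by
    ext x
    constructor
    · rintro ⟨r, ⟨h0, h1⟩, rfl⟩
      have : r / a < 1 := (div_lt_one ha).2 h1
      have : 0 < r / a := by positivity
      exact ⟨by positivity, by simp only; nlinarith⟩
    · rintro ⟨h0, h1⟩
      refine ⟨a * √x, ⟨by positivity, ?_⟩, ?_⟩
      · have : √x < 1 := by rw [Real.sqrt_lt' one_pos]; simpa using h1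
        nlinarith
      · simp only
        rw [mul_div_cancel_left₀ _ ha.ne', Real.sq_sqrt h0.le]
  have hinj : Set.InjOn (fun r : ℝ => (r / a) ^ 2) (Set.Ioo 0 a) := by
    intro x hx y hy hxy
    have hx' : 0 ≤ x / a := div_nonneg hx.1.le ha.le
    have hy' : 0 ≤ y / a := div_nonneg hy.1.le ha.le
    have := (pow_left_inj₀ hx' hy' two_ne_zero).1 hxy
    field_simp at this
    exact this
  have hcv := integral_image_eq_integral_abs_deriv_smul (s := Set.Ioo 0 a)
    (f := fun r : ℝ => (r / a) ^ 2) (f' := fun r => 2 * (r / a) * (1 / a)) measurableSet_Ioo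
    (fun r _ => by
      have := ((hasDerivAt_id r).div_const a).pow 2
      simp only [id, Nat.cast_ofNat, Nat.add_one_sub_one, pow_one] at this
      exact this.hasDerivWithinAt) hinj
    (fun x => x ^ (((n : ℝ) + 1) / 2 - 1) * (1 - x) ^ (β + 1 - 1))
  rw [himg, hb] at hcv
  have hcong : ∫ r in Set.Ioo (0 : ℝ) a, |2 * (r / a) * (1 / a)| •
      (((r / a) ^ 2) ^ (((n : ℝ) + 1) / 2 - 1) * (1 - (r / a) ^ 2) ^ (β + 1 - 1)) =
      ∫ r in Set.Ioo (0 : ℝ) a, (2 * a ^ (-(2 * β + n + 1))) *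
        ((a ^ 2 - r ^ 2) ^ β * r ^ n) := by
    refine setIntegral_congr_fun measurableSet_Ioo fun r hr => ?_
    have hr0 : 0 < r := hr.1
    have h1 : 0 < a ^ 2 - r ^ 2 := by nlinarith [hr.2]
    have h2 : 1 - (r / a) ^ 2 = (a ^ 2 - r ^ 2) / a ^ 2 := by field_simp
    have h3 : ((r / a) ^ 2) ^ (((n : ℝ) + 1) / 2 - 1) = (r / a) ^ ((n : ℝ) - 1) := by
      rw [← Real.rpow_natCast, ← Real.rpow_mul (by positivity)]
      congr 1; push_cast; ring
    have h4 : (a ^ 2) ^ β = a ^ (2 * β) := by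
      rw [← Real.rpow_natCast, ← Real.rpow_mul (by positivity)]
      push_cast; rfl
    have h5 : r * r ^ ((n : ℝ) - 1) = r ^ n := by
      rw [← Real.rpow_natCast, Real.rpow_sub_one hr0.ne']
      field_simp
    have h6 : a ^ (-(2 * β + n + 1)) = (a ^ (2 * β) * a ^ ((n : ℝ) - 1) * a * a)⁻¹ := by
      rw [Real.rpow_neg ha.le]
      congr 1
      rw [show a ^ (2 * β) * a ^ ((n : ℝ) - 1) * a * a =
        a ^ (2 * β) * a ^ ((n : ℝ) - 1) * a ^ (1 : ℝ) * a ^ (1 : ℝ) by simp,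
        ← Real.rpow_add ha, ← Real.rpow_add ha, ← Real.rpow_add ha]
      congr 1; ring
    simp only [smul_eq_mul]
    rw [abs_of_pos (by positivity), h2, h3, add_sub_cancel_right,
      Real.div_rpow h1.le (by positivity),
      h4, Real.div_rpow hr0.le ha.le, h6, ← h5]
    field_simp
  rw [hcong, integral_const_mul] at hcv
  have h7 : a ^ (-(2 * β + n + 1)) * a ^ (2 * β + n + 1) = 1 := by
    rw [← Real.rpow_add ha, neg_add_cancel, Real.rpow_zero]
  have h8 : Real.Gamma (((n : ℝ) + 1) / 2) * Real.Gamma (β + 1) /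
      Real.Gamma (((n : ℝ) + 1) / 2 + (β + 1)) = Real.Gamma (β + 1) *
      Real.Gamma (((n : ℝ) + 1) / 2) / Real.Gamma (β + 1 + ((n : ℝ) + 1) / 2) := by
    rw [mul_comm, add_comm (β + 1)]
  rw [← h8, hcv]
  linear_combination (-(∫ r in Set.Ioo (0 : ℝ) a, (a ^ 2 - r ^ 2) ^ β * r ^ n)) * h7

theorem integrableOn_ball_rpow_mul_pow {β a : ℝ} (hβ : -1 < β) (ha : 0 < a) (n : ℕ) :
    IntegrableOn (fun r : ℝ => (a ^ 2 - r ^ 2) ^ β * r ^ n) (Set.Ioo 0 a) := by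
  -- A non-integrable function has Bochner integral 0, so the positive value just computed already
  -- proves integrability.
  refine Integrable.of_integral_ne_zero ?_
  rw [integral_ball_rpow_mul_pow hβ ha]
  have hw : (0 : ℝ) < ((n : ℝ) + 1) / 2 := by positivity
  have h1 := Real.Gamma_pos_of_pos hw
  have h2 := Real.Gamma_pos_of_pos (by linarith : 0 < β + 1)
  have h3 := Real.Gamma_pos_of_pos (by linarith : 0 < β + 1 + ((n : ℝ) + 1) / 2)
  positivity

theorem Gamma_nat_add_half_div_factorial (k : ℕ) :
    Real.Gamma (k + 1 / 2) / (2 * k).factorial = √Real.pi / (4 ^ k * k.factorial) := by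
  induction k with
  | zero => simp [-one_div, Real.Gamma_one_half_eq]
  | succ k ih =>
    have h1 : ((k + 1 : ℕ) : ℝ) + 1 / 2 = ((k : ℝ) + 1 / 2) + 1 := by push_cast; ring
    have h2 : 2 * (k + 1) = 2 * k + 1 + 1 := by ring
    have hk : (0 : ℝ) < k + 1 / 2 := by positivity
    rw [h1, Real.Gamma_add_one hk.ne', h2, Nat.factorial_succ, Nat.factorial_succ,
      Nat.factorial_succ]
    rw [div_eq_iff (by positivity)] at ih
    rw [ih]
    push_cast
    field_simp
    ring

/-- Termwise integration of the cosine series against a radial profile. -/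
theorem integral_ball_rpow_mul_besselLam {β a : ℝ} (hβ : -1 < β) (ha : 0 < a) {d : ℕ} (hd : 1 ≤ d)
    (y : ℝ) :
    ∫ r in Set.Ioo (0 : ℝ) a, (a ^ 2 - r ^ 2) ^ β * (r ^ (d - 1) *
        besselLam ((d : ℝ) / 2 - 1) (y * r ^ 2)) =
      Real.Gamma (β + 1) / 2 * a ^ (2 * β + d) * besselLam ((d : ℝ) / 2 + β) (y * a ^ 2) := by
  have hd' : ((d - 1 : ℕ) : ℝ) = d - 1 := by simp [Nat.cast_sub hd]
  have hd1 : (1 : ℝ) ≤ d := by exact_mod_cast hd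
  -- The factor `Γ(d/2 + k)` of the Beta integral cancels the one in the coefficient of `Λ_{d/2-1}`,
  -- which leaves the coefficient of `Λ_{d/2+β}`: this is Sonine's integral.
  have hterm : ∀ k : ℕ, ∫ r in Set.Ioo (0 : ℝ) a,
      lamCoeff ((d : ℝ) / 2 - 1) k * y ^ k * ((a ^ 2 - r ^ 2) ^ β * r ^ (d - 1 + 2 * k)) =
      Real.Gamma (β + 1) / 2 * a ^ (2 * β + d) *
        (lamCoeff ((d : ℝ) / 2 + β) k * (y * a ^ 2) ^ k) := by
    intro k
    rw [integral_const_mul, integral_ball_rpow_mul_pow hβ ha]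
    have e1 : ((d - 1 + 2 * k : ℕ) : ℝ) = d - 1 + 2 * k := by push_cast [hd']; ring
    have e2 : 2 * β + ((d - 1 + 2 * k : ℕ) : ℝ) + 1 = 2 * β + d + (2 * k : ℕ) := by
      rw [e1]; push_cast; ring
    have e3 : (((d - 1 + 2 * k : ℕ) : ℝ) + 1) / 2 = (d : ℝ) / 2 + k := by rw [e1]; ring
    have hG : 0 < Real.Gamma ((d : ℝ) / 2 + k) := Real.Gamma_pos_of_pos (by positivity)
    rw [e2, e3, Real.rpow_add ha, Real.rpow_natCast, lamCoeff, lamCoeff,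
      show (d : ℝ) / 2 - 1 + k + 1 = (d : ℝ) / 2 + k by ring,
      show β + 1 + ((d : ℝ) / 2 + k) = (d : ℝ) / 2 + β + k + 1 by ring]
    have : 0 < Real.Gamma ((d : ℝ) / 2 + β + k + 1) := Real.Gamma_pos_of_pos (by
      have : (0 : ℝ) ≤ k := Nat.cast_nonneg k
      linarith)
    rw [mul_pow, ← pow_mul]
    field_simp
  have hInt : ∀ k : ℕ, IntegrableOn (fun r : ℝ => lamCoeff ((d : ℝ) / 2 - 1) k * y ^ k *
      ((a ^ 2 - r ^ 2) ^ β * r ^ (d - 1 + 2 * k))) (Set.Ioo 0 a) := fun k =>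
    (integrableOn_ball_rpow_mul_pow hβ ha _).const_mul _
  have hsum : Summable (fun k : ℕ => ∫ r in Set.Ioo (0 : ℝ) a, ‖lamCoeff ((d : ℝ) / 2 - 1) k *
      y ^ k * ((a ^ 2 - r ^ 2) ^ β * r ^ (d - 1 + 2 * k))‖) := by
    have hle : ∀ k : ℕ, ∫ r in Set.Ioo (0 : ℝ) a, ‖lamCoeff ((d : ℝ) / 2 - 1) k *
        y ^ k * ((a ^ 2 - r ^ 2) ^ β * r ^ (d - 1 + 2 * k))‖ ≤
        |lamCoeff ((d : ℝ) / 2 - 1) k| * |y * a ^ 2| ^ k *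
          ∫ r in Set.Ioo (0 : ℝ) a, (a ^ 2 - r ^ 2) ^ β * r ^ (d - 1) := by
      intro k
      rw [← integral_const_mul]
      refine setIntegral_mono_on (hInt k).norm
        ((integrableOn_ball_rpow_mul_pow hβ ha _).const_mul _) measurableSet_Ioo fun r hr => ?_
      have hr0 : 0 < r := hr.1
      have h1 : 0 ≤ (a ^ 2 - r ^ 2) ^ β := Real.rpow_nonneg (by nlinarith [hr.2]) _
      rw [Real.norm_eq_abs, abs_mul, abs_mul, abs_of_nonneg (by positivity :
        0 ≤ (a ^ 2 - r ^ 2) ^ β * r ^ (d - 1 + 2 * k)), abs_pow, abs_mul, mul_pow, pow_add,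
        abs_of_nonneg (by positivity : 0 ≤ a ^ 2), ← pow_mul a]
      have h2 : r ^ (2 * k) ≤ a ^ (2 * k) := pow_le_pow_left₀ hr0.le hr.2.le _
      calc |lamCoeff ((d : ℝ) / 2 - 1) k| * |y| ^ k *
            ((a ^ 2 - r ^ 2) ^ β * (r ^ (d - 1) * r ^ (2 * k)))
          = |lamCoeff ((d : ℝ) / 2 - 1) k| * |y| ^ k *
            ((a ^ 2 - r ^ 2) ^ β * r ^ (d - 1)) * r ^ (2 * k) := by ring
        _ ≤ |lamCoeff ((d : ℝ) / 2 - 1) k| * |y| ^ k *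
            ((a ^ 2 - r ^ 2) ^ β * r ^ (d - 1)) * a ^ (2 * k) := by gcongr
        _ = _ := by ring
    refine Summable.of_nonneg_of_le (fun k => integral_nonneg fun _ => norm_nonneg _) hle ?_
    exact (summable_abs_lamCoeff _ _).mul_right _
  have h := hasSum_integral_of_summable_integral_norm hInt hsum
  simp only [hterm] at h
  rw [besselLam, ← tsum_mul_left, h.tsum_eq]
  refine setIntegral_congr_fun measurableSet_Ioo fun r _ => ?_
  simp only [besselLam, ← tsum_mul_left]
  refine tsum_congr fun k => ?_
  rw [mul_pow, pow_add, pow_mul]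
  ring


/-! ### Asymptotics of `besselLam` -/

theorem besselLam_neg_half (z : ℝ) : besselLam (-1 / 2) (z ^ 2 / 4) = Real.cos z / √Real.pi := by
  have h := (Real.hasSum_cos z).div_const (√Real.pi)
  rw [← h.tsum_eq, besselLam]
  refine tsum_congr fun k => ?_
  have h1 := Gamma_nat_add_half_div_factorial k
  have hG : 0 < Real.Gamma ((k : ℝ) + 1 / 2) := Real.Gamma_pos_of_pos (by positivity)
  have hpi : 0 < √Real.pi := Real.sqrt_pos.2 Real.pi_pos
  rw [lamCoeff, show (-1 / 2 : ℝ) + k + 1 = k + 1 / 2 by ring, div_pow, ← pow_mul]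
  rw [div_eq_div_iff (by positivity) (by positivity)] at h1
  rw [div_mul_div_comm, div_div, div_eq_div_iff (by positivity) (by positivity)]
  linear_combination (-((-1) ^ k * z ^ (2 * k))) * h1

/-- The one-dimensional Sonine integral, since `Λ_{-1/2}` is a cosine. This is Poisson's
representation of `J_ν`, from which the behaviour at large argument is obtained. -/
theorem integral_cos_eq_besselLam {α : ℝ} (hα : -1 < α) (t : ℝ) :
    ∫ x in (0 : ℝ)..1, (1 - x ^ 2) ^ α * Real.cos (t * x) =
      √Real.pi * Real.Gamma (α + 1) / 2 * besselLam (α + 1 / 2) (t ^ 2 / 4) := by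
  have h := integral_ball_rpow_mul_besselLam hα one_pos le_rfl (t ^ 2 / 4)
  have hpi : 0 < √Real.pi := Real.sqrt_pos.2 Real.pi_pos
  rw [intervalIntegral.integral_of_le zero_le_one, integral_Ioc_eq_integral_Ioo]
  have h2 : ∀ x : ℝ, (1 - x ^ 2) ^ α * Real.cos (t * x) = √Real.pi * ((1 ^ 2 - x ^ 2) ^ α *
      (x ^ (1 - 1) * besselLam (((1 : ℕ) : ℝ) / 2 - 1) (t ^ 2 / 4 * x ^ 2))) := by
    intro x
    rw [show ((1 : ℕ) : ℝ) / 2 - 1 = -1 / 2 by norm_num,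
      show t ^ 2 / 4 * x ^ 2 = (t * x) ^ 2 / 4 by ring, besselLam_neg_half]
    field_simp
    simp
  simp_rw [h2]
  rw [integral_const_mul, h, Real.one_rpow, show ((1 : ℕ) : ℝ) / 2 + α = α + 1 / 2 by
    push_cast; ring, one_pow, mul_one]
  ring_nf

/-- The integrand of the contour integral. -/
noncomputable def contourFun (α t : ℝ) (z : ℂ) : ℂ :=
  (1 - z) ^ (α : ℂ) * (1 + z) ^ (α : ℂ) * Complex.exp (Complex.I * t * z)

theorem norm_contourFun_le {α : ℝ} (hα : 0 ≤ α) (t : ℝ) {x Y : ℝ} (hx : x ∈ Set.Icc (0 : ℝ) 1)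
    (hY : 0 ≤ Y) :
    ‖contourFun α t (x + Y * Complex.I)‖ ≤ (2 + Y) ^ (2 * α) * Real.exp (-t * Y) := by
  have h1 : ‖1 - (x + Y * Complex.I)‖ ≤ 2 + Y := by
    refine (Complex.norm_le_abs_re_add_abs_im _).trans ?_
    simp only [Complex.sub_re, Complex.one_re, Complex.add_re, Complex.ofReal_re, Complex.mul_re,
      Complex.I_re, mul_zero, Complex.ofReal_im, Complex.I_im, mul_one, sub_self, add_zero,
      Complex.sub_im, Complex.one_im, Complex.add_im, Complex.mul_im, zero_add, zero_sub, abs_neg]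
    rw [abs_of_nonneg hY, abs_of_nonneg (by linarith [hx.2])]
    linarith [hx.1]
  have h2 : ‖1 + (x + Y * Complex.I)‖ ≤ 2 + Y := by
    refine (Complex.norm_le_abs_re_add_abs_im _).trans ?_
    simp only [Complex.one_re, Complex.add_re, Complex.ofReal_re, Complex.mul_re,
      Complex.I_re, mul_zero, Complex.ofReal_im, Complex.I_im, mul_one, sub_self, add_zero,
      Complex.one_im, Complex.add_im, Complex.mul_im, zero_add]
    rw [abs_of_nonneg hY, abs_of_nonneg (by linarith [hx.1])]
    linarith [hx.2]
  have h3 : ‖Complex.exp (Complex.I * t * (x + Y * Complex.I))‖ = Real.exp (-t * Y) := by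
    rw [Complex.norm_exp]; congr 1; simp
  rw [contourFun, norm_mul, norm_mul, Complex.norm_cpow_real, Complex.norm_cpow_real, h3]
  refine mul_le_mul_of_nonneg_right ?_ (Real.exp_pos _).le
  calc _ ≤ (2 + Y) ^ α * (2 + Y) ^ α := by gcongr
    _ = _ := by rw [← Real.rpow_add (by linarith)]; ring_nf

/-- Cauchy's theorem on the rectangle with corners 0, 1, `1 + iY`, `iY`. On the left edge `1 - z`
and `1 + z` are conjugate, so the integrand is real there and the edge, carrying a factor `I`, drops
out of the real part. Positivity of `α` keeps the integrand continuous at the branch point 1. -/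
theorem contourFun_rect {α : ℝ} (hα : 0 < α) (t Y : ℝ) :
    ∫ x in (0 : ℝ)..1, (1 - x ^ 2) ^ α * Real.cos (t * x) =
      (∫ x in (0 : ℝ)..1, contourFun α t (x + Y * Complex.I)).re +
      (-Complex.I * ∫ y in (0 : ℝ)..Y, contourFun α t (1 + y * Complex.I)).re := by
  have hrect := Complex.integral_boundary_rect_eq_zero_of_continuousOn_of_differentiableOn
    (contourFun α t) 0 (1 + Y * Complex.I) ?_ ?_
  · simp only [Complex.zero_re, Complex.add_re, Complex.one_re, Complex.mul_re, Complex.ofReal_re,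
      Complex.I_re, mul_zero, Complex.ofReal_im, Complex.I_im, mul_one, sub_self, add_zero,
      Complex.zero_im, Complex.ofReal_zero, zero_mul, Complex.add_im, Complex.one_im,
      Complex.mul_im, zero_add, Complex.ofReal_one, smul_eq_mul] at hrect
    have h1 : (∫ x in (0 : ℝ)..1, contourFun α t x).re =
        ∫ x in (0 : ℝ)..1, (1 - x ^ 2) ^ α * Real.cos (t * x) := by
      have e : ∫ x in (0 : ℝ)..1, contourFun α t x = ∫ x in (0 : ℝ)..1,
          (((1 - x ^ 2) ^ α : ℝ) : ℂ) * Complex.exp ((t * x : ℝ) * Complex.I) := by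
        refine intervalIntegral.integral_congr fun x hx => ?_
        rw [Set.uIcc_of_le zero_le_one] at hx
        have h1 : (0 : ℝ) ≤ 1 - x := by linarith [hx.2]
        have h2 : (0 : ℝ) ≤ 1 + x := by linarith [hx.1]
        simp only [contourFun]
        rw [show (1 - x ^ 2 : ℝ) = (1 - x) * (1 + x) by ring, Real.mul_rpow h1 h2,
          Complex.ofReal_mul, Complex.ofReal_cpow h1, Complex.ofReal_cpow h2]
        push_cast
        ring_nf
      rw [e]
      have hc : Continuous fun x : ℝ => (((1 - x ^ 2) ^ α : ℝ) : ℂ) *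
          Complex.exp ((t * x : ℝ) * Complex.I) := by
        have : Continuous fun x : ℝ => (1 - x ^ 2) ^ α :=
          (by fun_prop : Continuous fun x : ℝ => 1 - x ^ 2).rpow_const fun _ => Or.inr hα.le
        fun_prop
      have := Complex.reCLM.intervalIntegral_comp_comm (hc.intervalIntegrable
        (μ := volume) 0 1)
      rw [← Complex.reCLM_apply, ← this]
      refine intervalIntegral.integral_congr fun x _ => ?_
      simp only [Complex.reCLM_apply, Complex.re_ofReal_mul, Complex.exp_ofReal_mul_I_re]
    have h2 : (Complex.I * ∫ y in (0 : ℝ)..Y, contourFun α t (y * Complex.I)).re = 0 := by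
      have e : ∫ y in (0 : ℝ)..Y, contourFun α t (y * Complex.I) = ∫ y in (0 : ℝ)..Y,
          (((1 + y ^ 2) ^ α * Real.exp (-t * y) : ℝ) : ℂ) := by
        refine intervalIntegral.integral_congr fun y _ => ?_
        have h0 : (1 - y * Complex.I) = (starRingEnd ℂ) (1 + y * Complex.I) := by
          simp [sub_eq_add_neg]
        have harg : (1 + y * Complex.I : ℂ).arg ≠ Real.pi := by
          have : 0 < (1 + y * Complex.I : ℂ).re := by simp
          exact Complex.mem_slitPlane_iff_arg.1 (Complex.mem_slitPlane_iff.2 (Or.inl this)) |>.1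
        simp only [contourFun]
        rw [h0, Complex.conj_cpow _ _ harg, Complex.conj_ofReal, mul_comm (starRingEnd ℂ _),
          Complex.mul_conj, Complex.normSq_eq_norm_sq, Complex.norm_cpow_real]
        have h3 : (‖(1 + y * Complex.I : ℂ)‖ ^ α) ^ 2 = (1 + y ^ 2) ^ α := by
          rw [← Real.rpow_natCast, ← Real.rpow_mul (norm_nonneg _), mul_comm α, Real.rpow_mul
            (norm_nonneg _), Real.rpow_natCast, ← Complex.normSq_eq_norm_sq, Complex.normSq_apply]
          simp [pow_two]
        rw [h3]
        push_cast
        congr 2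
        linear_combination (t * y) * Complex.I_sq
      rw [e, intervalIntegral.integral_ofReal]
      simp
    have h3 := congrArg Complex.re hrect
    simp only [Complex.add_re, Complex.sub_re, h1, h2, Complex.zero_re] at h3
    rw [neg_mul, Complex.neg_re]
    linarith
  · have hmem : ∀ z ∈ Set.uIcc (0 : ℂ).re (1 + Y * Complex.I).re ×ℂ
        Set.uIcc (0 : ℂ).im (1 + Y * Complex.I).im, 0 ≤ z.re ∧ z.re ≤ 1 := by
      intro z hz
      rw [Complex.mem_reProdIm] at hz
      have := hz.1
      simp only [Complex.zero_re, Complex.add_re, Complex.one_re, Complex.mul_re, Complex.ofReal_re,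
        Complex.I_re, mul_zero, Complex.ofReal_im, Complex.I_im, mul_one, sub_self, add_zero,
        Set.uIcc_of_le zero_le_one] at this
      exact this
    intro z hz
    refine ContinuousAt.continuousWithinAt ?_
    have h1 : ContinuousAt (fun z : ℂ => (1 - z) ^ (α : ℂ)) z :=
      (Complex.continuousAt_cpow_const_of_re_pos (Or.inl (by simpa using (hmem z hz).2))
        (by simpa using hα)).comp (f := fun z : ℂ => 1 - z) (by fun_prop)
    have h2 : ContinuousAt (fun z : ℂ => (1 + z) ^ (α : ℂ)) z :=
      (Complex.continuousAt_cpow_const_of_re_pos (Or.inl (by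
        simpa using by linarith [(hmem z hz).1])) (by simpa using hα)).comp
        (f := fun z : ℂ => 1 + z) (by fun_prop)
    exact (h1.mul h2).mul (by fun_prop)
  · intro z hz
    rw [Complex.mem_reProdIm] at hz
    have hz1 := hz.1
    simp only [Complex.zero_re, Complex.add_re, Complex.one_re, Complex.mul_re, Complex.ofReal_re,
        Complex.I_re, mul_zero, Complex.ofReal_im, Complex.I_im, mul_one, sub_self, add_zero,
        min_eq_left zero_le_one, max_eq_right zero_le_one] at hz1
    refine DifferentiableAt.differentiableWithinAt ?_
    refine ((DifferentiableAt.cpow_const (by fun_prop) (Complex.mem_slitPlane_iff.2 (Or.inl ?_))).mul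
      (DifferentiableAt.cpow_const (by fun_prop) (Complex.mem_slitPlane_iff.2 (Or.inl ?_)))).mul
      (by fun_prop)
    · simpa using hz1.2
    · simpa using by linarith [hz1.1]

/-- On this edge `1 - z = -iy`, whose power contributes the phase `e^{-iπα/2}`; combined with
`e^{it}` and `-i` it gives the phase of the asymptotics. -/
theorem contourFun_right_edge (α t : ℝ) {y : ℝ} (hy : 0 < y) :
    -Complex.I * contourFun α t (1 + y * Complex.I) =
      Complex.exp ((t - Real.pi * (α + 1) / 2 : ℝ) * Complex.I) *
      (((y ^ α * Real.exp (-t * y) : ℝ) : ℂ) * (2 + y * Complex.I) ^ (α : ℂ)) := by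
  have h1 : (1 - (1 + y * Complex.I)) ^ (α : ℂ) =
      ((y ^ α : ℝ) : ℂ) * Complex.exp (-(Real.pi * α / 2) * Complex.I) := by
    have e : (1 - (1 + y * Complex.I) : ℂ) = y * (-Complex.I) := by ring
    have hI : (-Complex.I : ℂ) ≠ 0 := by simp
    rw [e, Complex.cpow_def_of_ne_zero (mul_ne_zero (by exact_mod_cast hy.ne') hI),
      Complex.log_ofReal_mul hy hI, Complex.log_neg_I, add_mul, Complex.exp_add,
      Real.rpow_def_of_pos hy]
    push_cast
    congr 2
    ring
  have h2 : -Complex.I = Complex.exp (-(Real.pi / 2) * Complex.I) := by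
    rw [neg_mul, Complex.exp_neg, Complex.exp_pi_div_two_mul_I, Complex.inv_I]
  have h3 : Complex.exp (Complex.I * t * (1 + y * Complex.I)) =
      Complex.exp (t * Complex.I) * ((Real.exp (-t * y) : ℝ) : ℂ) := by
    rw [Complex.ofReal_exp, ← Complex.exp_add]
    congr 1
    push_cast
    linear_combination (t * y) * Complex.I_sq
  have h4 : Complex.exp ((t - Real.pi * (α + 1) / 2 : ℝ) * Complex.I) =
      Complex.exp (-(Real.pi / 2) * Complex.I) * Complex.exp (-(Real.pi * α / 2) * Complex.I) *
        Complex.exp (t * Complex.I) := by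
    rw [← Complex.exp_add, ← Complex.exp_add]
    congr 1
    push_cast
    ring
  rw [contourFun, h1, h3, h4, ← h2, show (1 + (1 + y * Complex.I) : ℂ) = 2 + y * Complex.I by ring]
  push_cast
  ring

theorem norm_two_add_mul_I_cpow_sub_le {α : ℝ} (hα : 1 ≤ α) {y : ℝ} (hy : 0 ≤ y) :
    ‖(2 + y * Complex.I) ^ (α : ℂ) - ((2 ^ α : ℝ) : ℂ)‖ ≤ α * (2 + y) ^ (α - 1) * y := by
  have h := Convex.norm_image_sub_le_of_norm_hasDerivWithin_le (𝕜 := ℝ) (s := Set.Icc 0 y)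
    (f := fun u : ℝ => (2 + u * Complex.I) ^ (α : ℂ))
    (f' := fun u : ℝ => (α : ℂ) * (2 + u * Complex.I) ^ ((α : ℂ) - 1) * Complex.I)
    (x := 0) (y := y) (C := α * (2 + y) ^ (α - 1)) ?_ ?_ (convex_Icc _ _) (by simp [hy])
    (by simp [hy])
  · simp only [Complex.ofReal_zero, zero_mul, add_zero, sub_zero, Real.norm_eq_abs,
      abs_of_nonneg hy] at h
    rw [Complex.ofReal_cpow (by norm_num)]
    exact_mod_cast h
  · intro u hu
    have hd : HasDerivAt (fun u : ℝ => (2 + u * Complex.I : ℂ)) Complex.I u := by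
      simpa using ((Complex.ofRealCLM.hasDerivAt (x := u)).mul_const Complex.I).const_add 2
    have hs : (2 + u * Complex.I : ℂ) ∈ Complex.slitPlane :=
      Complex.mem_slitPlane_iff.2 (Or.inl (by simp))
    have h1 : HasDerivAt (fun z : ℂ => z ^ (α : ℂ)) ((α : ℂ) * (2 + u * Complex.I) ^ ((α : ℂ) - 1))
        (2 + u * Complex.I) := by
      simpa using (hasDerivAt_id (2 + u * Complex.I : ℂ)).cpow_const (c := (α : ℂ)) hs
    exact (HasDerivAt.comp u h1 hd).hasDerivWithinAt
  · intro u hu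
    have e : ((α : ℂ) - 1) = ((α - 1 : ℝ) : ℂ) := by push_cast; rfl
    rw [norm_mul, norm_mul, Complex.norm_I, mul_one, e, Complex.norm_cpow_real,
      Complex.norm_real, Real.norm_of_nonneg (by linarith)]
    have hn : ‖(2 + u * Complex.I : ℂ)‖ ≤ 2 + y := by
      refine (Complex.norm_le_abs_re_add_abs_im _).trans ?_
      simp [abs_of_nonneg hu.1, hu.2]
    gcongr


/-! ### Laplace integrals along the vertical ray. -/

theorem integrableOn_rpow_mul_exp_neg {s b : ℝ} (hs : -1 < s) (hb : 0 < b) :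
    IntegrableOn (fun y : ℝ => y ^ s * Real.exp (-b * y)) (Set.Ioi 0) := by
  simpa using integrableOn_rpow_mul_exp_neg_mul_rpow hs one_pos hb

theorem integral_rpow_mul_exp_neg {s b : ℝ} (hs : -1 < s) (hb : 0 < b) :
    ∫ y in Set.Ioi (0 : ℝ), y ^ s * Real.exp (-b * y) = Real.Gamma (s + 1) * b ^ (-s - 1) := by
  have h := Real.integral_rpow_mul_exp_neg_mul_Ioi (by linarith : 0 < s + 1) hb
  simp only [add_sub_cancel_right] at h
  simp_rw [neg_mul]
  rw [h, one_div, Real.inv_rpow hb.le, ← Real.rpow_neg hb.le, mul_comm]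
  ring_nf

/-- The integrand on the vertical ray, after removing the phase. -/
noncomputable def rayFun (α t y : ℝ) : ℂ :=
  ((y ^ α * Real.exp (-t * y) : ℝ) : ℂ) * (2 + y * Complex.I) ^ (α : ℂ)

/-- Freezing `(2 + iy)^α` at `y = 0` costs one factor `y` by the mean value inequality, hence later
one power of `1/t`. -/
theorem norm_rayFun_sub_le {α : ℝ} (hα : 1 ≤ α) {t y : ℝ} (ht : α ≤ t) (hy : 0 < y) :
    ‖rayFun α t y - ((2 ^ α * (y ^ α * Real.exp (-t * y)) : ℝ) : ℂ)‖ ≤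
      α * 2 ^ (α - 1) * (y ^ (α + 1) * Real.exp (-(t / 2) * y)) := by
  have h1 := norm_two_add_mul_I_cpow_sub_le hα hy.le
  have e : rayFun α t y - ((2 ^ α * (y ^ α * Real.exp (-t * y)) : ℝ) : ℂ) =
      ((y ^ α * Real.exp (-t * y) : ℝ) : ℂ) *
        ((2 + y * Complex.I) ^ (α : ℂ) - ((2 ^ α : ℝ) : ℂ)) := by
    rw [rayFun]; push_cast; ring
  have h0 : 0 ≤ y ^ α * Real.exp (-t * y) := by positivity
  -- Half of the exponential decay is spent on absorbing this power: `2 + y ≤ 2e^{y/2}` and `α - 1 ≤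
  -- t`.
  have h2 : (2 + y) ^ (α - 1) ≤ 2 ^ (α - 1) * Real.exp (t / 2 * y) := by
    have h3 : 2 + y ≤ 2 * Real.exp (y / 2) := by linarith [Real.add_one_le_exp (y / 2)]
    calc (2 + y) ^ (α - 1) ≤ (2 * Real.exp (y / 2)) ^ (α - 1) := by
          gcongr
      _ = 2 ^ (α - 1) * Real.exp (y / 2 * (α - 1)) := by
          rw [Real.mul_rpow (by norm_num) (Real.exp_pos _).le, ← Real.exp_mul]
      _ ≤ _ := by
          gcongr 2 ^ (α - 1) * Real.exp ?_
          nlinarith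
  rw [e, norm_mul, Complex.norm_real, Real.norm_of_nonneg h0]
  calc _ ≤ y ^ α * Real.exp (-t * y) * (α * (2 ^ (α - 1) * Real.exp (t / 2 * y)) * y) := by
        refine mul_le_mul_of_nonneg_left (h1.trans ?_) h0
        gcongr
    _ = α * 2 ^ (α - 1) * (y ^ (α + 1) * (Real.exp (-t * y) * Real.exp (t / 2 * y))) := by
        rw [Real.rpow_add_one hy.ne']; ring
    _ = _ := by
        rw [← Real.exp_add]; ring_nf

theorem continuousOn_rayFun {α : ℝ} (hα : 0 ≤ α) (t : ℝ) :
    Continuous (rayFun α t) := by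
  refine Continuous.mul ?_ ?_
  · have : Continuous fun y : ℝ => y ^ α := continuous_id.rpow_const fun _ => Or.inr hα
    fun_prop
  · refine Continuous.cpow (by fun_prop) continuous_const fun y => ?_
    exact Complex.mem_slitPlane_iff.2 (Or.inl (by simp))

theorem integrableOn_rayFun {α : ℝ} (hα : 1 ≤ α) {t : ℝ} (ht : α ≤ t) :
    IntegrableOn (rayFun α t) (Set.Ioi 0) := by
  have ht0 : 0 < t := by linarith
  have h1 : IntegrableOn (fun y : ℝ => ((2 ^ α * (y ^ α * Real.exp (-t * y)) : ℝ) : ℂ))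
      (Set.Ioi 0) :=
    ((integrableOn_rpow_mul_exp_neg (by linarith : -1 < α) ht0).const_mul (2 ^ α)).ofReal
  have h2 : IntegrableOn (fun y : ℝ => rayFun α t y -
      ((2 ^ α * (y ^ α * Real.exp (-t * y)) : ℝ) : ℂ)) (Set.Ioi 0) := by
    refine Integrable.mono' ((integrableOn_rpow_mul_exp_neg (by linarith : -1 < α + 1)
      (by linarith : 0 < t / 2)).const_mul (α * 2 ^ (α - 1))) ?_ ?_
    · exact ((continuousOn_rayFun (by linarith) t).aestronglyMeasurable.restrict).sub
        h1.aestronglyMeasurable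
    · filter_upwards [ae_restrict_mem measurableSet_Ioi] with y hy
      exact norm_rayFun_sub_le hα ht hy
  refine (h1.add h2).congr (Eventually.of_forall fun y => ?_)
  simp

/-- Let the height of the rectangle tend to infinity: the top edge vanishes because of the factor
`e^{-tY}`. -/
theorem integral_cos_eq_re_rayFun {α : ℝ} (hα : 1 ≤ α) {t : ℝ} (ht : α ≤ t) :
    ∫ x in (0 : ℝ)..1, (1 - x ^ 2) ^ α * Real.cos (t * x) =
      (Complex.exp ((t - Real.pi * (α + 1) / 2 : ℝ) * Complex.I) *
        ∫ y in Set.Ioi (0 : ℝ), rayFun α t y).re := by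
  have ht0 : 0 < t := by linarith
  have hlim1 : Tendsto (fun Y : ℝ => ∫ x in (0 : ℝ)..1, contourFun α t (x + Y * Complex.I))
      atTop (𝓝 0) := by
    have hg : Tendsto (fun Y : ℝ => (2 + Y) ^ (2 * α) * Real.exp (-t * Y)) atTop (𝓝 0) := by
      have h := (tendsto_rpow_mul_exp_neg_mul_atTop_nhds_zero (2 * α) t ht0).comp
        (tendsto_atTop_add_const_left atTop (2 : ℝ) tendsto_id)
      have h' := h.mul_const (Real.exp (t * 2))
      rw [zero_mul] at h'
      refine h'.congr fun Y => ?_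
      simp only [Function.comp, id]
      rw [mul_assoc, ← Real.exp_add]
      ring_nf
    refine squeeze_zero_norm' ?_ hg
    filter_upwards [eventually_ge_atTop 0] with Y hY
    have := intervalIntegral.norm_integral_le_of_norm_le_const (a := 0) (b := 1)
      (f := fun x : ℝ => contourFun α t (x + Y * Complex.I))
      (C := (2 + Y) ^ (2 * α) * Real.exp (-t * Y)) fun x hx => by
        rw [Set.uIoc_of_le zero_le_one] at hx
        exact norm_contourFun_le (by linarith) t ⟨hx.1.le, hx.2⟩ hY
    simpa using this
  have hlim2 : Tendsto (fun Y : ℝ => ∫ y in (0 : ℝ)..Y, rayFun α t y) atTop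
      (𝓝 (∫ y in Set.Ioi (0 : ℝ), rayFun α t y)) :=
    intervalIntegral_tendsto_integral_Ioi 0 (integrableOn_rayFun hα ht) tendsto_id
  have hlim := ((Complex.continuous_re.tendsto _).comp hlim1).add
    ((Complex.continuous_re.tendsto _).comp
      (hlim2.const_mul (Complex.exp ((t - Real.pi * (α + 1) / 2 : ℝ) * Complex.I))))
  rw [Complex.zero_re, zero_add] at hlim
  refine tendsto_nhds_unique (tendsto_const_nhds.congr' ?_) hlim
  filter_upwards [eventually_ge_atTop 0] with Y hY
  rw [contourFun_rect (by linarith) t Y]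
  simp only [Function.comp]
  congr 2
  rw [← intervalIntegral.integral_const_mul, ← intervalIntegral.integral_const_mul,
    intervalIntegral.integral_of_le hY, intervalIntegral.integral_of_le hY]
  exact setIntegral_congr_fun measurableSet_Ioc fun y hy => contourFun_right_edge α t hy.1

theorem integral_cos_asymptotics {α : ℝ} (hα : 1 ≤ α) :
    (fun t : ℝ => (∫ x in (0 : ℝ)..1, (1 - x ^ 2) ^ α * Real.cos (t * x)) -
      2 ^ α * Real.Gamma (α + 1) * t ^ (-α - 1) * Real.cos (t - Real.pi * (α + 1) / 2))
      =O[atTop] fun t : ℝ => t ^ (-α - 2) := by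
  -- The constant is the integral of the bound in `norm_rayFun_sub_le`, with decay rate `t/2` and
  -- the power of `t` taken out.
  refine IsBigO.of_bound (α * 2 ^ (α - 1) * (Real.Gamma (α + 2) * (1 / 2) ^ (-α - 2))) ?_
  filter_upwards [eventually_ge_atTop α] with t ht
  have ht0 : 0 < t := by linarith
  set c : ℂ := Complex.exp ((t - Real.pi * (α + 1) / 2 : ℝ) * Complex.I)
  have hmain : 2 ^ α * Real.Gamma (α + 1) * t ^ (-α - 1) * Real.cos (t - Real.pi * (α + 1) / 2) =
      (c * ∫ y in Set.Ioi (0 : ℝ), ((2 ^ α * (y ^ α * Real.exp (-t * y)) : ℝ) : ℂ)).re := by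
    rw [integral_complex_ofReal, integral_const_mul, integral_rpow_mul_exp_neg (by linarith) ht0,
      Complex.re_mul_ofReal, Complex.exp_ofReal_mul_I_re]
    ring
  have h1 : IntegrableOn (fun y : ℝ => ((2 ^ α * (y ^ α * Real.exp (-t * y)) : ℝ) : ℂ))
      (Set.Ioi 0) :=
    ((integrableOn_rpow_mul_exp_neg (by linarith : -1 < α) ht0).const_mul (2 ^ α)).ofReal
  rw [hmain, integral_cos_eq_re_rayFun hα ht, ← Complex.sub_re, ← mul_sub,
    ← integral_sub (integrableOn_rayFun hα ht) h1, Real.norm_eq_abs, Real.norm_eq_abs]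
  refine (Complex.abs_re_le_norm _).trans ?_
  rw [norm_mul, Complex.norm_exp_ofReal_mul_I, one_mul]
  have hInt := (integrableOn_rpow_mul_exp_neg (by linarith : -1 < α + 1)
      (by linarith : 0 < t / 2)).const_mul (α * 2 ^ (α - 1))
  refine (norm_integral_le_of_norm_le hInt ?_).trans_eq ?_
  · filter_upwards [ae_restrict_mem measurableSet_Ioi] with y hy
    exact norm_rayFun_sub_le hα ht hy
  · rw [integral_const_mul, integral_rpow_mul_exp_neg (by linarith) (by linarith),
      abs_of_pos (by positivity), show α + 1 + 1 = α + 2 by ring,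
      show -(α + 1) - 1 = -α - 2 by ring, div_eq_mul_one_div t,
      Real.mul_rpow ht0.le (by norm_num)]
    ring

/-- The leading term of `besselLam ν (z² / 4)` for large `z`. -/
noncomputable def lamMain (ν z : ℝ) : ℝ :=
  (√Real.pi)⁻¹ * (z / 2) ^ (-ν - 1 / 2) * Real.cos (z - ν * Real.pi / 2 - Real.pi / 4)

theorem lamMain_isBigO (ν : ℝ) : lamMain ν =O[atTop] fun z : ℝ => z ^ (-ν - 1 / 2) := by
  refine IsBigO.of_bound ((√Real.pi)⁻¹ * (1 / 2) ^ (-ν - 1 / 2)) ?_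
  filter_upwards [eventually_gt_atTop 0] with z hz
  have h1 : |Real.cos (z - ν * Real.pi / 2 - Real.pi / 4)| ≤ 1 := Real.abs_cos_le_one _
  rw [lamMain, norm_mul, Real.norm_of_nonneg (by positivity), Real.norm_eq_abs,
    Real.norm_of_nonneg (by positivity : 0 ≤ z ^ (-ν - 1 / 2)),
    div_eq_mul_one_div z, Real.mul_rpow hz.le (by norm_num)]
  refine (mul_le_of_le_one_right (by positivity) h1).trans_eq ?_
  ring

theorem besselLam_asymptotics_of_large {ν : ℝ} (hν : 3 / 2 ≤ ν) :
    (fun z : ℝ => besselLam ν (z ^ 2 / 4) - lamMain ν z) =O[atTop]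
      fun z : ℝ => z ^ (-ν - 3 / 2) := by
  have h := integral_cos_asymptotics (by linarith : 1 ≤ ν - 1 / 2)
  have hpi : 0 < √Real.pi := Real.sqrt_pos.2 Real.pi_pos
  have hG : 0 < Real.Gamma (ν - 1 / 2 + 1) := Real.Gamma_pos_of_pos (by linarith)
  have h2 := h.const_mul_left (2 / (√Real.pi * Real.Gamma (ν - 1 / 2 + 1)))
  rw [show -(ν - 1 / 2) - 2 = -ν - 3 / 2 by ring] at h2
  refine h2.congr' ?_ EventuallyEq.rfl
  filter_upwards [eventually_gt_atTop 0] with z hz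
  rw [integral_cos_eq_besselLam (by linarith), lamMain, mul_sub,
    show ν - 1 / 2 + 1 / 2 = ν by ring, show -(ν - 1 / 2) - 1 = -ν - 1 / 2 by ring,
    Real.div_rpow hz.le (by norm_num)]
  have e : (2 : ℝ) ^ (-ν - 1 / 2) = (2 * 2 ^ (ν - 1 / 2))⁻¹ := by
    rw [show -ν - 1 / 2 = -(ν - 1 / 2 + 1) by ring, Real.rpow_neg (by norm_num),
      Real.rpow_add_one (by norm_num), mul_comm]
  rw [e, show z - Real.pi * (ν - 1 / 2 + 1) / 2 = z - ν * Real.pi / 2 - Real.pi / 4 by ring]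
  generalize Real.Gamma (ν - 1 / 2 + 1) = G at hG ⊢
  field_simp

/-- Raising the order by 2 turns the phase by `π`. The leading term therefore obeys the three-term
recurrence with its middle term dropped, which is what the descent in `ν` needs. -/
theorem lamMain_add_two (ν : ℝ) {z : ℝ} (hz : 0 < z) :
    lamMain ν z = -(z ^ 2 / 4 * lamMain (ν + 2) z) := by
  have h1 : (z / 2) ^ (-ν - 1 / 2) = z ^ 2 / 4 * (z / 2) ^ (-(ν + 2) - 1 / 2) := by
    rw [show -ν - 1 / 2 = -(ν + 2) - 1 / 2 + (2 : ℕ) by push_cast; ring,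
      Real.rpow_add_natCast (by positivity)]
    ring
  have h2 : Real.cos (z - (ν + 2) * Real.pi / 2 - Real.pi / 4) =
      -Real.cos (z - ν * Real.pi / 2 - Real.pi / 4) := by
    rw [← Real.cos_sub_pi]; congr 1; ring
  rw [lamMain, lamMain, h1, h2]
  ring

theorem isBigO_rpow_of_le {s t : ℝ} (h : s ≤ t) :
    (fun z : ℝ => z ^ s) =O[atTop] fun z : ℝ => z ^ t := by
  refine IsBigO.of_bound 1 ?_
  filter_upwards [eventually_ge_atTop 1] with z hz
  have : 0 < z := by linarith
  rw [Real.norm_of_nonneg (by positivity), Real.norm_of_nonneg (by positivity), one_mul]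
  exact Real.rpow_le_rpow_of_exponent_le hz h

/-- The asymptotics of the Bessel function `J_ν`, for every real order `ν`. -/
theorem besselLam_asymptotics (ν : ℝ) :
    (fun z : ℝ => besselLam ν (z ^ 2 / 4) - lamMain ν z) =O[atTop]
      fun z : ℝ => z ^ (-ν - 3 / 2) := by
  -- Descent in the order: the recurrence expresses `Λ_ν` through orders `ν + 1` and `ν + 2`. The
  -- first is already of the size of the error, and the second carries the leading term.
  suffices H : ∀ n : ℕ, ∀ ν : ℝ, 3 / 2 - n ≤ ν →
      (fun z : ℝ => besselLam ν (z ^ 2 / 4) - lamMain ν z) =O[atTop]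
        fun z : ℝ => z ^ (-ν - 3 / 2) by
    obtain ⟨n, hn⟩ := exists_nat_ge (3 / 2 - ν)
    exact H n ν (by linarith)
  intro n
  induction n with
  | zero => intro ν hν; exact besselLam_asymptotics_of_large (by simpa using hν)
  | succ n ih =>
    intro ν hν
    push_cast at hν
    have h1 := ih (ν + 1) (by linarith)
    have h2 := ih (ν + 2) (by linarith)
    have h3 : (fun z : ℝ => besselLam (ν + 1) (z ^ 2 / 4)) =O[atTop]
        fun z : ℝ => z ^ (-ν - 3 / 2) := by
      have h4 := (h1.trans (isBigO_rpow_of_le (by linarith : -(ν + 1) - 3 / 2 ≤ -ν - 3 / 2))).add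
        ((lamMain_isBigO (ν + 1)).trans
          (isBigO_rpow_of_le (by linarith : -(ν + 1) - 1 / 2 ≤ -ν - 3 / 2)))
      simpa using h4
    have h5 : (fun z : ℝ => z ^ 2 / 4 * (besselLam (ν + 2) (z ^ 2 / 4) - lamMain (ν + 2) z))
        =O[atTop] fun z : ℝ => z ^ (-ν - 3 / 2) := by
      have h6 : (fun z : ℝ => z ^ 2 / 4) =O[atTop] fun z : ℝ => z ^ (2 : ℝ) := by
        refine IsBigO.of_bound 1 (Eventually.of_forall fun z => ?_)
        rw [Real.rpow_two, Real.norm_of_nonneg (by positivity),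
          Real.norm_of_nonneg (by positivity)]
        linarith [sq_nonneg z]
      refine (h6.mul h2).congr' EventuallyEq.rfl ?_
      filter_upwards [eventually_gt_atTop 0] with z hz
      rw [← Real.rpow_add hz]; congr 1; ring
    refine ((h3.const_mul_left (ν + 1)).sub h5).congr' ?_ EventuallyEq.rfl
    filter_upwards [eventually_gt_atTop 0] with z hz
    have h7 := besselLam_pred (ν + 1) (z ^ 2 / 4)
    rw [add_sub_cancel_right, show ν + 1 + 1 = ν + 2 by ring] at h7
    rw [h7, lamMain_add_two ν hz]
    ring

theorem besselLam_isBigO (ν : ℝ) :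
    (fun z : ℝ => besselLam ν (z ^ 2 / 4)) =O[atTop] fun z : ℝ => z ^ (-ν - 1 / 2) := by
  have h := ((besselLam_asymptotics ν).trans
    (isBigO_rpow_of_le (by linarith : -ν - 3 / 2 ≤ -ν - 1 / 2))).add (lamMain_isBigO ν)
  simpa using h

/-- Compactness handles `c ≤ x ≤ max c Z²`, and the asymptotics at `z = 2√x` handle the rest. The
result is an upper bound free of any threshold, usable uniformly in parameters. -/
theorem exists_besselLam_bound (ν : ℝ) {c : ℝ} (hc : 0 < c) :
    ∃ C : ℝ, 0 < C ∧ ∀ x : ℝ, c ≤ x → |besselLam ν x| ≤ C * x ^ (-ν / 2 - 1 / 4) := by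
  obtain ⟨C, hC0, hC⟩ := (besselLam_isBigO ν).exists_pos
  rw [isBigOWith_iff] at hC
  obtain ⟨Z, hZ⟩ := eventually_atTop.1 hC
  have hcont : ContinuousOn (fun x : ℝ => besselLam ν x * x ^ (ν / 2 + 1 / 4))
      (Set.Icc c (max c (Z ^ 2))) := by
    refine (continuous_besselLam ν).continuousOn.mul fun x hx => ?_
    exact (Real.continuousAt_rpow_const x _ (Or.inl (by linarith [hx.1]))).continuousWithinAt
  obtain ⟨B, hB⟩ := isCompact_Icc.exists_bound_of_continuousOn hcont
  have hid : ∀ x : ℝ, c ≤ x → x ^ (ν / 2 + 1 / 4) * x ^ (-ν / 2 - 1 / 4) = 1 := by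
    intro x hx
    rw [← Real.rpow_add (by linarith)]
    ring_nf; simp
  refine ⟨max 1 (max B (C * 2 ^ (-ν - 1 / 2))), by positivity, fun x hx => ?_⟩
  have hx0 : 0 < x := by linarith
  have hpos : 0 < x ^ (-ν / 2 - 1 / 4) := by positivity
  rcases le_or_gt x (max c (Z ^ 2)) with h | h
  · have h1 := hB x ⟨hx, h⟩
    rw [Real.norm_eq_abs, abs_mul, abs_of_pos (by positivity : 0 < x ^ (ν / 2 + 1 / 4))] at h1
    calc |besselLam ν x| = |besselLam ν x| * x ^ (ν / 2 + 1 / 4) * x ^ (-ν / 2 - 1 / 4) := by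
          rw [mul_assoc, hid x hx, mul_one]
      _ ≤ B * x ^ (-ν / 2 - 1 / 4) := by gcongr
      _ ≤ _ := by gcongr; exact (le_max_left _ _).trans (le_max_right _ _)
  · have hZx : Z ≤ 2 * √x := by
      have h2 : Z ^ 2 < x := (le_max_right _ _).trans_lt h
      have h3 : Z ≤ √x := Real.le_sqrt_of_sq_le h2.le
      linarith [Real.sqrt_nonneg x]
    have h1 := hZ (2 * √x) hZx
    rw [show (2 * √x) ^ 2 / 4 = x by rw [mul_pow, Real.sq_sqrt hx0.le]; ring,
      Real.norm_eq_abs, Real.norm_of_nonneg (by positivity),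
      Real.mul_rpow (by norm_num) (by positivity), Real.sqrt_eq_rpow, ← Real.rpow_mul hx0.le,
      show (1 / 2 : ℝ) * (-ν - 1 / 2) = -ν / 2 - 1 / 4 by ring, ← mul_assoc] at h1
    refine h1.trans ?_
    gcongr
    exact (le_max_right _ _).trans (le_max_right _ _)


/-! ### Fourier transforms of radial functions -/

theorem nontrivial_E {d : ℕ} (hd : 1 ≤ d) : Nontrivial (E d) := by
  have : Nonempty (Fin d) := ⟨⟨0, hd⟩⟩
  infer_instance

/-- Integration in polar coordinates. -/
theorem integral_polar {d : ℕ} (hd : 1 ≤ d) {F : E d → ℝ} (hF : Integrable F) :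
    ∫ x, F x = ∫ r in Set.Ioi (0 : ℝ), r ^ (d - 1) *
      ∫ w, F (r • (w : E d)) ∂(volume : Measure (E d)).toSphere := by
  have := nontrivial_E hd
  set μ : Measure (E d) := volume with hμ
  set G : Metric.sphere (0 : E d) 1 × Set.Ioi (0 : ℝ) → ℝ :=
    fun p => F ((p.2 : ℝ) • (p.1 : E d)) with hG
  have hGF : ∀ x : ({(0 : E d)}ᶜ : Set (E d)), G (homeomorphUnitSphereProd (E d) x) = F x := by
    intro x
    have hx : ‖(x : E d)‖ ≠ 0 := norm_ne_zero_iff.2 x.2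
    simp only [hG, homeomorphUnitSphereProd_apply_snd_coe, homeomorphUnitSphereProd_apply_fst_coe]
    rw [smul_smul, mul_inv_cancel₀ hx, one_smul]
  have hmp := μ.measurePreserving_homeomorphUnitSphereProd
  have hemb := (homeomorphUnitSphereProd (E d)).measurableEmbedding
  have hInt : Integrable G (μ.toSphere.prod (.volumeIoiPow (Module.finrank ℝ (E d) - 1))) := by
    rw [← hmp.integrable_comp_emb hemb]
    have : G ∘ homeomorphUnitSphereProd (E d) = F ∘ Subtype.val := funext hGF
    rw [this, ← integrableOn_iff_comap_subtypeVal (by measurability)]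
    exact hF.integrableOn
  have hfin : Module.finrank ℝ (E d) = d := by simp
  calc ∫ x, F x = ∫ x : ({(0)}ᶜ : Set (E d)), F x.1 ∂(μ.comap (↑)) := by
        rw [integral_subtype_comap (measurableSet_singleton _).compl fun x => F x,
          restrict_compl_singleton]
    _ = ∫ p, G p ∂(μ.toSphere.prod (.volumeIoiPow (Module.finrank ℝ (E d) - 1))) := by
        rw [← hmp.integral_comp hemb]
        exact integral_congr_ae (Eventually.of_forall fun x => (hGF x).symm)
    _ = ∫ r : Set.Ioi (0 : ℝ), (∫ w, F ((r : ℝ) • (w : E d)) ∂μ.toSphere)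
          ∂(.volumeIoiPow (Module.finrank ℝ (E d) - 1)) := integral_prod_symm G hInt
    _ = _ := by
        rw [hfin]
        simp only [Measure.volumeIoiPow, ENNReal.ofReal]
        rw [integral_withDensity_eq_integral_smul,
          integral_subtype_comap measurableSet_Ioi fun r : ℝ => Real.toNNReal (r ^ (d - 1)) •
            ∫ w, F (r • (w : E d)) ∂μ.toSphere]
        · refine setIntegral_congr_fun measurableSet_Ioi fun r hr => ?_
          simp only [NNReal.smul_def, smul_eq_mul]
          rw [Real.coe_toNNReal _ (pow_nonneg (Set.mem_Ioi.1 hr).le _)]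
        · exact (measurable_subtype_coe.pow_const _).real_toNNReal

theorem integral_pow_mul_exp_neg_sq (n : ℕ) :
    ∫ x in Set.Ioi (0 : ℝ), x ^ n * Real.exp (-x ^ 2) = Real.Gamma (((n : ℝ) + 1) / 2) / 2 := by
  have h := integral_rpow_mul_exp_neg_rpow (p := 2) (q := n) two_pos
    (by have : (0 : ℝ) ≤ n := Nat.cast_nonneg n
        linarith)
  simp only [Real.rpow_natCast, Real.rpow_two] at h
  rw [h]; ring

theorem integral_even_pow_mul_exp_neg_sq (k : ℕ) :
    ∫ x : ℝ, x ^ (2 * k) * Real.exp (-x ^ 2) = Real.Gamma (k + 1 / 2) := by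
  have h := integral_comp_abs (f := fun x : ℝ => x ^ (2 * k) * Real.exp (-x ^ 2))
  rw [integral_pow_mul_exp_neg_sq] at h
  have e : ∀ x : ℝ, |x| ^ (2 * k) * Real.exp (-|x| ^ 2) = x ^ (2 * k) * Real.exp (-x ^ 2) := by
    intro x
    rw [sq_abs, pow_mul, sq_abs, ← pow_mul]
  simp only [e] at h
  rw [h, show (((2 * k : ℕ) : ℝ) + 1) / 2 = k + 1 / 2 by push_cast; ring]
  ring

theorem integrable_even_pow_mul_exp_neg_sq (k : ℕ) :
    Integrable fun x : ℝ => x ^ (2 * k) * Real.exp (-x ^ 2) := by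
  refine Integrable.of_integral_ne_zero ?_
  rw [integral_even_pow_mul_exp_neg_sq]
  exact (Real.Gamma_pos_of_pos (by positivity)).ne'

theorem gaussian_coord_moment {d : ℕ} (i : Fin d) (k : ℕ) :
    Integrable (fun x : E d => x i ^ (2 * k) * Real.exp (-‖x‖ ^ 2)) ∧
    ∫ x : E d, x i ^ (2 * k) * Real.exp (-‖x‖ ^ 2) =
      Real.Gamma (k + 1 / 2) * √Real.pi ^ (d - 1) := by
  set f : Fin d → ℝ → ℝ := fun j x => x ^ (2 * (if j = i then k else 0)) * Real.exp (-x ^ 2)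
    with hf
  have hprod : ∀ x : E d, x i ^ (2 * k) * Real.exp (-‖x‖ ^ 2) = ∏ j, f j (x j) := by
    intro x
    simp only [hf]
    rw [Finset.prod_mul_distrib, ← Real.exp_sum, EuclideanSpace.real_norm_sq_eq,
      Finset.sum_neg_distrib]
    congr 1
    rw [Finset.prod_eq_single i]
    · simp
    · intro j _ hj; simp [hj]
    · simp
  have hmp := PiLp.volume_preserving_ofLp (Fin d)
  have hemb : MeasurableEmbedding (WithLp.ofLp : E d → Fin d → ℝ) :=
    (MeasurableEquiv.toLp 2 (Fin d → ℝ)).symm.measurableEmbedding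
  have hfi : ∀ j, Integrable (f j) := fun j => integrable_even_pow_mul_exp_neg_sq _
  constructor
  · have h1 : Integrable (fun y : Fin d → ℝ => ∏ j, f j (y j)) := Integrable.fintype_prod hfi
    have h2 := (hmp.integrable_comp_emb hemb).2 h1
    exact h2.congr (Eventually.of_forall fun x => (hprod x).symm)
  · simp_rw [hprod]
    have h3 := hmp.integral_comp hemb (fun y : Fin d → ℝ => ∏ j, f j (y j))
    rw [h3, integral_fintype_prod_volume_eq_prod f]
    simp only [hf, integral_even_pow_mul_exp_neg_sq]
    rw [← Finset.mul_prod_erase Finset.univ _ (Finset.mem_univ i)]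
    congr 1
    · simp
    · rw [Finset.prod_congr rfl (g := fun _ => √Real.pi)]
      · simp
      · intro j hj
        rw [if_neg (Finset.ne_of_mem_erase hj)]
        simpa using Real.Gamma_one_half_eq

/-- A reflection preserving the measure and the norm carries `y` to a multiple of a basis vector,
and the Gaussian moment of one coordinate factorizes. -/
theorem gaussian_inner_moment {d : ℕ} (hd : 1 ≤ d) (y : E d) (k : ℕ) :
    Integrable (fun x : E d => (inner ℝ x y : ℝ) ^ (2 * k) * Real.exp (-‖x‖ ^ 2)) ∧
    ∫ x : E d, (inner ℝ x y : ℝ) ^ (2 * k) * Real.exp (-‖x‖ ^ 2) =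
      ‖y‖ ^ (2 * k) * (Real.Gamma (k + 1 / 2) * √Real.pi ^ (d - 1)) := by
  set i : Fin d := ⟨0, hd⟩
  set w : E d := EuclideanSpace.single i ‖y‖ with hw
  have hnorm : ‖y‖ = ‖w‖ := by simp [hw]
  set L := ((ℝ ∙ (y - w))ᗮ).reflection with hL
  have hLy : L y = w := Submodule.reflection_sub hnorm
  have hmp : MeasurePreserving L volume volume := L.measurePreserving
  have hemb : MeasurableEmbedding L := L.toHomeomorph.measurableEmbedding
  obtain ⟨h1, h2⟩ := gaussian_coord_moment i k
  have e : ∀ x : E d, (inner ℝ x y : ℝ) ^ (2 * k) * Real.exp (-‖x‖ ^ 2) =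
      ‖y‖ ^ (2 * k) * ((L x) i ^ (2 * k) * Real.exp (-‖L x‖ ^ 2)) := by
    intro x
    rw [← L.inner_map_map x y, hLy, L.norm_map, hw, EuclideanSpace.inner_single_right]
    simp [mul_pow, mul_assoc]
  simp_rw [e]
  constructor
  · exact ((hmp.integrable_comp_emb hemb).2 h1).const_mul _
  · rw [integral_const_mul]
    have h3 := hmp.integral_comp hemb (fun x : E d => x i ^ (2 * k) * Real.exp (-‖x‖ ^ 2))
    rw [h3, h2]

/-- In polar coordinates the Gaussian moment is the sphere moment times a radial Gamma integral;
dividing avoids any parametrization of the sphere. -/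
theorem sphere_moment {d : ℕ} (hd : 1 ≤ d) (y : E d) (k : ℕ) :
    ∫ w : Metric.sphere (0 : E d) 1, (inner ℝ (w : E d) y : ℝ) ^ (2 * k)
        ∂(volume : Measure (E d)).toSphere =
      2 * ‖y‖ ^ (2 * k) * (Real.Gamma (k + 1 / 2) * √Real.pi ^ (d - 1)) /
        Real.Gamma ((d : ℝ) / 2 + k) := by
  obtain ⟨h1, h2⟩ := gaussian_inner_moment hd y k
  rw [integral_polar hd h1] at h2
  set M := ∫ w : Metric.sphere (0 : E d) 1, (inner ℝ (w : E d) y : ℝ) ^ (2 * k)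
        ∂(volume : Measure (E d)).toSphere with hM
  have e : ∀ r ∈ Set.Ioi (0 : ℝ), r ^ (d - 1) * ∫ w : Metric.sphere (0 : E d) 1,
      (inner ℝ (r • (w : E d)) y : ℝ) ^ (2 * k) * Real.exp (-‖r • (w : E d)‖ ^ 2)
        ∂(volume : Measure (E d)).toSphere =
      (r ^ (d - 1 + 2 * k) * Real.exp (-r ^ 2)) * M := by
    intro r hr
    have : ∀ w : Metric.sphere (0 : E d) 1, (inner ℝ (r • (w : E d)) y : ℝ) ^ (2 * k) *
        Real.exp (-‖r • (w : E d)‖ ^ 2) =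
        r ^ (2 * k) * Real.exp (-r ^ 2) * (inner ℝ (w : E d) y : ℝ) ^ (2 * k) := by
      intro w
      have hw : ‖(w : E d)‖ = 1 := by simp
      rw [norm_smul, hw, mul_one, Real.norm_eq_abs, sq_abs, real_inner_smul_left, mul_pow]
      ring
    simp_rw [this]
    rw [integral_const_mul, pow_add]
    ring
  rw [setIntegral_congr_fun measurableSet_Ioi e, integral_mul_const,
    integral_pow_mul_exp_neg_sq] at h2
  have e2 : (((d - 1 + 2 * k : ℕ) : ℝ) + 1) / 2 = (d : ℝ) / 2 + k := by
    push_cast [Nat.cast_sub hd]; ring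
  have hd1 : (1 : ℝ) ≤ d := by exact_mod_cast hd
  have hG : 0 < Real.Gamma ((d : ℝ) / 2 + k) := Real.Gamma_pos_of_pos (by positivity)
  rw [e2] at h2
  rw [eq_div_iff hG.ne']
  linear_combination 2 * h2

theorem sphere_cos_integral {d : ℕ} (hd : 1 ≤ d) (y : E d) :
    ∫ w : Metric.sphere (0 : E d) 1, Real.cos (inner ℝ (w : E d) y)
        ∂(volume : Measure (E d)).toSphere =
      2 * Real.pi ^ ((d : ℝ) / 2) * besselLam ((d : ℝ) / 2 - 1) (‖y‖ ^ 2 / 4) := by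
  set σ := (volume : Measure (E d)).toSphere
  have hd1 : (1 : ℝ) ≤ d := by exact_mod_cast hd
  have hcont : ∀ n : ℕ, Continuous fun w : Metric.sphere (0 : E d) 1 =>
      (inner ℝ (w : E d) y : ℝ) ^ n := fun n =>
    (continuous_subtype_val.inner continuous_const).pow n
  have hInt : ∀ k : ℕ, Integrable (fun w : Metric.sphere (0 : E d) 1 =>
      (-1) ^ k * (inner ℝ (w : E d) y : ℝ) ^ (2 * k) / (2 * k).factorial) σ := fun k =>
    (((hcont _).const_mul _).div_const _).integrable_of_hasCompactSupport
      (HasCompactSupport.of_compactSpace _)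
  have hpi : √Real.pi ^ (d - 1) * √Real.pi = Real.pi ^ ((d : ℝ) / 2) := by
    rw [← pow_succ, Nat.sub_add_cancel hd, Real.sqrt_eq_rpow, ← Real.rpow_natCast,
      ← Real.rpow_mul Real.pi_pos.le]
    ring_nf
  have hterm : ∀ k : ℕ, ∫ w : Metric.sphere (0 : E d) 1,
      (-1) ^ k * (inner ℝ (w : E d) y : ℝ) ^ (2 * k) / (2 * k).factorial ∂σ =
      2 * Real.pi ^ ((d : ℝ) / 2) * (lamCoeff ((d : ℝ) / 2 - 1) k * (‖y‖ ^ 2 / 4) ^ k) := by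
    intro k
    have h1 := Gamma_nat_add_half_div_factorial k
    have hG : 0 < Real.Gamma ((d : ℝ) / 2 + k) := Real.Gamma_pos_of_pos (by positivity)
    rw [integral_div, integral_const_mul, sphere_moment hd, ← hpi, lamCoeff,
      show (d : ℝ) / 2 - 1 + k + 1 = (d : ℝ) / 2 + k by ring]
    calc _ = (-1) ^ k * (2 * ‖y‖ ^ (2 * k) * √Real.pi ^ (d - 1) *
          (Real.Gamma (k + 1 / 2) / (2 * k).factorial)) / Real.Gamma ((d : ℝ) / 2 + k) := by
          ring
      _ = _ := by
          rw [h1, div_pow, ← pow_mul]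
          field_simp
  have hsum : Summable fun k : ℕ => ∫ w : Metric.sphere (0 : E d) 1,
      ‖(-1) ^ k * (inner ℝ (w : E d) y : ℝ) ^ (2 * k) / (2 * k).factorial‖ ∂σ := by
    have e : ∀ k : ℕ, ∫ w : Metric.sphere (0 : E d) 1,
        ‖(-1) ^ k * (inner ℝ (w : E d) y : ℝ) ^ (2 * k) / (2 * k).factorial‖ ∂σ =
        2 * Real.pi ^ ((d : ℝ) / 2) * (|lamCoeff ((d : ℝ) / 2 - 1) k| * |‖y‖ ^ 2 / 4| ^ k) := by
      intro k
      -- Even powers are nonnegative, so the norm of a term is the term times `(-1)^k`, and the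
      -- norms sum to the series with absolute coefficients.
      have h0 : ∀ w : Metric.sphere (0 : E d) 1,
          ‖(-1) ^ k * (inner ℝ (w : E d) y : ℝ) ^ (2 * k) / (2 * k).factorial‖ =
          (-1) ^ k * ((-1) ^ k * (inner ℝ (w : E d) y : ℝ) ^ (2 * k) / (2 * k).factorial) := by
        intro w
        have h2 : (0 : ℝ) ≤ (inner ℝ (w : E d) y : ℝ) ^ (2 * k) := by
          rw [pow_mul]; positivity
        have h3 : ((-1 : ℝ) ^ k) * (-1) ^ k = 1 := by rw [← mul_pow]; simp
        rw [norm_div, norm_mul, norm_pow, norm_neg, norm_one, one_pow, one_mul,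
          Real.norm_of_nonneg h2, RCLike.norm_natCast]
        linear_combination (-((inner ℝ (w : E d) y : ℝ) ^ (2 * k) / (2 * k).factorial)) * h3
      simp_rw [h0]
      rw [integral_const_mul, hterm]
      have hG : 0 < Real.Gamma ((d : ℝ) / 2 - 1 + k + 1) := Real.Gamma_pos_of_pos (by
        have : (0 : ℝ) ≤ k := Nat.cast_nonneg k
        linarith)
      have h4 : |lamCoeff ((d : ℝ) / 2 - 1) k| = (-1) ^ k * lamCoeff ((d : ℝ) / 2 - 1) k := by
        have h3 : ((-1 : ℝ) ^ k) * (-1) ^ k = 1 := by rw [← mul_pow]; simp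
        rw [lamCoeff, abs_div, abs_pow, abs_neg, abs_one, one_pow, abs_of_pos (by positivity),
          mul_div_assoc', h3]
      rw [h4, abs_of_nonneg (by positivity)]
      ring
    simp_rw [e]
    exact (summable_abs_lamCoeff _ _).mul_left _
  have h := hasSum_integral_of_summable_integral_norm hInt hsum
  simp only [hterm] at h
  rw [besselLam, ← tsum_mul_left, h.tsum_eq]
  refine integral_congr_ae (Eventually.of_forall fun w => ?_)
  exact (Real.hasSum_cos _).tsum_eq.symm

/-- The Fourier transform of an integrable radial function. -/
theorem integral_radial_mul_cos {d : ℕ} (hd : 1 ≤ d) {h : ℝ → ℝ}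
    (hh : Integrable fun x : E d => h ‖x‖) (y : E d) :
    ∫ x : E d, h ‖x‖ * Real.cos (2 * Real.pi * inner ℝ x y) =
      2 * Real.pi ^ ((d : ℝ) / 2) * ∫ r in Set.Ioi (0 : ℝ), h r * (r ^ (d - 1) *
        besselLam ((d : ℝ) / 2 - 1) (Real.pi ^ 2 * ‖y‖ ^ 2 * r ^ 2)) := by
  have hInt : Integrable fun x : E d => h ‖x‖ * Real.cos (2 * Real.pi * inner ℝ x y) := by
    refine hh.mul_bdd (c := 1) ?_ ?_
    · exact (Real.continuous_cos.comp
        (continuous_const.mul (continuous_id.inner continuous_const))).aestronglyMeasurable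
    · exact Eventually.of_forall fun x => Real.abs_cos_le_one _
  rw [integral_polar hd hInt, ← integral_const_mul]
  refine setIntegral_congr_fun measurableSet_Ioi fun r hr => ?_
  have hr : 0 < r := hr
  have e : ∀ w : Metric.sphere (0 : E d) 1, h ‖r • (w : E d)‖ *
      Real.cos (2 * Real.pi * inner ℝ (r • (w : E d)) y) =
      h r * Real.cos (inner ℝ (w : E d) ((2 * Real.pi * r) • y)) := by
    intro w
    have hw : ‖(w : E d)‖ = 1 := by simp
    rw [norm_smul, hw, mul_one, Real.norm_of_nonneg hr.le, real_inner_smul_left,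
      real_inner_smul_right, ← mul_assoc]
  simp_rw [e]
  rw [integral_const_mul, sphere_cos_integral hd, norm_smul, Real.norm_of_nonneg (by positivity),
    show (2 * Real.pi * r * ‖y‖) ^ 2 / 4 = Real.pi ^ 2 * ‖y‖ ^ 2 * r ^ 2 by ring]
  ring


/-! ### The Fourier transform of the bump and its spherical partial integrals -/

/-- The radial profile of `bump β a`. -/
noncomputable def bumpProfile (β a r : ℝ) : ℝ := if r < a then (a ^ 2 - r ^ 2) ^ β else 0

theorem bump_eq_profile {d : ℕ} (β a : ℝ) (x : E d) : bump β a x = bumpProfile β a ‖x‖ := rfl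

theorem bump_neg {d : ℕ} (β a : ℝ) (x : E d) : bump β a (-x) = bump β a x := by
  simp [bump_eq_profile]

theorem integral_bumpProfile_mul (β a : ℝ) (f : ℝ → ℝ) :
    ∫ r in Set.Ioi (0 : ℝ), bumpProfile β a r * f r =
      ∫ r in Set.Ioo (0 : ℝ) a, (a ^ 2 - r ^ 2) ^ β * f r := by
  have e : Set.Ioo (0 : ℝ) a = Set.Ioi 0 ∩ Set.Iio a := rfl
  rw [e, ← setIntegral_indicator measurableSet_Iio]
  refine setIntegral_congr_fun measurableSet_Ioi fun r _ => ?_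
  by_cases hr : r < a <;> simp [bumpProfile, hr]

theorem integrable_bump {d : ℕ} (hd : 1 ≤ d) {β a : ℝ} (hβ : -1 < β) (ha : 0 < a) :
    Integrable (bump β a : E d → ℝ) := by
  have := nontrivial_E hd
  have h := (integrable_fun_norm_addHaar (E := E d) volume (f := bumpProfile β a)).2 ?_
  · exact h
  · have h1 := integrableOn_ball_rpow_mul_pow hβ ha (d - 1)
    have e : Set.Ioo (0 : ℝ) a = Set.Ioi 0 ∩ Set.Iio a := rfl
    rw [IntegrableOn, e, Set.inter_comm, ← Measure.restrict_restrict measurableSet_Iio,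
      ← IntegrableOn, ← integrable_indicator_iff measurableSet_Iio] at h1
    refine h1.congr (Eventually.of_forall fun r => ?_)
    have hfin : Module.finrank ℝ (E d) = d := by simp
    simp only [hfin, smul_eq_mul]
    by_cases hr : r < a <;> simp [bumpProfile, hr, mul_comm]

/-- The constant in front of the Fourier transform of `bump β a`. -/
noncomputable def hatConst (d : ℕ) (β a : ℝ) : ℝ :=
  Real.Gamma (β + 1) * Real.pi ^ ((d : ℝ) / 2) * a ^ (2 * β + d)

/-- The radial profile of the Fourier transform of `bump β a`. -/
noncomputable def bumpHat (d : ℕ) (β a t : ℝ) : ℝ :=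
  hatConst d β a * besselLam ((d : ℝ) / 2 + β) (Real.pi ^ 2 * a ^ 2 * t ^ 2)

theorem continuous_bumpHat (d : ℕ) (β a : ℝ) : Continuous (bumpHat d β a) :=
  continuous_const.mul ((continuous_besselLam _).comp (by fun_prop))

theorem integral_bump_mul_cos {d : ℕ} (hd : 1 ≤ d) {β a : ℝ} (hβ : -1 < β) (ha : 0 < a) (y : E d) :
    ∫ x : E d, bump β a x * Real.cos (2 * Real.pi * inner ℝ x y) = bumpHat d β a ‖y‖ := by
  simp_rw [bump_eq_profile]
  rw [integral_radial_mul_cos hd (integrable_bump hd hβ ha), integral_bumpProfile_mul,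
    integral_ball_rpow_mul_besselLam hβ ha hd, bumpHat, hatConst,
    show Real.pi ^ 2 * ‖y‖ ^ 2 * a ^ 2 = Real.pi ^ 2 * a ^ 2 * ‖y‖ ^ 2 by ring]
  ring

/-- The sine part is odd and integrates to 0, so all transforms below can be treated as real cosine
integrals. -/
theorem integral_even_mul_cexp {d : ℕ} {F : E d → ℝ} (hF : Integrable F) (hev : ∀ x, F (-x) = F x)
    (y : E d) :
    ∫ x : E d, (F x : ℂ) * Complex.exp ((2 * Real.pi * inner ℝ x y : ℝ) * Complex.I) =
      ((∫ x : E d, F x * Real.cos (2 * Real.pi * inner ℝ x y) : ℝ) : ℂ) := by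
  have hθ : Continuous fun x : E d => 2 * Real.pi * (inner ℝ x y : ℝ) :=
    continuous_const.mul (continuous_id.inner continuous_const)
  have hc : Integrable fun x : E d => F x * Real.cos (2 * Real.pi * inner ℝ x y) :=
    hF.mul_bdd (c := 1) (Real.continuous_cos.comp hθ).aestronglyMeasurable
      (Eventually.of_forall fun x => Real.abs_cos_le_one _)
  have hs : Integrable fun x : E d => F x * Real.sin (2 * Real.pi * inner ℝ x y) :=
    hF.mul_bdd (c := 1) (Real.continuous_sin.comp hθ).aestronglyMeasurable
      (Eventually.of_forall fun x => Real.abs_sin_le_one _)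
  have hodd : ∫ x : E d, F x * Real.sin (2 * Real.pi * inner ℝ x y) = 0 := by
    have h := integral_neg_eq_self (fun x : E d => F x * Real.sin (2 * Real.pi * inner ℝ x y))
      volume
    simp only [hev, inner_neg_left, mul_neg, Real.sin_neg, integral_neg] at h
    linarith
  have e : ∀ x : E d, (F x : ℂ) * Complex.exp ((2 * Real.pi * inner ℝ x y : ℝ) * Complex.I) =
      ((F x * Real.cos (2 * Real.pi * inner ℝ x y) : ℝ) : ℂ) +
      ((F x * Real.sin (2 * Real.pi * inner ℝ x y) : ℝ) : ℂ) * Complex.I := by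
    intro x
    rw [Complex.exp_mul_I, ← Complex.ofReal_cos, ← Complex.ofReal_sin]
    push_cast
    ring
  simp_rw [e]
  rw [integral_add hc.ofReal (hs.ofReal.mul_const _), integral_mul_const, integral_complex_ofReal,
    integral_complex_ofReal, hodd]
  simp

theorem fourier_even {d : ℕ} {F : E d → ℝ} (hF : Integrable F) (hev : ∀ x, F (-x) = F x)
    (y : E d) :
    𝓕 (fun x : E d => (F x : ℂ)) y =
      ((∫ x : E d, F x * Real.cos (2 * Real.pi * inner ℝ x y) : ℝ) : ℂ) := by
  have h := integral_even_mul_cexp hF hev (-y)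
  simp only [inner_neg_right, mul_neg, Real.cos_neg] at h
  rw [← h, Real.fourier_eq']
  refine integral_congr_ae (Eventually.of_forall fun x => ?_)
  simp only [smul_eq_mul]
  rw [mul_comm]
  congr 3
  push_cast
  ring

theorem fourier_bump {d : ℕ} (hd : 1 ≤ d) {β a : ℝ} (hβ : -1 < β) (ha : 0 < a) (y : E d) :
    𝓕 (fun x : E d => (bump β a x : ℂ)) y = (bumpHat d β a ‖y‖ : ℂ) := by
  rw [fourier_even (integrable_bump hd hβ ha) (bump_neg β a), integral_bump_mul_cos hd hβ ha]

/-- The basic product integral `∫₀ˡ 2 r^(d-1) Λ_ν(p r²) Λ_{d/2-1}(q r²) dr`. -/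
noncomputable def lamInt (d : ℕ) (ν p q l : ℝ) : ℝ :=
  ∫ r in (0 : ℝ)..l, 2 * (r ^ (d - 1) * (besselLam ν (p * r ^ 2) *
    besselLam ((d : ℝ) / 2 - 1) (q * r ^ 2)))

theorem continuous_lamInt_integrand (d : ℕ) (ν p q : ℝ) :
    Continuous fun r : ℝ => 2 * (r ^ (d - 1) * (besselLam ν (p * r ^ 2) *
      besselLam ((d : ℝ) / 2 - 1) (q * r ^ 2))) := by
  have h1 : Continuous fun r : ℝ => besselLam ν (p * r ^ 2) :=
    (continuous_besselLam ν).comp (by fun_prop)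
  have h2 : Continuous fun r : ℝ => besselLam ((d : ℝ) / 2 - 1) (q * r ^ 2) :=
    (continuous_besselLam _).comp (by fun_prop)
  fun_prop

/-- The spherical partial integral of `bump β a` at a point of norm `ρ`. -/
noncomputable def sigmaBall (d : ℕ) (β a ρ l : ℝ) : ℝ :=
  hatConst d β a * Real.pi ^ ((d : ℝ) / 2) *
    lamInt d ((d : ℝ) / 2 + β) (Real.pi ^ 2 * a ^ 2) (Real.pi ^ 2 * ρ ^ 2) l

theorem integrable_indicator_Iio_norm {d : ℕ} {f : ℝ → ℝ} (hf : Continuous f) (l : ℝ) :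
    Integrable fun x : E d => (Set.Iio l).indicator f ‖x‖ := by
  have e : (fun x : E d => (Set.Iio l).indicator f ‖x‖) =
      (Metric.ball (0 : E d) l).indicator fun x => f ‖x‖ := by
    ext x
    simp [Set.indicator]
  rw [e, integrable_indicator_iff measurableSet_ball]
  exact ((hf.comp continuous_norm).continuousOn.integrableOn_compact
    (isCompact_closedBall (0 : E d) l)).mono_set Metric.ball_subset_closedBall

theorem setIntegral_ball_bumpHat_mul_cos {d : ℕ} (hd : 1 ≤ d) (β a : ℝ) {l : ℝ} (hl : 0 ≤ l)
    (y : E d) :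
    ∫ x in Metric.ball (0 : E d) l, bumpHat d β a ‖x‖ * Real.cos (2 * Real.pi * inner ℝ x y) =
      sigmaBall d β a ‖y‖ l := by
  rw [← integral_indicator measurableSet_ball]
  have e : ∀ x : E d, (Metric.ball (0 : E d) l).indicator (fun x : E d => bumpHat d β a ‖x‖ *
      Real.cos (2 * Real.pi * inner ℝ x y)) x =
      (Set.Iio l).indicator (bumpHat d β a) ‖x‖ * Real.cos (2 * Real.pi * inner ℝ x y) := by
    intro x
    by_cases hx : ‖x‖ < l <;> simp [Set.indicator, hx]
  simp_rw [e]
  rw [integral_radial_mul_cos hd (integrable_indicator_Iio_norm (continuous_bumpHat d β a) l),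
    sigmaBall, lamInt, intervalIntegral.integral_of_le hl, integral_Ioc_eq_integral_Ioo]
  have e2 : Set.Ioo (0 : ℝ) l = Set.Ioi 0 ∩ Set.Iio l := rfl
  rw [e2, ← setIntegral_indicator measurableSet_Iio, ← integral_const_mul, ← integral_const_mul]
  refine setIntegral_congr_fun measurableSet_Ioi fun r _ => ?_
  by_cases hr : r < l
  · simp only [Set.indicator, Set.mem_Iio, hr, if_true, bumpHat]
    ring
  · simp [Set.indicator, hr]

theorem partialIntegral_bump_zero {d : ℕ} (hd : 1 ≤ d) {β a : ℝ} (hβ : -1 < β) (ha : 0 < a)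
    {l : ℝ} (hl : 0 ≤ l) :
    partialIntegral l (bump β a) (0 : E d) = (sigmaBall d β a 0 l : ℂ) := by
  have h := setIntegral_ball_bumpHat_mul_cos hd β a hl (0 : E d)
  rw [norm_zero] at h
  rw [← h, partialIntegral, ← integral_complex_ofReal]
  refine integral_congr_ae (Eventually.of_forall fun x => ?_)
  simp [fourier_bump hd hβ ha]


/-! ### The Green identity for spherical partial integrals -/

/-- The first boundary term. -/
noncomputable def lamX (d : ℕ) (ν p q l : ℝ) : ℝ :=
  l ^ d * (besselLam (ν + 1) (p * l ^ 2) * besselLam ((d : ℝ) / 2 - 1) (q * l ^ 2))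

/-- The second boundary term. -/
noncomputable def lamY (d : ℕ) (ν p q l : ℝ) : ℝ :=
  l ^ d * (besselLam ν (p * l ^ 2) * besselLam ((d : ℝ) / 2) (q * l ^ 2))

theorem hasDerivAt_besselLam_mul_sq (ν p r : ℝ) :
    HasDerivAt (fun r : ℝ => besselLam ν (p * r ^ 2))
      (-besselLam (ν + 1) (p * r ^ 2) * (2 * p * r)) r := by
  have h1 : HasDerivAt (fun r : ℝ => p * r ^ 2) (2 * p * r) r := by
    have := (hasDerivAt_pow 2 r).const_mul p
    refine this.congr_deriv ?_
    simp; ring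
  exact (hasDerivAt_besselLam ν (p * r ^ 2)).comp r h1

/-- The mixed products of orders `ν + 1` and `d/2` cancel, and the recurrence in each factor removes
the orders `ν + 2` and `d/2 + 1`. -/
theorem hasDerivAt_boundary {d : ℕ} (hd : 1 ≤ d) (ν p q r : ℝ) :
    HasDerivAt (fun l => p * lamX d ν p q l - q * lamY d ν p q l)
      (p * ((d : ℝ) / 2 - ν - 1) * (2 * (r ^ (d - 1) * (besselLam (ν + 1) (p * r ^ 2) *
        besselLam ((d : ℝ) / 2 - 1) (q * r ^ 2)))) +
      (p - q) * (2 * (r ^ (d - 1) * (besselLam ν (p * r ^ 2) *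
        besselLam ((d : ℝ) / 2 - 1) (q * r ^ 2))))) r := by
  have hX := (hasDerivAt_pow d r).mul ((hasDerivAt_besselLam_mul_sq (ν + 1) p r).mul
    (hasDerivAt_besselLam_mul_sq ((d : ℝ) / 2 - 1) q r))
  have hY := (hasDerivAt_pow d r).mul ((hasDerivAt_besselLam_mul_sq ν p r).mul
    (hasDerivAt_besselLam_mul_sq ((d : ℝ) / 2) q r))
  have h := (hX.const_mul p).sub (hY.const_mul q)
  refine h.congr_deriv ?_
  have h1 := besselLam_pred (ν + 1) (p * r ^ 2)
  have h2 := besselLam_pred ((d : ℝ) / 2) (q * r ^ 2)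
  rw [add_sub_cancel_right] at h1
  have hd' : r ^ d = r ^ (d - 1) * r := by rw [← pow_succ, Nat.sub_add_cancel hd]
  simp only [sub_add_cancel, hd', Pi.mul_apply]
  linear_combination (-2 * p * r ^ (d - 1) * besselLam ((d : ℝ) / 2 - 1) (q * r ^ 2)) * h1 +
    (2 * q * r ^ (d - 1) * besselLam ν (p * r ^ 2)) * h2

/-- The boundary expression vanishes at 0 because `d ≥ 1`. The identity is used in three regimes: `p
= q` on the sphere, `q = 0` at the origin, and generic `q` at the other lattice points. -/
theorem lamInt_green {d : ℕ} (hd : 1 ≤ d) (ν p q l : ℝ) :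
    p * ((d : ℝ) / 2 - ν - 1) * lamInt d (ν + 1) p q l + (p - q) * lamInt d ν p q l =
      p * lamX d ν p q l - q * lamY d ν p q l := by
  have h := intervalIntegral.integral_eq_sub_of_hasDerivAt (a := 0) (b := l)
    (fun r _ => hasDerivAt_boundary hd ν p q r) (Continuous.intervalIntegrable
      (((continuous_lamInt_integrand d (ν + 1) p q).const_mul _).add
        ((continuous_lamInt_integrand d ν p q).const_mul _)) _ _)
  have h0 : p * lamX d ν p q 0 - q * lamY d ν p q 0 = 0 := by
    simp [lamX, lamY, zero_pow (by omega : d ≠ 0)]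
  rw [h0, sub_zero, intervalIntegral.integral_add] at h
  · rw [← h, lamInt, lamInt, ← intervalIntegral.integral_const_mul,
      ← intervalIntegral.integral_const_mul]
  · exact ((continuous_lamInt_integrand d (ν + 1) p q).const_mul _).intervalIntegrable _ _
  · exact ((continuous_lamInt_integrand d ν p q).const_mul _).intervalIntegrable _ _

/-- The error of the spherical partial integral of `bump β a` at a point of norm `ρ`. -/
noncomputable def sigmaErr (d : ℕ) (β a ρ l : ℝ) : ℝ :=
  sigmaBall d β a ρ l - bumpProfile β a ρ

/-- The boundary term relating `sigmaErr` for `β` and `β + 1`. -/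
noncomputable def sigmaBdry (d : ℕ) (β a ρ l : ℝ) : ℝ :=
  hatConst d β a * Real.pi ^ ((d : ℝ) / 2) *
    (a ^ 2 * lamX d ((d : ℝ) / 2 + β) (Real.pi ^ 2 * a ^ 2) (Real.pi ^ 2 * ρ ^ 2) l -
      ρ ^ 2 * lamY d ((d : ℝ) / 2 + β) (Real.pi ^ 2 * a ^ 2) (Real.pi ^ 2 * ρ ^ 2) l)

theorem hatConst_add_one (d : ℕ) {β a : ℝ} (hβ : -1 < β) (ha : 0 < a) :
    hatConst d (β + 1) a = (β + 1) * a ^ 2 * hatConst d β a := by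
  rw [hatConst, hatConst, Real.Gamma_add_one (by linarith),
    show 2 * (β + 1) + (d : ℝ) = 2 * β + d + (2 : ℕ) by push_cast; ring,
    Real.rpow_add_natCast ha.ne']
  ring

/-- For `ν = d/2 + β` the coefficient `d/2 - ν - 1` is `-(β + 1)`, the factor that passes from the
constant of `β` to that of `β + 1`; the profiles satisfy the same relation without boundary term.
The error is thus traded for that of a smoother bump. -/
theorem sigmaErr_green {d : ℕ} (hd : 1 ≤ d) {β a : ℝ} (hβ : -1 < β) (ha : 0 < a) {ρ : ℝ}
    (hρ : 0 ≤ ρ) (l : ℝ) :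
    (a ^ 2 - ρ ^ 2) * sigmaErr d β a ρ l = sigmaErr d (β + 1) a ρ l + sigmaBdry d β a ρ l := by
  have h := lamInt_green hd ((d : ℝ) / 2 + β) (Real.pi ^ 2 * a ^ 2) (Real.pi ^ 2 * ρ ^ 2) l
  have h2 : bumpProfile (β + 1) a ρ = (a ^ 2 - ρ ^ 2) * bumpProfile β a ρ := by
    by_cases hr : ρ < a
    · simp only [bumpProfile, hr, if_true]
      rw [Real.rpow_add_one (by nlinarith), mul_comm]
    · simp [bumpProfile, hr]
  have hpi : Real.pi ^ 2 ≠ 0 := by positivity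
  rw [sigmaErr, sigmaErr, sigmaBdry, sigmaBall, sigmaBall, h2, hatConst_add_one d hβ ha,
    ← add_assoc]
  refine mul_left_cancel₀ hpi ?_
  linear_combination hatConst d β a * Real.pi ^ ((d : ℝ) / 2) * h

/-! ### Fourier inversion for large exponents -/

theorem exists_bumpHat_bound (d : ℕ) (β : ℝ) {a : ℝ} (ha : 0 < a) :
    ∃ C : ℝ, 0 < C ∧ ∀ t : ℝ, 1 ≤ t → |bumpHat d β a t| ≤ C * t ^ (-((d : ℝ) + 1) / 2 - β) := by
  have hc : 0 < Real.pi ^ 2 * a ^ 2 := by have := Real.pi_pos; positivity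
  obtain ⟨C, hC0, hC⟩ := exists_besselLam_bound ((d : ℝ) / 2 + β) hc
  refine ⟨(|hatConst d β a| + 1) * (C * (Real.pi ^ 2 * a ^ 2) ^ (-((d : ℝ) / 2 + β) / 2 - 1 / 4)),
    by positivity, fun t ht => ?_⟩
  have ht0 : 0 < t := by linarith
  have h1 := hC (Real.pi ^ 2 * a ^ 2 * t ^ 2) (le_mul_of_one_le_right hc.le (one_le_pow₀ ht))
  rw [Real.mul_rpow hc.le (by positivity), ← Real.rpow_natCast t 2, ← Real.rpow_mul ht0.le,
    show ((2 : ℕ) : ℝ) * (-((d : ℝ) / 2 + β) / 2 - 1 / 4) = -((d : ℝ) + 1) / 2 - β by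
      push_cast; ring, Real.rpow_natCast] at h1
  rw [bumpHat, abs_mul, mul_assoc (|hatConst d β a| + 1), mul_assoc C]
  exact mul_le_mul (by linarith) h1 (abs_nonneg _) (by positivity)

/-- The integrand has size `r^{(d-3)/2-β}` at infinity, whence the threshold `(d-1)/2`. -/
theorem integrableOn_Ioi_pow_mul_bumpHat {d : ℕ} (hd : 1 ≤ d) {β a : ℝ} (ha : 0 < a)
    (hβ : ((d : ℝ) - 1) / 2 < β) :
    IntegrableOn (fun r : ℝ => r ^ (d - 1) * bumpHat d β a r) (Set.Ioi 0) := by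
  obtain ⟨C, hC0, hC⟩ := exists_bumpHat_bound d β ha
  have hcont : Continuous fun r : ℝ => r ^ (d - 1) * bumpHat d β a r :=
    (continuous_pow _).mul (continuous_bumpHat d β a)
  rw [← Set.Ioc_union_Ioi_eq_Ioi zero_le_one]
  refine (hcont.integrableOn_Ioc).union ?_
  refine Integrable.mono' ((integrableOn_Ioi_rpow_of_lt
    (by linarith : ((d : ℝ) - 3) / 2 - β < -1) one_pos).const_mul C)
    hcont.aestronglyMeasurable.restrict ?_
  filter_upwards [ae_restrict_mem measurableSet_Ioi] with r hr
  have hr1 : 1 < r := hr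
  have hr0 : 0 < r := by linarith
  rw [norm_mul, Real.norm_of_nonneg (by positivity), Real.norm_eq_abs]
  calc r ^ (d - 1) * |bumpHat d β a r| ≤ r ^ (d - 1) * (C * r ^ (-((d : ℝ) + 1) / 2 - β)) := by
        gcongr; exact hC r hr1.le
    _ = C * (r ^ (((d - 1 : ℕ) : ℝ)) * r ^ (-((d : ℝ) + 1) / 2 - β)) := by
        rw [Real.rpow_natCast]; ring
    _ = _ := by
        rw [← Real.rpow_add hr0, Nat.cast_sub hd]
        congr 2; push_cast; ring

theorem integrable_bumpHat_norm {d : ℕ} (hd : 1 ≤ d) {β a : ℝ} (ha : 0 < a)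
    (hβ : ((d : ℝ) - 1) / 2 < β) : Integrable fun x : E d => bumpHat d β a ‖x‖ := by
  have := nontrivial_E hd
  refine (integrable_fun_norm_addHaar (E := E d) volume (f := bumpHat d β a)).2 ?_
  have hfin : Module.finrank ℝ (E d) = d := by simp
  simp only [hfin, smul_eq_mul]
  exact integrableOn_Ioi_pow_mul_bumpHat hd ha hβ

theorem continuous_bump {d : ℕ} {β a : ℝ} (hβ : 0 < β) (ha : 0 < a) :
    Continuous (bump β a : E d → ℝ) := by
  have e : (bump β a : E d → ℝ) = fun x => (max 0 (a ^ 2 - ‖x‖ ^ 2)) ^ β := by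
    ext x
    by_cases hx : ‖x‖ < a
    · have : 0 ≤ a ^ 2 - ‖x‖ ^ 2 := by nlinarith [norm_nonneg x]
      simp [bump, hx, max_eq_right this]
    · have : a ^ 2 - ‖x‖ ^ 2 ≤ 0 := by nlinarith [norm_nonneg x]
      simp [bump, hx, max_eq_left this, Real.zero_rpow hβ.ne']
  rw [e]
  exact (by fun_prop : Continuous fun x : E d => max 0 (a ^ 2 - ‖x‖ ^ 2)).rpow_const
    fun _ => Or.inr hβ.le

theorem integral_bumpHat_mul_cos {d : ℕ} (hd : 1 ≤ d) {β a : ℝ} (ha : 0 < a)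
    (hβ0 : 0 < β) (hβ : ((d : ℝ) - 1) / 2 < β) (y : E d) :
    ∫ x : E d, bumpHat d β a ‖x‖ * Real.cos (2 * Real.pi * inner ℝ x y) = bump β a y := by
  have hInt := integrable_bump (d := d) hd (by linarith : -1 < β) ha
  have hF : 𝓕 (fun x : E d => (bump β a x : ℂ)) = fun x => (bumpHat d β a ‖x‖ : ℂ) :=
    funext fun x => fourier_bump hd (by linarith) ha x
  have h := hInt.ofReal (𝕜 := ℂ) |>.fourierInv_fourier_eq (v := y)
    (by
      change Integrable (𝓕 (fun x : E d => (bump β a x : ℂ)))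
      rw [hF]
      exact (integrable_bumpHat_norm (d := d) hd ha hβ).ofReal)
    (Complex.continuous_ofReal.comp (continuous_bump hβ0 ha)).continuousAt
  have h2 : 𝓕⁻ (fun x : E d => (bumpHat d β a ‖x‖ : ℂ)) y =
      ((∫ x : E d, bumpHat d β a ‖x‖ * Real.cos (2 * Real.pi * inner ℝ x y) : ℝ) : ℂ) := by
    rw [Real.fourierInv_eq_fourier_neg, fourier_even (integrable_bumpHat_norm hd ha hβ) (by simp)]
    simp
  have h3 : 𝓕⁻ (𝓕 (fun x : E d => (bump β a x : ℂ))) y = (bump β a y : ℂ) := h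
  rw [hF, h2] at h3
  exact_mod_cast h3

/-- Fourier inversion makes the error a tail integral outside the ball. Bounding the cosine by 1
makes the estimate uniform in `y`; it is the terminal case of the Green iterations. -/
theorem exists_sigmaErr_bound_of_large {d : ℕ} (hd : 1 ≤ d) {β a : ℝ} (ha : 0 < a)
    (hβ0 : 0 < β) (hβ : ((d : ℝ) - 1) / 2 < β) :
    ∃ C : ℝ, 0 < C ∧ ∀ (y : E d) (l : ℝ), 1 ≤ l →
      |sigmaErr d β a ‖y‖ l| ≤ C * l ^ (((d : ℝ) - 1) / 2 - β) := by
  have := nontrivial_E hd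
  obtain ⟨C, hC0, hC⟩ := exists_bumpHat_bound d β ha
  have hfin : Module.finrank ℝ (E d) = d := by simp
  set v : ℝ := (volume : Measure (E d)).real (Metric.ball 0 1)
  have hInt := integrable_bumpHat_norm (d := d) hd ha hβ
  have hneg : 0 < β - ((d : ℝ) - 1) / 2 := by linarith
  -- `d * v` is the total mass of the sphere, and the inverse factor comes from integrating the
  -- power tail. The summand 1 only makes positivity immediate.
  refine ⟨(d * v + 1) * (C * (β - ((d : ℝ) - 1) / 2)⁻¹), by positivity, fun y l hl => ?_⟩
  have hl0 : 0 < l := by linarith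
  have hθ : Continuous fun x : E d => 2 * Real.pi * (inner ℝ x y : ℝ) :=
    continuous_const.mul (continuous_id.inner continuous_const)
  have hint2 : Integrable fun x : E d => bumpHat d β a ‖x‖ *
      Real.cos (2 * Real.pi * inner ℝ x y) :=
    hInt.mul_bdd (c := 1) (Real.continuous_cos.comp hθ).aestronglyMeasurable
      (Eventually.of_forall fun x => Real.abs_cos_le_one _)
  have h1 := integral_add_compl (measurableSet_ball (x := (0 : E d)) (ε := l)) hint2
  rw [setIntegral_ball_bumpHat_mul_cos hd β a hl0.le, integral_bumpHat_mul_cos hd ha hβ0 hβ] at h1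
  have h2 : sigmaErr d β a ‖y‖ l = -∫ x in (Metric.ball (0 : E d) l)ᶜ,
      bumpHat d β a ‖x‖ * Real.cos (2 * Real.pi * inner ℝ x y) := by
    rw [sigmaErr, ← bump_eq_profile]; linarith
  rw [h2, abs_neg, ← Real.norm_eq_abs]
  have h3 : ‖∫ x in (Metric.ball (0 : E d) l)ᶜ,
      bumpHat d β a ‖x‖ * Real.cos (2 * Real.pi * inner ℝ x y)‖ ≤
      ∫ x in (Metric.ball (0 : E d) l)ᶜ, |bumpHat d β a ‖x‖| := by
    refine norm_integral_le_of_norm_le hInt.abs.integrableOn (Eventually.of_forall fun x => ?_)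
    rw [norm_mul, Real.norm_eq_abs, Real.norm_eq_abs]
    exact mul_le_of_le_one_right (abs_nonneg _) (Real.abs_cos_le_one _)
  refine h3.trans ?_
  have h4 : ∫ x in (Metric.ball (0 : E d) l)ᶜ, |bumpHat d β a ‖x‖| =
      d * v * ∫ r in Set.Ioi l, r ^ (d - 1) * |bumpHat d β a r| := by
    rw [← integral_indicator measurableSet_ball.compl]
    have e : ∀ x : E d, (Metric.ball (0 : E d) l)ᶜ.indicator
        (fun x : E d => |bumpHat d β a ‖x‖|) x =
        (Set.Ici l).indicator (fun r => |bumpHat d β a r|) ‖x‖ := by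
      intro x
      by_cases hx : ‖x‖ < l <;> simp [Set.indicator, hx]
    simp_rw [e]
    rw [integral_fun_norm_addHaar volume, hfin, nsmul_eq_mul, smul_eq_mul, ← mul_assoc]
    congr 1
    have e3 : ∀ r : ℝ, r ^ (d - 1) • (Set.Ici l).indicator (fun r => |bumpHat d β a r|) r =
        (Set.Ici l).indicator (fun r => r ^ (d - 1) * |bumpHat d β a r|) r := by
      intro r
      by_cases hr : l ≤ r <;> simp [Set.indicator, hr]
    simp_rw [e3]
    rw [setIntegral_indicator measurableSet_Ici, ← integral_Ici_eq_integral_Ioi]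
    congr 2
    ext r
    simp only [Set.mem_inter_iff, Set.mem_Ioi, Set.mem_Ici]
    exact ⟨fun h => h.2, fun h => ⟨by linarith, h⟩⟩
  have h5 : ∫ r in Set.Ioi l, r ^ (d - 1) * |bumpHat d β a r| ≤
      ∫ r in Set.Ioi l, C * r ^ (((d : ℝ) - 3) / 2 - β) := by
    refine setIntegral_mono_on ?_ ((integrableOn_Ioi_rpow_of_lt (by linarith) hl0).const_mul C)
      measurableSet_Ioi fun r hr => ?_
    · have := ((integrableOn_Ioi_pow_mul_bumpHat hd ha hβ).mono_set
        (Set.Ioi_subset_Ioi hl0.le)).abs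
      refine this.congr ?_
      filter_upwards [ae_restrict_mem measurableSet_Ioi] with r hr
      have hr0 : 0 < r := hl0.trans hr
      rw [abs_mul, abs_of_nonneg (by positivity)]
    · have hr1 : 1 ≤ r := hl.trans (Set.mem_Ioi.1 hr).le
      have hr0 : 0 < r := by linarith
      calc r ^ (d - 1) * |bumpHat d β a r| ≤ r ^ (d - 1) * (C * r ^ (-((d : ℝ) + 1) / 2 - β)) := by
            gcongr; exact hC r hr1
        _ = C * (r ^ (((d - 1 : ℕ) : ℝ)) * r ^ (-((d : ℝ) + 1) / 2 - β)) := by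
            rw [Real.rpow_natCast]; ring
        _ = _ := by
            rw [← Real.rpow_add hr0, Nat.cast_sub hd]
            congr 2; push_cast; ring
  have h6 : ∫ r in Set.Ioi l, C * r ^ (((d : ℝ) - 3) / 2 - β) =
      C * (β - ((d : ℝ) - 1) / 2)⁻¹ * l ^ (((d : ℝ) - 1) / 2 - β) := by
    rw [integral_const_mul, integral_Ioi_rpow_of_lt (by linarith) hl0,
      show ((d : ℝ) - 3) / 2 - β + 1 = -(β - ((d : ℝ) - 1) / 2) by ring,
      show ((d : ℝ) - 1) / 2 - β = -(β - ((d : ℝ) - 1) / 2) by ring, neg_div_neg_eq]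
    field_simp
  rw [h4]
  have hv : 0 ≤ v := measureReal_nonneg
  calc _ ≤ d * v * (C * (β - ((d : ℝ) - 1) / 2)⁻¹ * l ^ (((d : ℝ) - 1) / 2 - β)) := by
        rw [← h6]; gcongr
    _ ≤ (d * v + 1) * (C * (β - ((d : ℝ) - 1) / 2)⁻¹ * l ^ (((d : ℝ) - 1) / 2 - β)) := by
        gcongr; linarith
    _ = _ := by ring


/-! ### Unfolding and Poisson summation on `ℤ^d` -/

theorem latticePt_apply {d : ℕ} (m : Fin d → ℤ) (i : Fin d) : latticePt m i = m i := rfl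

theorem latticePt_zero {d : ℕ} : latticePt (0 : Fin d → ℤ) = 0 := by
  ext i; simp [latticePt_apply]

theorem latticePt_add {d : ℕ} (m n : Fin d → ℤ) :
    latticePt (m + n) = latticePt m + latticePt n := by
  ext i; simp [latticePt_apply]

theorem measurableSet_torus (d : ℕ) : MeasurableSet (torus d) := by
  have : torus d = ⋂ i, (fun x : E d => x i) ⁻¹' Set.Ioc (-1 / 2 : ℝ) (1 / 2) := by
    ext x; simp [torus]
  rw [this]
  refine MeasurableSet.iInter fun i => ?_
  exact (by fun_prop : Measurable fun x : E d => x i) measurableSet_Ioc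

/-- Each coordinate has a unique integer translate in the half-open unit interval, so the translated
cubes tile the space. -/
theorem hasSum_integral_torus {d : ℕ} {F : Type*} [NormedAddCommGroup F] [NormedSpace ℝ F]
    {f : E d → F} (hf : Integrable f) :
    HasSum (fun m : Fin d → ℤ => ∫ x in torus d, f (x + latticePt m)) (∫ x, f x) := by
  set T : (Fin d → ℤ) → Set (E d) := fun m => (fun x => x + -latticePt m) ⁻¹' torus d with hT
  have hmem : ∀ (m : Fin d → ℤ) (x : E d), x ∈ T m ↔
      ∀ i, x i - m i • (1 : ℝ) ∈ Set.Ioc (-1 / 2 : ℝ) (-1 / 2 + 1) := by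
    intro m x
    simp only [hT, Set.mem_preimage, torus, Set.mem_ofPred_eq, PiLp.add_apply, PiLp.neg_apply,
      latticePt_apply, zsmul_eq_mul, mul_one, sub_eq_add_neg]
    norm_num
  have hu := fun x : ℝ => existsUnique_sub_zsmul_mem_Ioc one_pos x (-1 / 2)
  have hmeas : ∀ m, MeasurableSet (T m) := fun m =>
    (measurable_add_const _) (measurableSet_torus d)
  have hdisj : Pairwise (Function.onFun Disjoint T) := by
    intro m n hmn
    rw [Function.onFun, Set.disjoint_left]
    intro x hx hy
    rw [hmem] at hx hy
    exact hmn (funext fun i => (hu (x i)).unique (hx i) (hy i))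
  have huniv : ⋃ m, T m = Set.univ := by
    refine Set.eq_univ_of_forall fun x => Set.mem_iUnion.2 ?_
    choose m hm _ using fun i => (hu (x i))
    exact ⟨m, (hmem m x).2 hm⟩
  have h := hasSum_integral_iUnion hmeas hdisj (hf.integrableOn (s := ⋃ m, T m))
  rw [huniv, setIntegral_univ] at h
  refine h.congr_fun fun m => ?_
  have h1 := (measurePreserving_add_right (volume : Measure (E d))
    (-latticePt m)).setIntegral_preimage_emb
    (measurableEmbedding_addRight _) (fun y => f (y + latticePt m)) (torus d)
  simpa [hT] using h1.symm

theorem integral_torus_tsum {d : ℕ} {f : E d → ℂ} (hf : Integrable f) :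
    ∫ x in torus d, ∑' m : Fin d → ℤ, f (x + latticePt m) = ∫ x, f x := by
  have h1 := hasSum_integral_torus hf
  have h2 := hasSum_integral_torus hf.norm
  have h3 := hasSum_integral_of_summable_integral_norm (μ := volume.restrict (torus d))
    (F := fun (m : Fin d → ℤ) (x : E d) => f (x + latticePt m))
    (fun m => (hf.comp_add_right _).integrableOn) h2.summable
  exact (h1.unique h3).symm

theorem inner_latticePt {d : ℕ} (m n : Fin d → ℤ) :
    ∃ k : ℤ, (inner ℝ (latticePt m) (latticePt n) : ℝ) = k := by
  refine ⟨∑ i, n i * m i, ?_⟩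
  simp [PiLp.inner_apply, latticePt_apply]

theorem exp_inner_add_latticePt {d : ℕ} (m n : Fin d → ℤ) (x : E d) :
    Complex.exp (-2 * Real.pi * Complex.I * (inner ℝ (latticePt m) (x + latticePt n) : ℝ)) =
      Complex.exp (-2 * Real.pi * Complex.I * (inner ℝ (latticePt m) x : ℝ)) := by
  obtain ⟨k, hk⟩ := inner_latticePt m n
  rw [inner_add_right, hk]
  rw [Complex.exp_eq_exp_iff_exists_int]
  exact ⟨-k, by push_cast; ring⟩

/-- The Fourier coefficients of a periodization are the values of the Fourier transform. -/
theorem integral_torus_periodization {d : ℕ} {F : E d → ℝ} (hF : Integrable F)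
    (hev : ∀ x, F (-x) = F x) (m : Fin d → ℤ) :
    ∫ x in torus d, (periodization F x : ℂ) *
        Complex.exp (-2 * Real.pi * Complex.I * (inner ℝ (latticePt m) x : ℝ)) =
      ((∫ x : E d, F x * Real.cos (2 * Real.pi * inner ℝ x (latticePt m)) : ℝ) : ℂ) := by
  have hInt : Integrable fun x : E d => (F x : ℂ) *
      Complex.exp (-2 * Real.pi * Complex.I * (inner ℝ (latticePt m) x : ℝ)) := by
    refine hF.ofReal.mul_bdd (c := 1) ?_ (Eventually.of_forall fun x => ?_)
    · refine Continuous.aestronglyMeasurable ?_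
      have : Continuous fun x : E d => (inner ℝ (latticePt m) x : ℝ) :=
        continuous_const.inner continuous_id
      fun_prop
    · rw [Complex.norm_exp]
      simp
  have h := integral_torus_tsum hInt
  simp only [exp_inner_add_latticePt, tsum_mul_right] at h
  have e : ∀ x : E d, ((periodization F x : ℝ) : ℂ) = ∑' n : Fin d → ℤ,
      (F (x + latticePt n) : ℂ) := fun x => by rw [periodization, Complex.ofReal_tsum]
  simp_rw [e]
  rw [h, ← fourier_even hF hev, Real.fourier_eq']
  refine integral_congr_ae (Eventually.of_forall fun x => ?_)
  simp only [smul_eq_mul]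
  rw [mul_comm, real_inner_comm]
  congr 2
  push_cast
  ring

theorem fourierCoefficient_perBump {d : ℕ} (hd : 1 ≤ d) {β a : ℝ} (hβ : -1 < β) (ha : 0 < a)
    (m : Fin d → ℤ) :
    fourierCoefficient (perBump β a) m = (bumpHat d β a ‖latticePt m‖ : ℂ) := by
  rw [fourierCoefficient, ← integral_bump_mul_cos hd hβ ha]
  exact integral_torus_periodization (integrable_bump hd hβ ha) (bump_neg β a) m

theorem partialSum_perBump {d : ℕ} (hd : 1 ≤ d) {β a : ℝ} (hβ : -1 < β) (ha : 0 < a) (t : ℝ) :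
    partialSum t (perBump β a) (0 : E d) =
      ((∑ m ∈ latticeBall d t, bumpHat d β a ‖latticePt m‖ : ℝ) : ℂ) := by
  rw [partialSum]
  push_cast
  refine Finset.sum_congr rfl fun m _ => ?_
  simp [fourierCoefficient_perBump hd hβ ha]

theorem mem_latticeBall {d : ℕ} {R : ℝ} {m : Fin d → ℤ} :
    m ∈ latticeBall d R ↔ ‖latticePt m‖ < R := by
  simp [latticeBall]

section Poisson

variable {d : ℕ} {f : E d → ℝ}

theorem periodization_add_latticePt (f : E d → ℝ) (x : E d) (k : Fin d → ℤ) :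
    periodization f (x + latticePt k) = periodization f x := by
  rw [periodization, periodization,
    ← (Equiv.addLeft k).tsum_eq fun m => f (x + latticePt m)]
  refine tsum_congr fun m => ?_
  rw [Equiv.coe_addLeft, latticePt_add, add_assoc]

theorem periodization_eq_sum {R : ℝ} (hR : ∀ x, R ≤ ‖x‖ → f x = 0) {x : E d} {r : ℝ}
    (hx : ‖x‖ ≤ r) :
    periodization f x = ∑ m ∈ latticeBall d (R + r), f (x + latticePt m) := by
  rw [periodization]
  refine tsum_eq_sum fun m hm => hR _ ?_
  rw [mem_latticeBall, not_lt] at hm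
  have h2 : ‖latticePt m‖ ≤ ‖x + latticePt m‖ + ‖x‖ := by
    have := norm_sub_le (x + latticePt m) x
    rwa [add_sub_cancel_left] at this
  linarith

theorem continuous_periodization (hf : Continuous f) {R : ℝ} (hR : ∀ x, R ≤ ‖x‖ → f x = 0) :
    Continuous (periodization f) := by
  rw [continuous_iff_continuousAt]
  intro x
  have h1 : ContinuousAt (fun y => ∑ m ∈ latticeBall d (R + (‖x‖ + 1)), f (y + latticePt m)) x := by
    fun_prop
  refine h1.congr ?_
  have h2 : ∀ᶠ y in 𝓝 x, ‖y‖ < ‖x‖ + 1 :=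
    continuous_norm.continuousAt.eventually (gt_mem_nhds (by linarith))
  filter_upwards [h2] with y hy
  exact (periodization_eq_sum hR hy.le).symm

/-- The periodization as a continuous function on the torus. -/
noncomputable def periodizationTorus (f : E d → ℝ) (z : UnitAddTorus (Fin d)) : ℂ :=
  (periodization f (WithLp.toLp 2 fun i => Quotient.out (z i)) : ℂ)

/-- The chosen representative differs from `x` by an integer vector, which the periodization does
not see. -/
theorem periodizationTorus_coe (f : E d → ℝ) (x : Fin d → ℝ) :
    periodizationTorus f (fun i => (x i : UnitAddCircle)) =
      (periodization f (WithLp.toLp 2 x) : ℂ) := by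
  rw [periodizationTorus]
  have h : ∀ i, ∃ k : ℤ, Quotient.out ((x i : UnitAddCircle)) = x i + k := by
    intro i
    have h1 : ((Quotient.out ((x i : UnitAddCircle)) : ℝ) : UnitAddCircle) = x i :=
      QuotientAddGroup.out_eq' _
    rw [← sub_eq_zero, ← AddCircle.coe_sub, AddCircle.coe_eq_zero_iff] at h1
    obtain ⟨n, hn⟩ := h1
    exact ⟨n, by simp at hn; linarith⟩
  choose k hk using h
  have e : (WithLp.toLp 2 fun i => Quotient.out ((x i : UnitAddCircle)) : E d) =
      WithLp.toLp 2 x + latticePt k := by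
    ext i; simp [hk, latticePt_apply]
  rw [e, periodization_add_latticePt]

theorem continuous_periodizationTorus (hf : Continuous f) {R : ℝ}
    (hR : ∀ x, R ≤ ‖x‖ → f x = 0) : Continuous (periodizationTorus f) := by
  have hq : IsOpenQuotientMap (Pi.map fun _ : Fin d => (QuotientAddGroup.mk : ℝ → UnitAddCircle)) :=
    IsOpenQuotientMap.piMap fun _ => QuotientAddGroup.isOpenQuotientMap_mk
  rw [hq.isQuotientMap.continuous_iff]
  have e : (periodizationTorus f) ∘
      (Pi.map fun _ : Fin d => (QuotientAddGroup.mk : ℝ → UnitAddCircle)) =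
      fun x => (periodization f (WithLp.toLp 2 x) : ℂ) := funext fun x => periodizationTorus_coe f x
  rw [e]
  exact Complex.continuous_ofReal.comp ((continuous_periodization hf hR).comp
    (PiLp.continuous_toLp 2 _))

theorem mFourierCoeff_periodizationTorus (hf : Continuous f) (hev : ∀ x, f (-x) = f x) {R : ℝ}
    (hR : ∀ x, R ≤ ‖x‖ → f x = 0) (n : Fin d → ℤ) :
    UnitAddTorus.mFourierCoeff (periodizationTorus f) n =
      ((∫ x : E d, f x * Real.cos (2 * Real.pi * inner ℝ x (latticePt n)) : ℝ) : ℂ) := by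
  have hInt : Integrable f := hf.integrable_of_hasCompactSupport
    (HasCompactSupport.of_support_subset_isCompact (isCompact_closedBall (0 : E d) R) fun x hx => by
      rw [mem_closedBall_zero_iff]
      by_contra h
      exact hx (hR x (not_le.1 h).le))
  -- The base point `-1/2` makes the fundamental box coincide with `torus d`.
  rw [UnitAddTorus.mFourierCoeff_eq_integral _ _ (fun _ => -1 / 2),
    ← integral_torus_periodization hInt hev]
  have hemb : MeasurableEmbedding (WithLp.ofLp : E d → Fin d → ℝ) :=
    (MeasurableEquiv.toLp 2 (Fin d → ℝ)).symm.measurableEmbedding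
  rw [← (PiLp.volume_preserving_ofLp (Fin d)).setIntegral_preimage_emb hemb]
  have hset : (WithLp.ofLp : E d → Fin d → ℝ) ⁻¹'
      {x | ∀ i, x i ∈ Set.Ioc (-1 / 2 : ℝ) (-1 / 2 + 1)} = torus d := by
    ext x
    simp only [Set.mem_preimage, Set.mem_ofPred_eq, torus]
    norm_num
  rw [hset]
  refine setIntegral_congr_fun (measurableSet_torus d) fun x _ => ?_
  simp only [smul_eq_mul]
  rw [periodizationTorus_coe, mul_comm]
  congr 1
  simp only [UnitAddTorus.mFourier, ContinuousMap.coe_mk, fourier_coe_apply]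
  rw [← Complex.exp_sum]
  congr 1
  simp only [PiLp.inner_apply, latticePt_apply, RCLike.inner_apply, conj_trivial]
  push_cast
  rw [Finset.mul_sum]
  refine Finset.sum_congr rfl fun i _ => ?_
  simp
  ring

/-- Poisson summation for even continuous functions of compact support. -/
theorem poisson_summation (hf : Continuous f) (hev : ∀ x, f (-x) = f x) {R : ℝ}
    (hR : ∀ x, R ≤ ‖x‖ → f x = 0)
    (hsum : Summable fun n : Fin d → ℤ =>
      ∫ x : E d, f x * Real.cos (2 * Real.pi * inner ℝ x (latticePt n))) :
    ∑' n : Fin d → ℤ, ∫ x : E d, f x * Real.cos (2 * Real.pi * inner ℝ x (latticePt n)) =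
      ∑ m ∈ latticeBall d R, f (latticePt m) := by
  set g : C(UnitAddTorus (Fin d), ℂ) :=
    ⟨periodizationTorus f, continuous_periodizationTorus hf hR⟩ with hg
  have hcoef : ∀ n, UnitAddTorus.mFourierCoeff g n =
      ((∫ x : E d, f x * Real.cos (2 * Real.pi * inner ℝ x (latticePt n)) : ℝ) : ℂ) :=
    mFourierCoeff_periodizationTorus hf hev hR
  have hs : Summable (UnitAddTorus.mFourierCoeff g) := by
    have := (Complex.hasSum_ofReal.2 hsum.hasSum).summable
    refine this.congr fun n => (hcoef n).symm
  have h := UnitAddTorus.hasSum_mFourier_series_apply_of_summable hs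
    (fun i => ((0 : ℝ) : UnitAddCircle))
  have hg0 : g (fun i => ((0 : ℝ) : UnitAddCircle)) = (periodization f 0 : ℂ) := by
    have := periodizationTorus_coe f (fun _ : Fin d => (0 : ℝ))
    exact this
  have hone : ∀ n : Fin d → ℤ,
      UnitAddTorus.mFourier n (fun i => ((0 : ℝ) : UnitAddCircle)) = 1 := by
    intro n
    simp [UnitAddTorus.mFourier]
  simp only [hone, smul_eq_mul, mul_one, hcoef, hg0] at h
  rw [Complex.hasSum_ofReal] at h
  rw [h.tsum_eq, periodization_eq_sum hR (x := 0) (r := 0) (by simp), add_zero]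
  simp

end Poisson


/-! ### Smoothed products of Bessel functions -/

/-- Smooth functions supported in `(-1, 1)`. -/
def IsTest (ψ : ℝ → ℝ) : Prop := ContDiff ℝ (⊤ : ℕ∞) ψ ∧ tsupport ψ ⊆ Set.Ioo (-1) 1

theorem IsTest.deriv {ψ : ℝ → ℝ} (h : IsTest ψ) : IsTest (deriv ψ) :=
  ⟨h.1.iterate_deriv 1, tsupport_deriv_subset.trans h.2⟩

theorem IsTest.id_mul {ψ : ℝ → ℝ} (h : IsTest ψ) : IsTest fun τ => τ * ψ τ :=
  ⟨contDiff_id.mul h.1, (tsupport_mul_subset_right (f := fun τ : ℝ => τ) (g := ψ)).trans h.2⟩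

theorem IsTest.continuous {ψ : ℝ → ℝ} (h : IsTest ψ) : Continuous ψ := h.1.continuous

theorem IsTest.hasDerivAt {ψ : ℝ → ℝ} (h : IsTest ψ) (τ : ℝ) :
    HasDerivAt ψ (_root_.deriv ψ τ) τ :=
  (h.1.differentiable (by simp)).differentiableAt.hasDerivAt

theorem IsTest.eq_zero {ψ : ℝ → ℝ} (h : IsTest ψ) {τ : ℝ} (hτ : τ ∉ Set.Ioo (-1 : ℝ) 1) :
    ψ τ = 0 :=
  image_eq_zero_of_notMem_tsupport fun h' => hτ (h.2 h')

theorem IsTest.exists_bound {ψ : ℝ → ℝ} (h : IsTest ψ) : ∃ B : ℝ, 0 < B ∧ ∀ τ, |ψ τ| ≤ B := by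
  obtain ⟨B, hB⟩ := isCompact_Icc.exists_bound_of_continuousOn
    (s := Set.Icc (-1 : ℝ) 1) h.continuous.continuousOn
  refine ⟨max B 1, by positivity, fun τ => ?_⟩
  by_cases hτ : τ ∈ Set.Ioo (-1 : ℝ) 1
  · exact (hB τ ⟨hτ.1.le, hτ.2.le⟩).trans (le_max_left _ _)
  · rw [h.eq_zero hτ]; simp

/-- The squared radius `l² + l τ`. -/
def sqRad (l τ : ℝ) : ℝ := l ^ 2 + l * τ

theorem sqRad_ge {l τ : ℝ} (hl : 2 ≤ l) (hτ : τ ∈ Set.Icc (-1 : ℝ) 1) :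
    l ^ 2 / 2 ≤ sqRad l τ := by
  rw [sqRad]; nlinarith [hτ.1]

theorem sqRad_le {l τ : ℝ} (hl : 2 ≤ l) (hτ : τ ∈ Set.Icc (-1 : ℝ) 1) :
    sqRad l τ ≤ 2 * l ^ 2 := by
  rw [sqRad]; nlinarith [hτ.2]

theorem sqRad_pos {l τ : ℝ} (hl : 2 ≤ l) (hτ : τ ∈ Set.Icc (-1 : ℝ) 1) : 0 < sqRad l τ :=
  lt_of_lt_of_le (by positivity) (sqRad_ge hl hτ)

theorem rpow_le_of_mem_Icc {x : ℝ} (h1 : 1 / 2 ≤ x) (h2 : x ≤ 2) (e : ℝ) : x ^ e ≤ 2 ^ |e| := by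
  rcases le_total 0 e with he | he
  · rw [abs_of_nonneg he]
    exact Real.rpow_le_rpow (by linarith) h2 he
  · rw [abs_of_nonpos he]
    calc x ^ e ≤ (1 / 2) ^ e := Real.rpow_le_rpow_of_nonpos (by norm_num) h1 he
      _ = 2 ^ (-e) := by rw [one_div, Real.inv_rpow (by norm_num), Real.rpow_neg (by norm_num)]

theorem sqRad_rpow_le {l τ : ℝ} (hl : 2 ≤ l) (hτ : τ ∈ Set.Icc (-1 : ℝ) 1) (e : ℝ) :
    sqRad l τ ^ e ≤ 2 ^ |e| * l ^ (2 * e) := by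
  have hl0 : 0 < l := by linarith
  have h0 := sqRad_pos hl hτ
  have h1 : sqRad l τ = l ^ 2 * (sqRad l τ / l ^ 2) := by field_simp
  rw [h1, Real.mul_rpow (by positivity) (by positivity), ← Real.rpow_natCast l 2,
    ← Real.rpow_mul hl0.le, mul_comm]
  push_cast
  gcongr
  refine rpow_le_of_mem_Icc ?_ ?_ e
  · rw [Real.rpow_two, le_div_iff₀ (by positivity)]; linarith [sqRad_ge hl hτ]
  · rw [Real.rpow_two, div_le_iff₀ (by positivity)]; linarith [sqRad_le hl hτ]

/-- The smoothed product. -/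
noncomputable def smoothedLam (ψ : ℝ → ℝ) (p ν κ q : ℝ) (j : ℕ) (l : ℝ) : ℝ :=
  ∫ τ in (-1 : ℝ)..1, ψ τ * (p ^ j * besselLam (ν + j) (p * sqRad l τ)) *
    (sqRad l τ ^ κ * besselLam κ (q * sqRad l τ))

theorem hasDerivAt_sqRad (l τ : ℝ) : HasDerivAt (sqRad l) l τ := by
  have h := ((hasDerivAt_id τ).const_mul l).const_add (l ^ 2)
  exact h.congr_deriv (mul_one l)

theorem continuous_sqRad (l : ℝ) : Continuous (sqRad l) := by
  unfold sqRad; fun_prop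

/-- The squared radius is affine in `τ`, so the chain rule contributes only the constant `l`. The
second factor of the smoothed product becomes an exact derivative whose primitive has order one
higher, hence better decay in `q`. -/
theorem hasDerivAt_rpow_mul_besselLam (κ q : ℝ) {l τ : ℝ} (hs : 0 < sqRad l τ) :
    HasDerivAt (fun τ => sqRad l τ ^ (κ + 1) * besselLam (κ + 1) (q * sqRad l τ))
      (l * (sqRad l τ ^ κ * besselLam κ (q * sqRad l τ))) τ := by
  have h1 := (hasDerivAt_sqRad l τ).rpow_const (p := κ + 1) (Or.inl hs.ne')
  have h2 := (hasDerivAt_besselLam (κ + 1) (q * sqRad l τ)).comp τ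
    ((hasDerivAt_sqRad l τ).const_mul q)
  refine (h1.mul h2).congr_deriv ?_
  have h3 := besselLam_pred (κ + 1) (q * sqRad l τ)
  rw [add_sub_cancel_right] at h3 ⊢
  simp only [Function.comp]
  rw [h3, Real.rpow_add_one hs.ne']
  ring

/-- Integration by parts without boundary terms, as `ψ` vanishes at both ends. The derivative falls
either on the weight or on the first Bessel factor, raising `j`. -/
theorem smoothedLam_eq {ψ : ℝ → ℝ} (hψ : IsTest ψ) (p ν κ q : ℝ) (j : ℕ) {l : ℝ} (hl : 2 ≤ l) :
    smoothedLam ψ p ν κ q j l = -(l⁻¹ * smoothedLam (deriv ψ) p ν (κ + 1) q j l) +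
      smoothedLam ψ p ν (κ + 1) q (j + 1) l := by
  have hl0 : 0 < l := by linarith
  have hu : ∀ τ, HasDerivAt (fun τ => ψ τ * (p ^ j * besselLam (ν + j) (p * sqRad l τ)))
      (deriv ψ τ * (p ^ j * besselLam (ν + j) (p * sqRad l τ)) -
        l * (ψ τ * (p ^ (j + 1) * besselLam (ν + (j + 1 : ℕ)) (p * sqRad l τ)))) τ := by
    intro τ
    have h2 := ((hasDerivAt_besselLam (ν + j) (p * sqRad l τ)).comp τ
      ((hasDerivAt_sqRad l τ).const_mul p)).const_mul (p ^ j)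
    refine ((hψ.hasDerivAt τ).mul h2).congr_deriv ?_
    simp only [Function.comp]
    rw [show ν + ((j + 1 : ℕ) : ℝ) = ν + j + 1 by push_cast; ring]
    ring
  have hpos : ∀ τ ∈ Set.uIcc (-1 : ℝ) 1, 0 < sqRad l τ := fun τ hτ =>
    sqRad_pos hl (by rwa [Set.uIcc_of_le (by norm_num)] at hτ)
  have hc1 : ∀ μ x : ℝ, Continuous fun τ => besselLam μ (x * sqRad l τ) := fun μ x =>
    (continuous_besselLam μ).comp (continuous_const.mul (continuous_sqRad l))
  have hc2 : ∀ e : ℝ, ContinuousOn (fun τ => sqRad l τ ^ e) (Set.uIcc (-1 : ℝ) 1) := fun e =>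
    (continuous_sqRad l).continuousOn.rpow_const fun τ hτ => Or.inl (hpos τ hτ).ne'
  have hψc := hψ.continuous
  have hψc' := hψ.deriv.continuous
  have hi1 := (hc1 (ν + j) p)
  have hi2 := (hc1 (ν + (j + 1 : ℕ)) p)
  have h := intervalIntegral.integral_mul_deriv_eq_deriv_mul (a := -1) (b := 1)
    (fun τ _ => hu τ) (fun τ hτ => hasDerivAt_rpow_mul_besselLam κ q (hpos τ hτ))
    (Continuous.intervalIntegrable (by fun_prop) _ _)
    (ContinuousOn.intervalIntegrable
      (((hc2 κ).mul (hc1 κ q).continuousOn).const_mul l))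
  have e1 : ψ 1 = 0 := hψ.eq_zero (by simp)
  have e2 : ψ (-1) = 0 := hψ.eq_zero (by simp)
  rw [e1, e2] at h
  simp only [zero_mul, sub_zero, zero_sub] at h
  have h3 : ∫ τ in (-1 : ℝ)..1, (deriv ψ τ * (p ^ j * besselLam (ν + j) (p * sqRad l τ)) -
        l * (ψ τ * (p ^ (j + 1) * besselLam (ν + (j + 1 : ℕ)) (p * sqRad l τ)))) *
        (sqRad l τ ^ (κ + 1) * besselLam (κ + 1) (q * sqRad l τ)) =
      smoothedLam (deriv ψ) p ν (κ + 1) q j l - l * smoothedLam ψ p ν (κ + 1) q (j + 1) l := by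
    rw [smoothedLam, smoothedLam, ← intervalIntegral.integral_const_mul,
      ← intervalIntegral.integral_sub]
    · refine intervalIntegral.integral_congr fun τ _ => ?_
      ring
    · refine ContinuousOn.intervalIntegrable ?_
      exact (by fun_prop : Continuous fun τ => deriv ψ τ *
        (p ^ j * besselLam (ν + j) (p * sqRad l τ))).continuousOn.mul
        ((hc2 _).mul (hc1 _ q).continuousOn)
    · refine ContinuousOn.intervalIntegrable (ContinuousOn.const_mul ?_ _)
      exact (by fun_prop : Continuous fun τ => ψ τ *
        (p ^ (j + 1) * besselLam (ν + (j + 1 : ℕ)) (p * sqRad l τ))).continuousOn.mul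
        ((hc2 _).mul (hc1 _ q).continuousOn)
  have h4 : ∫ τ in (-1 : ℝ)..1, ψ τ * (p ^ j * besselLam (ν + j) (p * sqRad l τ)) *
      (l * (sqRad l τ ^ κ * besselLam κ (q * sqRad l τ))) = l * smoothedLam ψ p ν κ q j l := by
    rw [smoothedLam, ← intervalIntegral.integral_const_mul]
    refine intervalIntegral.integral_congr fun τ _ => ?_
    ring
  rw [h4, h3] at h
  have : l * smoothedLam ψ p ν κ q j l = l * (-(l⁻¹ * smoothedLam (deriv ψ) p ν (κ + 1) q j l) +
      smoothedLam ψ p ν (κ + 1) q (j + 1) l) := by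
    rw [h]; field_simp; ring
  exact mul_left_cancel₀ hl0.ne' this

/-- Each integration by parts gains `q^{-1/2}` and loses nothing in `l`: the extra `l` from raising
`κ` is repaid by `l⁻¹` or by the smaller amplitude at `j + 1`. Keeping the amplitude bound as a
hypothesis also covers `p = 0`, where the first factor is constant. -/
theorem exists_smoothedLam_bound {p ν e : ℝ}
    (hamp : ∀ j : ℕ, ∃ C : ℝ, 0 < C ∧ ∀ l : ℝ, 2 ≤ l → ∀ τ ∈ Set.Icc (-1 : ℝ) 1,
      |p ^ j * besselLam (ν + j) (p * sqRad l τ)| ≤ C * l ^ (e - j)) (M : ℕ) :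
    ∀ (j : ℕ) (κ : ℝ) (ψ : ℝ → ℝ), IsTest ψ → ∃ C : ℝ, 0 < C ∧ ∀ l : ℝ, 2 ≤ l → ∀ q : ℝ, 1 ≤ q →
      |smoothedLam ψ p ν κ q j l| ≤
        C * l ^ (e - j + κ - 1 / 2) * q ^ (-κ / 2 - 1 / 4 - M / 2) := by
  induction M with
  | zero =>
    intro j κ ψ hψ
    obtain ⟨B, hB0, hB⟩ := hψ.exists_bound
    obtain ⟨C₁, hC₁0, hC₁⟩ := hamp j
    obtain ⟨C₂, hC₂0, hC₂⟩ := exists_besselLam_bound κ one_pos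
    refine ⟨B * C₁ * (C₂ * 2 ^ |κ / 2 - 1 / 4|) * 2, by positivity, fun l hl q hq => ?_⟩
    have hl0 : 0 < l := by linarith
    have hq0 : 0 < q := by linarith
    have h := intervalIntegral.norm_integral_le_of_norm_le_const (a := (-1 : ℝ)) (b := 1)
      (f := fun τ => ψ τ * (p ^ j * besselLam (ν + j) (p * sqRad l τ)) *
        (sqRad l τ ^ κ * besselLam κ (q * sqRad l τ)))
      (C := B * (C₁ * l ^ (e - j)) * (C₂ * 2 ^ |κ / 2 - 1 / 4| * l ^ (κ - 1 / 2) *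
        q ^ (-κ / 2 - 1 / 4))) ?_
    · rw [smoothedLam, ← Real.norm_eq_abs]
      refine h.trans_eq ?_
      rw [show e - j + κ - 1 / 2 = (e - j) + (κ - 1 / 2) by ring, Real.rpow_add hl0]
      norm_num
      ring
    · intro τ hτ
      rw [Set.uIoc_of_le (by norm_num)] at hτ
      have hτ' : τ ∈ Set.Icc (-1 : ℝ) 1 := ⟨hτ.1.le, hτ.2⟩
      have hs0 := sqRad_pos hl hτ'
      have hs1 : 1 ≤ q * sqRad l τ := by
        have : 1 ≤ sqRad l τ := by nlinarith [sqRad_ge hl hτ']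
        nlinarith
      have h1 := hC₂ _ hs1
      rw [Real.mul_rpow hq0.le hs0.le] at h1
      have h2 : sqRad l τ ^ κ * (C₂ * (q ^ (-κ / 2 - 1 / 4) * sqRad l τ ^ (-κ / 2 - 1 / 4))) ≤
          C₂ * 2 ^ |κ / 2 - 1 / 4| * l ^ (κ - 1 / 2) * q ^ (-κ / 2 - 1 / 4) := by
        have h3 := sqRad_rpow_le hl hτ' (κ / 2 - 1 / 4)
        rw [show 2 * (κ / 2 - 1 / 4) = κ - 1 / 2 by ring] at h3
        calc _ = C₂ * q ^ (-κ / 2 - 1 / 4) *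
              (sqRad l τ ^ κ * sqRad l τ ^ (-κ / 2 - 1 / 4)) := by ring
          _ = C₂ * q ^ (-κ / 2 - 1 / 4) * sqRad l τ ^ (κ / 2 - 1 / 4) := by
              rw [← Real.rpow_add hs0]; ring_nf
          _ ≤ C₂ * q ^ (-κ / 2 - 1 / 4) * (2 ^ |κ / 2 - 1 / 4| * l ^ (κ - 1 / 2)) := by gcongr
          _ = _ := by ring
      rw [Real.norm_eq_abs, abs_mul, abs_mul, abs_mul (sqRad l τ ^ κ),
        abs_of_pos (by positivity : 0 < sqRad l τ ^ κ)]
      refine mul_le_mul (mul_le_mul (hB τ) (hC₁ l hl τ hτ') (abs_nonneg _) hB0.le)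
        (le_trans (by gcongr) h2) (by positivity) (by positivity)
  | succ M ih =>
    intro j κ ψ hψ
    obtain ⟨C₁, hC₁0, hC₁⟩ := ih j (κ + 1) (deriv ψ) hψ.deriv
    obtain ⟨C₂, hC₂0, hC₂⟩ := ih (j + 1) (κ + 1) ψ hψ
    refine ⟨C₁ + C₂, by positivity, fun l hl q hq => ?_⟩
    have hl0 : 0 < l := by linarith
    have h1 := hC₁ l hl q hq
    have h2 := hC₂ l hl q hq
    have e1 : -(κ + 1) / 2 - 1 / 4 - (M : ℝ) / 2 = -κ / 2 - 1 / 4 - ((M + 1 : ℕ) : ℝ) / 2 := by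
      push_cast; ring
    have e2 : e - ((j + 1 : ℕ) : ℝ) + (κ + 1) - 1 / 2 = e - j + κ - 1 / 2 := by push_cast; ring
    have e3 : e - (j : ℝ) + (κ + 1) - 1 / 2 = e - j + κ - 1 / 2 + 1 := by ring
    rw [e1, e3, Real.rpow_add_one hl0.ne'] at h1
    rw [e1, e2] at h2
    rw [smoothedLam_eq hψ p ν κ q j hl]
    refine (abs_add_le _ _).trans ?_
    rw [abs_neg, abs_mul, abs_of_pos (by positivity : 0 < l⁻¹)]
    have h3 : l⁻¹ * |smoothedLam (deriv ψ) p ν (κ + 1) q j l| ≤ C₁ * l ^ (e - j + κ - 1 / 2) *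
        q ^ (-κ / 2 - 1 / 4 - ((M + 1 : ℕ) : ℝ) / 2) := by
      rw [inv_mul_le_iff₀ hl0]
      refine h1.trans_eq ?_
      ring
    linarith

theorem besselLam_amplitude_bound {p : ℝ} (hp : 0 < p) (ν : ℝ) (j : ℕ) :
    ∃ C : ℝ, 0 < C ∧ ∀ l : ℝ, 2 ≤ l → ∀ τ ∈ Set.Icc (-1 : ℝ) 1,
      |p ^ j * besselLam (ν + j) (p * sqRad l τ)| ≤ C * l ^ (-ν - 1 / 2 - j) := by
  obtain ⟨C, hC0, hC⟩ := exists_besselLam_bound (ν + j) hp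
  set e : ℝ := -(ν + j) / 2 - 1 / 4 with he
  refine ⟨p ^ j * (C * (p ^ e * 2 ^ |e|)), by positivity, fun l hl τ hτ => ?_⟩
  have hs0 := sqRad_pos hl hτ
  have hs1 : 1 ≤ sqRad l τ := by nlinarith [sqRad_ge hl hτ]
  have h1 := hC (p * sqRad l τ) (le_mul_of_one_le_right hp.le hs1)
  rw [Real.mul_rpow hp.le hs0.le] at h1
  have h2 := sqRad_rpow_le hl hτ e
  rw [show 2 * e = -ν - 1 / 2 - j by rw [he]; ring] at h2
  rw [abs_mul, abs_of_pos (by positivity : 0 < p ^ j), mul_assoc (p ^ j)]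
  gcongr
  refine h1.trans ?_
  calc C * (p ^ e * sqRad l τ ^ e) ≤ C * (p ^ e * (2 ^ |e| * l ^ (-ν - 1 / 2 - j))) := by gcongr
    _ = _ := by ring


/-! ### Smoothed errors at lattice points -/

theorem latticePt_injective {d : ℕ} : Function.Injective (latticePt : (Fin d → ℤ) → E d) := by
  intro m n h
  funext i
  have : latticePt m i = latticePt n i := by rw [h]
  simpa [latticePt_apply] using this

theorem summable_lattice_rpow (d : ℕ) :
    Summable fun n : Fin d → ℤ => ‖latticePt n‖ ^ (-((d : ℝ) + 1)) := by
  let L := Submodule.span ℤ (Set.range (EuclideanSpace.basisFun (Fin d) ℝ).toBasis)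
  have hrank : Module.finrank ℤ L = d := by
    rw [ZLattice.rank ℝ L]; simp
  have hmem : ∀ n : Fin d → ℤ, latticePt n ∈ L := by
    intro n
    have e : latticePt n = ∑ i, n i • (EuclideanSpace.basisFun (Fin d) ℝ).toBasis i := by
      ext j
      rw [latticePt_apply]
      simp [Finset.sum_apply, Pi.single_apply]
    rw [e]
    exact Submodule.sum_mem _ fun i _ => Submodule.smul_mem _ _ (Submodule.subset_span ⟨i, rfl⟩)
  have h := ZLattice.summable_norm_rpow L (-((d : ℝ) + 1)) (by rw [hrank]; linarith)
  have hinj : Function.Injective (fun n : Fin d → ℤ => (⟨latticePt n, hmem n⟩ : L)) :=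
    fun m n hmn => latticePt_injective (congrArg Subtype.val hmn)
  have h2 := h.comp_injective hinj
  refine h2.congr fun n => ?_
  rfl

theorem norm_latticePt_sq {d : ℕ} (n : Fin d → ℤ) : ∃ k : ℤ, ‖latticePt n‖ ^ 2 = k := by
  obtain ⟨k, hk⟩ := inner_latticePt n n
  exact ⟨k, by rw [← hk, real_inner_self_eq_norm_sq]⟩

theorem one_le_norm_latticePt {d : ℕ} {n : Fin d → ℤ} (hn : n ≠ 0) : 1 ≤ ‖latticePt n‖ := by
  obtain ⟨k, hk⟩ := norm_latticePt_sq n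
  have h0 : latticePt n ≠ 0 := fun h => hn (latticePt_injective (h.trans latticePt_zero.symm))
  have h1 : 0 < ‖latticePt n‖ := norm_pos_iff.2 h0
  have h2 : (0 : ℝ) < k := by rw [← hk]; positivity
  have h3 : (1 : ℝ) ≤ k := by exact_mod_cast h2
  nlinarith

theorem exists_int_gap (x : ℝ) : ∃ δ : ℝ, 0 < δ ∧ ∀ k : ℤ, (k : ℝ) ≠ x → δ ≤ |x - k| := by
  by_cases hx : Int.fract x = 0
  · refine ⟨1, one_pos, fun k hk => ?_⟩
    have h1 : x = ⌊x⌋ := by linarith [Int.floor_add_fract x]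
    have h2 : ⌊x⌋ - k ≠ 0 := fun h => hk (by rw [h1]; exact_mod_cast (sub_eq_zero.1 h).symm)
    have h3 : (1 : ℤ) ≤ |⌊x⌋ - k| := Int.one_le_abs h2
    rw [h1]
    exact_mod_cast h3
  · have h0 : 0 < Int.fract x := lt_of_le_of_ne (Int.fract_nonneg x) (Ne.symm hx)
    have h1 := Int.fract_lt_one x
    refine ⟨min (Int.fract x) (1 - Int.fract x), lt_min h0 (by linarith), fun k _ => ?_⟩
    have hf := Int.floor_add_fract x
    rcases le_or_gt k ⌊x⌋ with h | h
    · have : (k : ℝ) ≤ ⌊x⌋ := by exact_mod_cast h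
      exact (min_le_left _ _).trans ((by linarith : Int.fract x ≤ x - k).trans (le_abs_self _))
    · have : (⌊x⌋ : ℝ) + 1 ≤ k := by exact_mod_cast h
      exact (min_le_right _ _).trans ((by linarith : 1 - Int.fract x ≤ -(x - k)).trans
        (neg_le_abs _))

/-- Squared norms are integers, so those different from `a²` keep a fixed distance from it; beyond
`2a²` the difference is at least half the squared norm. Dividing by `a² - ‖n‖²` therefore gains
`‖n‖^{-2}`. -/
theorem exists_lattice_gap (d : ℕ) {a : ℝ} (ha : 0 < a) :
    ∃ c : ℝ, 0 < c ∧ ∀ n : Fin d → ℤ, ‖latticePt n‖ ≠ a →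
      c * ‖latticePt n‖ ^ 2 ≤ |a ^ 2 - ‖latticePt n‖ ^ 2| := by
  obtain ⟨δ, hδ, h⟩ := exists_int_gap (a ^ 2)
  refine ⟨min (1 / 2) (δ / (2 * a ^ 2)), by positivity, fun n hn => ?_⟩
  obtain ⟨k, hk⟩ := norm_latticePt_sq n
  have hne : (k : ℝ) ≠ a ^ 2 := by
    rw [← hk]
    intro h'
    exact hn ((pow_left_inj₀ (norm_nonneg _) ha.le two_ne_zero).1 h')
  have h1 := h k hne
  rw [← hk] at h1
  rcases le_or_gt (‖latticePt n‖ ^ 2) (2 * a ^ 2) with h2 | h2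
  · calc min (1 / 2) (δ / (2 * a ^ 2)) * ‖latticePt n‖ ^ 2 ≤ δ / (2 * a ^ 2) * (2 * a ^ 2) := by
          gcongr; exact min_le_right _ _
      _ = δ := by field_simp
      _ ≤ _ := h1
  · calc min (1 / 2) (δ / (2 * a ^ 2)) * ‖latticePt n‖ ^ 2 ≤ 1 / 2 * ‖latticePt n‖ ^ 2 := by
          gcongr; exact min_le_left _ _
      _ ≤ -(a ^ 2 - ‖latticePt n‖ ^ 2) := by linarith
      _ ≤ _ := neg_le_abs _

theorem sqrt_sqRad_pow (d : ℕ) {l τ : ℝ} (hs : 0 < sqRad l τ) :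
    √(sqRad l τ) ^ d = sqRad l τ ^ ((d : ℝ) / 2) := by
  rw [Real.sqrt_eq_rpow, ← Real.rpow_natCast, ← Real.rpow_mul hs.le]
  ring_nf

theorem continuous_sqrt_sqRad (l : ℝ) : Continuous fun τ => √(sqRad l τ) :=
  Real.continuous_sqrt.comp (continuous_sqRad l)

theorem continuous_lamX (d : ℕ) (ν p q : ℝ) : Continuous (lamX d ν p q) := by
  have h1 : ∀ μ x : ℝ, Continuous fun l : ℝ => besselLam μ (x * l ^ 2) := fun μ x =>
    (continuous_besselLam μ).comp (by fun_prop)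
  exact (continuous_pow d).mul ((h1 _ _).mul (h1 _ _))

theorem continuous_lamY (d : ℕ) (ν p q : ℝ) : Continuous (lamY d ν p q) := by
  have h1 : ∀ μ x : ℝ, Continuous fun l : ℝ => besselLam μ (x * l ^ 2) := fun μ x =>
    (continuous_besselLam μ).comp (by fun_prop)
  exact (continuous_pow d).mul ((h1 _ _).mul (h1 _ _))

theorem continuous_sigmaBdry (d : ℕ) (β a ρ : ℝ) : Continuous (sigmaBdry d β a ρ) :=
  continuous_const.mul ((continuous_const.mul (continuous_lamX _ _ _ _)).sub
    (continuous_const.mul (continuous_lamY _ _ _ _)))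

theorem continuous_lamInt (d : ℕ) (ν p q : ℝ) : Continuous (lamInt d ν p q) :=
  intervalIntegral.continuous_primitive
    (fun a b => (continuous_lamInt_integrand d ν p q).intervalIntegrable a b) 0

theorem continuous_sigmaBall (d : ℕ) (β a ρ : ℝ) : Continuous (sigmaBall d β a ρ) :=
  continuous_const.mul (continuous_lamInt _ _ _ _)

theorem continuous_sigmaErr (d : ℕ) (β a ρ : ℝ) : Continuous (sigmaErr d β a ρ) :=
  (continuous_sigmaBall d β a ρ).sub continuous_const

/-- The average of a function of the radius, with weight `ψ`. -/
noncomputable def radAvg (ψ : ℝ → ℝ) (l : ℝ) (F : ℝ → ℝ) : ℝ :=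
  ∫ τ in (-1 : ℝ)..1, ψ τ * F √(sqRad l τ)

theorem intervalIntegrable_radAvg {ψ : ℝ → ℝ} (hψ : IsTest ψ) (l : ℝ) {F : ℝ → ℝ}
    (hF : Continuous F) (a b : ℝ) :
    IntervalIntegrable (fun τ => ψ τ * F √(sqRad l τ)) volume a b :=
  (hψ.continuous.mul (hF.comp (continuous_sqrt_sqRad l))).intervalIntegrable a b

/-- With `s = l² + lτ` the radius to the power `d` is `s · s^{d/2-1}`, and expanding the first `s`
produces the weights `ψ` and `τψ`. -/
theorem radAvg_lamX {ψ : ℝ → ℝ} (hψ : IsTest ψ) (d : ℕ) (ν p q : ℝ) {l : ℝ} (hl : 2 ≤ l) :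
    radAvg ψ l (lamX d ν p q) =
      l ^ 2 * smoothedLam ψ p (ν + 1) ((d : ℝ) / 2 - 1) q 0 l +
      l * smoothedLam (fun τ => τ * ψ τ) p (ν + 1) ((d : ℝ) / 2 - 1) q 0 l := by
  have hpos : ∀ τ ∈ Set.uIcc (-1 : ℝ) 1, 0 < sqRad l τ := fun τ hτ =>
    sqRad_pos hl (by rwa [Set.uIcc_of_le (by norm_num)] at hτ)
  have hc1 : ∀ μ x : ℝ, Continuous fun τ => besselLam μ (x * sqRad l τ) := fun μ x =>
    (continuous_besselLam μ).comp (continuous_const.mul (continuous_sqRad l))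
  have hc2 : ∀ e : ℝ, ContinuousOn (fun τ => sqRad l τ ^ e) (Set.uIcc (-1 : ℝ) 1) := fun e =>
    (continuous_sqRad l).continuousOn.rpow_const fun τ hτ => Or.inl (hpos τ hτ).ne'
  have hInt : ∀ φ : ℝ → ℝ, Continuous φ → IntervalIntegrable (fun τ => φ τ *
      (p ^ 0 * besselLam (ν + 1 + (0 : ℕ)) (p * sqRad l τ)) *
      (sqRad l τ ^ ((d : ℝ) / 2 - 1) * besselLam ((d : ℝ) / 2 - 1) (q * sqRad l τ)))
      volume (-1) 1 := fun φ hφ =>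
    ContinuousOn.intervalIntegrable ((hφ.mul (continuous_const.mul (hc1 _ _))).continuousOn.mul
      ((hc2 _).mul (hc1 _ q).continuousOn))
  rw [radAvg, smoothedLam, smoothedLam, ← intervalIntegral.integral_const_mul,
    ← intervalIntegral.integral_const_mul, ← intervalIntegral.integral_add
      ((hInt _ hψ.continuous).const_mul _) ((hInt _ hψ.id_mul.continuous).const_mul _)]
  refine intervalIntegral.integral_congr fun τ hτ => ?_
  have hs := hpos τ hτ
  simp only [lamX]
  rw [sqrt_sqRad_pow d hs, Real.sq_sqrt hs.le, show (d : ℝ) / 2 = (d : ℝ) / 2 - 1 + 1 by ring,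
    Real.rpow_add_one hs.ne']
  have e : sqRad l τ = l ^ 2 + l * τ := rfl
  simp only [add_sub_cancel_right, Nat.cast_zero, add_zero, pow_zero, one_mul]
  linear_combination (ψ τ * (sqRad l τ ^ ((d : ℝ) / 2 - 1) * (besselLam (ν + 1) (p * sqRad l τ) *
    besselLam ((d : ℝ) / 2 - 1) (q * sqRad l τ)))) * e

theorem radAvg_lamY (ψ : ℝ → ℝ) (d : ℕ) (ν p q : ℝ) {l : ℝ} (hl : 2 ≤ l) :
    radAvg ψ l (lamY d ν p q) = smoothedLam ψ p ν ((d : ℝ) / 2) q 0 l := by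
  rw [radAvg, smoothedLam]
  refine intervalIntegral.integral_congr fun τ hτ => ?_
  have hs := sqRad_pos hl (by rwa [Set.uIcc_of_le (by norm_num)] at hτ)
  simp only [lamY]
  rw [sqrt_sqRad_pow d hs, Real.sq_sqrt hs.le]
  simp only [Nat.cast_zero, add_zero, pow_zero, one_mul]
  ring

theorem rpow_pi_sq_mul_le {ρ x D : ℝ} (hρ : 1 ≤ ρ) (hx : D ≤ 2 * x) (hx0 : 0 ≤ x) :
    (Real.pi ^ 2 * ρ ^ 2) ^ (-x) ≤ ρ ^ (-D) := by
  have hρ0 : 0 < ρ := by linarith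
  have hpi : 1 ≤ Real.pi ^ 2 := by nlinarith [Real.pi_gt_three]
  calc (Real.pi ^ 2 * ρ ^ 2) ^ (-x) ≤ (ρ ^ 2) ^ (-x) :=
        Real.rpow_le_rpow_of_nonpos (by positivity) (by nlinarith [sq_nonneg ρ]) (by linarith)
    _ = ρ ^ (-(2 * x)) := by
        rw [← Real.rpow_natCast, ← Real.rpow_mul hρ0.le]; congr 1; push_cast; ring
    _ ≤ _ := Real.rpow_le_rpow_of_exponent_le hρ (by linarith)

theorem one_le_pi_sq_mul {ρ : ℝ} (hρ : 1 ≤ ρ) : 1 ≤ Real.pi ^ 2 * ρ ^ 2 := by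
  have hpi : 1 ≤ Real.pi ^ 2 := by nlinarith [Real.pi_gt_three]
  nlinarith

/-- After `d + 3` integrations by parts the second boundary term decays like `ρ^{-(d+3)}`. Its
prefactor `ρ²` then leaves `ρ^{-(d+1)}`, which is summable over the lattice. -/
theorem exists_radAvg_sigmaBdry_bound {d : ℕ} (hd : 1 ≤ d) {ψ : ℝ → ℝ} (hψ : IsTest ψ) (β : ℝ)
    {a : ℝ} (ha : 0 < a) :
    ∃ C : ℝ, 0 < C ∧ ∀ l : ℝ, 2 ≤ l → ∀ ρ : ℝ, 1 ≤ ρ →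
      |radAvg ψ l (sigmaBdry d β a ρ)| ≤ C * l ^ (-β - 1) * ρ ^ (-((d : ℝ) + 1)) := by
  have hd1 : (1 : ℝ) ≤ d := by exact_mod_cast hd
  set ν : ℝ := (d : ℝ) / 2 + β with hν
  set p : ℝ := Real.pi ^ 2 * a ^ 2 with hp
  have hp0 : 0 < p := by have := Real.pi_pos; positivity
  set A : ℝ := hatConst d β a * Real.pi ^ ((d : ℝ) / 2) with hA
  obtain ⟨C₁, hC₁0, hC₁⟩ := exists_smoothedLam_bound (besselLam_amplitude_bound hp0 (ν + 1))
    (d + 3) 0 ((d : ℝ) / 2 - 1) ψ hψ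
  obtain ⟨C₂, hC₂0, hC₂⟩ := exists_smoothedLam_bound (besselLam_amplitude_bound hp0 (ν + 1))
    (d + 3) 0 ((d : ℝ) / 2 - 1) _ hψ.id_mul
  obtain ⟨C₃, hC₃0, hC₃⟩ := exists_smoothedLam_bound (besselLam_amplitude_bound hp0 ν)
    (d + 3) 0 ((d : ℝ) / 2) ψ hψ
  refine ⟨(|A| + 1) * (a ^ 2 * (C₁ + C₂) + C₃), by positivity, fun l hl ρ hρ => ?_⟩
  have hl0 : 0 < l := by linarith
  have hρ0 : 0 < ρ := by linarith
  set q : ℝ := Real.pi ^ 2 * ρ ^ 2 with hq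
  have hq1 : 1 ≤ q := one_le_pi_sq_mul hρ
  have h1 := hC₁ l hl q hq1
  have h2 := hC₂ l hl q hq1
  have h3 := hC₃ l hl q hq1
  have e1 : -(ν + 1) - 1 / 2 - ((0 : ℕ) : ℝ) + ((d : ℝ) / 2 - 1) - 1 / 2 = -β - 1 - 2 := by
    rw [hν]; push_cast; ring
  have e3 : -ν - 1 / 2 - ((0 : ℕ) : ℝ) + (d : ℝ) / 2 - 1 / 2 = -β - 1 := by
    rw [hν]; push_cast; ring
  rw [e1] at h1 h2
  rw [e3] at h3
  have hl2 : l ^ (-β - 1) = l ^ (-β - 1 - 2) * l ^ 2 := by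
    rw [← Real.rpow_natCast l 2, ← Real.rpow_add hl0]; congr 1; push_cast; ring
  set R : ℝ := ρ ^ (-((d : ℝ) + 1)) with hR
  have hR0 : 0 < R := by positivity
  have hρ3 : ρ ^ 2 * ρ ^ (-((d : ℝ) + 3)) = R := by
    rw [← Real.rpow_natCast ρ 2, ← Real.rpow_add hρ0, hR]; congr 1; push_cast; ring
  have hq2 : q ^ (-((d : ℝ) / 2 - 1) / 2 - 1 / 4 - ((d + 3 : ℕ) : ℝ) / 2) ≤ R := by
    have := rpow_pi_sq_mul_le (ρ := ρ) (x := ((d : ℝ) / 2 - 1) / 2 + 1 / 4 + ((d + 3 : ℕ) : ℝ) / 2)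
      (D := (d : ℝ) + 1) hρ (by push_cast; linarith) (by push_cast; linarith)
    refine le_trans (le_of_eq ?_) this
    congr 1; ring
  have hq3 : q ^ (-((d : ℝ) / 2) / 2 - 1 / 4 - ((d + 3 : ℕ) : ℝ) / 2) ≤ ρ ^ (-((d : ℝ) + 3)) := by
    have := rpow_pi_sq_mul_le (ρ := ρ) (x := ((d : ℝ) / 2) / 2 + 1 / 4 + ((d + 3 : ℕ) : ℝ) / 2)
      (D := (d : ℝ) + 3) hρ (by push_cast; linarith) (by push_cast; linarith)
    refine le_trans (le_of_eq ?_) this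
    congr 1; ring
  have hX : |radAvg ψ l (lamX d ν p q)| ≤ (C₁ + C₂) * l ^ (-β - 1) * R := by
    rw [radAvg_lamX hψ d ν p q hl]
    refine (abs_add_le _ _).trans ?_
    rw [abs_mul, abs_mul, abs_of_pos hl0, abs_of_pos (by positivity : 0 < l ^ 2)]
    have t1 : l ^ 2 * |smoothedLam ψ p (ν + 1) ((d : ℝ) / 2 - 1) q 0 l| ≤
        l ^ 2 * (C₁ * l ^ (-β - 1 - 2) * R) := by
      gcongr; exact h1.trans (by gcongr)
    have t2 : l * |smoothedLam (fun τ => τ * ψ τ) p (ν + 1) ((d : ℝ) / 2 - 1) q 0 l| ≤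
        l ^ 2 * (C₂ * l ^ (-β - 1 - 2) * R) := by
      have : l ≤ l ^ 2 := by nlinarith
      gcongr; exact h2.trans (by gcongr)
    rw [hl2]
    linarith
  have hY : ρ ^ 2 * |radAvg ψ l (lamY d ν p q)| ≤ C₃ * l ^ (-β - 1) * R := by
    rw [radAvg_lamY ψ d ν p q hl, ← hρ3]
    calc ρ ^ 2 * |smoothedLam ψ p ν ((d : ℝ) / 2) q 0 l| ≤
          ρ ^ 2 * (C₃ * l ^ (-β - 1) * ρ ^ (-((d : ℝ) + 3))) := by
          gcongr; exact h3.trans (by gcongr)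
      _ = _ := by ring
  have hsplit : radAvg ψ l (sigmaBdry d β a ρ) =
      A * (a ^ 2 * radAvg ψ l (lamX d ν p q) - ρ ^ 2 * radAvg ψ l (lamY d ν p q)) := by
    rw [radAvg, radAvg, radAvg, ← intervalIntegral.integral_const_mul,
      ← intervalIntegral.integral_const_mul, ← intervalIntegral.integral_sub
        ((intervalIntegrable_radAvg hψ l (continuous_lamX d ν p q) _ _).const_mul _)
        ((intervalIntegrable_radAvg hψ l (continuous_lamY d ν p q) _ _).const_mul _),
      ← intervalIntegral.integral_const_mul]
    refine intervalIntegral.integral_congr fun τ _ => ?_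
    simp only [sigmaBdry, hA, hν, hp, hq]
    ring
  rw [hsplit, abs_mul]
  calc |A| * |a ^ 2 * radAvg ψ l (lamX d ν p q) - ρ ^ 2 * radAvg ψ l (lamY d ν p q)| ≤
      (|A| + 1) * (a ^ 2 * |radAvg ψ l (lamX d ν p q)| + ρ ^ 2 * |radAvg ψ l (lamY d ν p q)|) := by
        refine mul_le_mul (by linarith) ?_ (abs_nonneg _) (by positivity)
        refine (abs_sub _ _).trans ?_
        rw [abs_mul, abs_mul, abs_of_pos (by positivity : 0 < a ^ 2),
          abs_of_pos (by positivity : 0 < ρ ^ 2)]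
    _ ≤ (|A| + 1) * (a ^ 2 * ((C₁ + C₂) * l ^ (-β - 1) * R) + C₃ * l ^ (-β - 1) * R) := by
        gcongr
    _ = _ := by ring

/-- `K` uses of the Green identity, each gaining `ρ^{-2}`, bring the exponent into the range of
Fourier inversion. The boundary terms of the later steps are no larger than the first, because `l ≥
2`. -/
theorem exists_radAvg_sigmaErr_bound_iter {d : ℕ} (hd : 1 ≤ d) {ψ : ℝ → ℝ} (hψ : IsTest ψ)
    {a : ℝ} (ha : 0 < a) (K : ℕ) :
    ∀ β : ℝ, -1 < β → 0 < β + K → ((d : ℝ) - 1) / 2 < β + K →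
    ∃ C : ℝ, 0 < C ∧ ∀ l : ℝ, 2 ≤ l → ∀ n : Fin d → ℤ, n ≠ 0 → ‖latticePt n‖ ≠ a →
      |radAvg ψ l (sigmaErr d β a ‖latticePt n‖)| ≤
        C * (l ^ (-β - 1) * ‖latticePt n‖ ^ (-((d : ℝ) + 1)) +
          ‖latticePt n‖ ^ (-(2 * K : ℝ)) * l ^ (((d : ℝ) - 1) / 2 - β - K)) := by
  induction K with
  | zero =>
    intro β hβ h0 h1
    simp only [Nat.cast_zero, add_zero] at h0 h1
    obtain ⟨C, hC0, hC⟩ := exists_sigmaErr_bound_of_large hd ha h0 h1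
    obtain ⟨B, hB0, hB⟩ := hψ.exists_bound
    set e : ℝ := ((d : ℝ) - 1) / 2 - β with he
    refine ⟨2 * (B * (C * 2 ^ |e / 2|)), by positivity, fun l hl n hn hna => ?_⟩
    have hl0 : 0 < l := by linarith
    have h := intervalIntegral.norm_integral_le_of_norm_le_const (a := (-1 : ℝ)) (b := 1)
      (f := fun τ => ψ τ * sigmaErr d β a ‖latticePt n‖ √(sqRad l τ))
      (C := B * (C * 2 ^ |e / 2|) * l ^ e) ?_
    · rw [radAvg, ← Real.norm_eq_abs]
      refine h.trans ?_
      have h3 : 0 ≤ l ^ (-β - 1) * ‖latticePt n‖ ^ (-((d : ℝ) + 1)) := by positivity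
      simp only [Nat.cast_zero, mul_zero, neg_zero, Real.rpow_zero, one_mul, sub_zero]
      rw [show |(1 : ℝ) - -1| = 2 by norm_num]
      have h4 : 0 ≤ 2 * (B * (C * 2 ^ |e / 2|)) := by positivity
      have := mul_nonneg h4 h3
      linarith
    · intro τ hτ
      rw [Set.uIoc_of_le (by norm_num)] at hτ
      have hτ' : τ ∈ Set.Icc (-1 : ℝ) 1 := ⟨hτ.1.le, hτ.2⟩
      have hs0 := sqRad_pos hl hτ'
      have hs1 : 1 ≤ sqRad l τ := by nlinarith [sqRad_ge hl hτ']
      have h2 := hC (latticePt n) (√(sqRad l τ)) (Real.one_le_sqrt.2 hs1)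
      rw [Real.sqrt_eq_rpow, ← Real.rpow_mul hs0.le, show 1 / 2 * e = e / 2 by ring] at h2
      have h3 := sqRad_rpow_le hl hτ' (e / 2)
      rw [show 2 * (e / 2) = e by ring] at h3
      rw [norm_mul, Real.norm_eq_abs, Real.norm_eq_abs, mul_assoc]
      refine mul_le_mul (hB τ) ?_ (abs_nonneg _) hB0.le
      rw [Real.sqrt_eq_rpow]
      refine h2.trans ?_
      rw [mul_assoc]
      gcongr
  | succ K ih =>
    intro β hβ h0 h1
    push_cast at h0 h1
    obtain ⟨C₁, hC₁0, hC₁⟩ := ih (β + 1) (by linarith) (by linarith) (by linarith)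
    obtain ⟨C₂, hC₂0, hC₂⟩ := exists_radAvg_sigmaBdry_bound hd hψ β ha
    obtain ⟨c, hc0, hc⟩ := exists_lattice_gap d ha
    refine ⟨c⁻¹ * (C₁ + C₂), by positivity, fun l hl n hn hna => ?_⟩
    have hl0 : 0 < l := by linarith
    set ρ := ‖latticePt n‖ with hρ
    have hρ1 : 1 ≤ ρ := one_le_norm_latticePt hn
    have hρ0 : 0 < ρ := by linarith
    have g1 := hC₁ l hl n hn hna
    have g2 := hC₂ l hl ρ hρ1
    have g3 := hc n hna
    have hsplit : (a ^ 2 - ρ ^ 2) * radAvg ψ l (sigmaErr d β a ρ) =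
        radAvg ψ l (sigmaErr d (β + 1) a ρ) + radAvg ψ l (sigmaBdry d β a ρ) := by
      rw [radAvg, radAvg, radAvg, ← intervalIntegral.integral_const_mul,
        ← intervalIntegral.integral_add
          (intervalIntegrable_radAvg hψ l (continuous_sigmaErr _ _ _ _) _ _)
          (intervalIntegrable_radAvg hψ l (continuous_sigmaBdry _ _ _ _) _ _)]
      refine intervalIntegral.integral_congr fun τ _ => ?_
      have := sigmaErr_green hd hβ ha hρ0.le √(sqRad l τ)
      linear_combination (ψ τ) * this
    have h5 : c * ρ ^ 2 * |radAvg ψ l (sigmaErr d β a ρ)| ≤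
        |radAvg ψ l (sigmaErr d (β + 1) a ρ)| + |radAvg ψ l (sigmaBdry d β a ρ)| := by
      refine le_trans ?_ (abs_add_le _ _)
      rw [← hsplit, abs_mul]
      gcongr
    set P : ℝ := l ^ (-β - 1) * ρ ^ (-((d : ℝ) + 1)) with hP
    have hP0 : 0 < P := by positivity
    set Q : ℝ := ρ ^ (-(2 * K : ℝ)) * l ^ (((d : ℝ) - 1) / 2 - (β + 1) - K) with hQ
    have hQ0 : 0 < Q := by positivity
    have h6 : l ^ (-(β + 1) - 1) * ρ ^ (-((d : ℝ) + 1)) ≤ P := by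
      rw [hP]; gcongr
      · linarith
      · linarith
    have h7 : ρ ^ (-(2 * ((K + 1 : ℕ) : ℝ))) * l ^ (((d : ℝ) - 1) / 2 - β - ((K + 1 : ℕ) : ℝ)) =
        Q / ρ ^ 2 := by
      rw [hQ, show -(2 * ((K + 1 : ℕ) : ℝ)) = -(2 * K : ℝ) - (2 : ℕ) by push_cast; ring,
        Real.rpow_sub_natCast hρ0.ne', show ((d : ℝ) - 1) / 2 - β - ((K + 1 : ℕ) : ℝ) =
        ((d : ℝ) - 1) / 2 - (β + 1) - K by push_cast; ring]
      ring
    rw [h7]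
    have h8 : c * ρ ^ 2 * |radAvg ψ l (sigmaErr d β a ρ)| ≤ (C₁ + C₂) * (P + Q) := by
      have t2 : |radAvg ψ l (sigmaBdry d β a ρ)| ≤ C₂ * P := by rw [hP]; linarith
      have t1 : |radAvg ψ l (sigmaErr d (β + 1) a ρ)| ≤ C₁ * (P + Q) :=
        g1.trans (by gcongr)
      have : 0 ≤ C₂ * Q := by positivity
      linarith
    have h9 : P + Q ≤ ρ ^ 2 * (P + Q / ρ ^ 2) := by
      have : ρ ^ 2 * (P + Q / ρ ^ 2) = ρ ^ 2 * P + Q := by field_simp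
      rw [this]
      have : 1 ≤ ρ ^ 2 := one_le_pow₀ hρ1
      nlinarith
    have h10 : c * ρ ^ 2 * |radAvg ψ l (sigmaErr d β a ρ)| ≤
        c * ρ ^ 2 * (c⁻¹ * (C₁ + C₂) * (P + Q / ρ ^ 2)) := by
      calc _ ≤ (C₁ + C₂) * (ρ ^ 2 * (P + Q / ρ ^ 2)) := h8.trans (by gcongr)
        _ = _ := by field_simp
    exact le_of_mul_le_mul_left h10 (by positivity)

theorem exists_radAvg_sigmaErr_bound {d : ℕ} (hd : 1 ≤ d) {ψ : ℝ → ℝ} (hψ : IsTest ψ)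
    {β a : ℝ} (hβ : -1 < β) (ha : 0 < a) :
    ∃ C : ℝ, 0 < C ∧ ∀ l : ℝ, 2 ≤ l → ∀ n : Fin d → ℤ, n ≠ 0 → ‖latticePt n‖ ≠ a →
      |radAvg ψ l (sigmaErr d β a ‖latticePt n‖)| ≤
        C * l ^ (-β - 1) * ‖latticePt n‖ ^ (-((d : ℝ) + 1)) := by
  have hd1 : (1 : ℝ) ≤ d := by exact_mod_cast hd
  -- `K = d + 1` suffices on all counts: `β + K > (d-1)/2`, `2K ≥ d + 1` and `(d-1)/2 - K ≤ -1`.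
  obtain ⟨C, hC0, hC⟩ := exists_radAvg_sigmaErr_bound_iter hd hψ ha (d + 1) β hβ
    (by push_cast; linarith) (by push_cast; linarith)
  refine ⟨2 * C, by positivity, fun l hl n hn hna => ?_⟩
  have hl0 : 0 < l := by linarith
  have hρ1 : 1 ≤ ‖latticePt n‖ := one_le_norm_latticePt hn
  refine (hC l hl n hn hna).trans ?_
  have h1 : ‖latticePt n‖ ^ (-(2 * ((d + 1 : ℕ) : ℝ))) ≤ ‖latticePt n‖ ^ (-((d : ℝ) + 1)) :=
    Real.rpow_le_rpow_of_exponent_le hρ1 (by push_cast; linarith)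
  have h2 : l ^ (((d : ℝ) - 1) / 2 - β - ((d + 1 : ℕ) : ℝ)) ≤ l ^ (-β - 1) :=
    Real.rpow_le_rpow_of_exponent_le (by linarith) (by push_cast; linarith)
  have h3 : ‖latticePt n‖ ^ (-(2 * ((d + 1 : ℕ) : ℝ))) *
      l ^ (((d : ℝ) - 1) / 2 - β - ((d + 1 : ℕ) : ℝ)) ≤
      l ^ (-β - 1) * ‖latticePt n‖ ^ (-((d : ℝ) + 1)) := by
    rw [mul_comm]
    gcongr
  calc _ ≤ C * (l ^ (-β - 1) * ‖latticePt n‖ ^ (-((d : ℝ) + 1)) +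
        l ^ (-β - 1) * ‖latticePt n‖ ^ (-((d : ℝ) + 1))) := by gcongr
    _ = _ := by ring


/-! ### Lattice points in thin annuli -/

theorem IsTest.comp_annulus_eq_zero {χ : ℝ → ℝ} (hχ : IsTest χ) {l : ℝ} (hl : 2 ≤ l) {r : ℝ}
    (hr : 2 * l ≤ r) : χ ((r ^ 2 - l ^ 2) / l) = 0 := by
  refine hχ.eq_zero fun h => ?_
  have h2 := h.2
  rw [div_lt_one (by linarith)] at h2
  nlinarith

/-- Polar coordinates followed by `s = r²` and `s = l² + lτ` give a smoothed product whose first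
factor is `Λ_0(0) = 1`, so the integration by parts bound applies to shell cutoffs as well. -/
theorem integral_annulus_mul_cos {d : ℕ} (hd : 1 ≤ d) {χ : ℝ → ℝ} (hχ : IsTest χ) {l : ℝ}
    (hl : 2 ≤ l) (y : E d) :
    ∫ x : E d, χ ((‖x‖ ^ 2 - l ^ 2) / l) * Real.cos (2 * Real.pi * inner ℝ x y) =
      Real.pi ^ ((d : ℝ) / 2) *
        (l * smoothedLam χ 0 0 ((d : ℝ) / 2 - 1) (Real.pi ^ 2 * ‖y‖ ^ 2) 0 l) := by
  have hl0 : 0 < l := by linarith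
  set q : ℝ := Real.pi ^ 2 * ‖y‖ ^ 2 with hq
  have hInt : Integrable fun x : E d => χ ((‖x‖ ^ 2 - l ^ 2) / l) := by
    refine Continuous.integrable_of_hasCompactSupport ?_ ?_
    · exact hχ.continuous.comp (by fun_prop)
    · refine HasCompactSupport.intro (isCompact_closedBall (0 : E d) (2 * l)) fun x hx => ?_
      rw [mem_closedBall_zero_iff, not_le] at hx
      exact hχ.comp_annulus_eq_zero hl hx.le
  rw [integral_radial_mul_cos hd (h := fun r => χ ((r ^ 2 - l ^ 2) / l)) hInt y,
    mul_comm 2, mul_assoc]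
  congr 1
  set G : ℝ → ℝ := fun s => χ ((s - l ^ 2) / l) *
    (s ^ ((d : ℝ) / 2 - 1) * besselLam ((d : ℝ) / 2 - 1) (q * s)) with hG
  have h1 : 2 * ∫ r in Set.Ioi (0 : ℝ), χ ((r ^ 2 - l ^ 2) / l) * (r ^ (d - 1) *
        besselLam ((d : ℝ) / 2 - 1) (q * r ^ 2)) = ∫ s in Set.Ioi (0 : ℝ), G s := by
    rw [← integral_comp_rpow_Ioi G (two_ne_zero), ← integral_const_mul]
    refine setIntegral_congr_fun measurableSet_Ioi fun r hr => ?_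
    have hr0 : (0 : ℝ) < r := hr
    have e1 : (r ^ 2) ^ ((d : ℝ) / 2 - 1) * r = r ^ (d - 1) := by
      rw [← Real.rpow_natCast r 2, ← Real.rpow_mul hr0.le, ← Real.rpow_add_one hr0.ne',
        ← Real.rpow_natCast, Nat.cast_sub hd]
      congr 1; push_cast; ring
    simp only [hG, Real.rpow_two, smul_eq_mul, abs_two, show (2 : ℝ) - 1 = 1 by norm_num,
      Real.rpow_one]
    rw [← e1]; ring
  rw [h1]
  have h2 : ∫ s in Set.Ioi (0 : ℝ), G s = ∫ s in (l ^ 2 + l * (-1))..(l ^ 2 + l * 1), G s := by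
    rw [intervalIntegral.integral_of_le (by linarith)]
    refine setIntegral_eq_of_subset_of_forall_sdiff_eq_zero measurableSet_Ioi ?_ ?_
    · intro s hs
      have : l ^ 2 + l * (-1) < s := hs.1
      show 0 < s
      nlinarith
    · intro s hs
      simp only [hG]
      rw [hχ.eq_zero, zero_mul]
      intro h
      refine hs.2 ⟨?_, ?_⟩
      · have := h.1
        rw [lt_div_iff₀ hl0] at this
        linarith
      · have := h.2
        rw [div_lt_iff₀ hl0] at this
        linarith
  rw [h2, ← intervalIntegral.smul_integral_comp_add_mul, smul_eq_mul, smoothedLam]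
  congr 1
  refine intervalIntegral.integral_congr fun τ _ => ?_
  have e2 : (l ^ 2 + l * τ - l ^ 2) / l = τ := by field_simp; ring
  simp only [hG, e2, sqRad]
  simp [besselLam_zero_right]

theorem one_amplitude_bound (j : ℕ) :
    ∃ C : ℝ, 0 < C ∧ ∀ l : ℝ, 2 ≤ l → ∀ τ ∈ Set.Icc (-1 : ℝ) 1,
      |(0 : ℝ) ^ j * besselLam (0 + j) (0 * sqRad l τ)| ≤ C * l ^ ((0 : ℝ) - j) := by
  refine ⟨1, one_pos, fun l hl τ hτ => ?_⟩
  rcases Nat.eq_zero_or_pos j with rfl | hj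
  · simp [besselLam_zero_right]
  · rw [zero_pow hj.ne', zero_mul, abs_zero]
    positivity

/-- Poisson summation: the zero frequency is the weighted volume of the shell, and all others
together are `O(l^{(d-1)/2})`. The order of quantifiers matters: `C₀` is fixed before `χ`, and only
`C` depends on its smoothness. -/
theorem exists_annulus_sum_bound {d : ℕ} (hd : 1 ≤ d) :
    ∃ C₀ : ℝ, 0 < C₀ ∧ ∀ χ : ℝ → ℝ, IsTest χ → (∀ τ, 0 ≤ χ τ) →
      ∃ C : ℝ, 0 < C ∧ ∀ l : ℝ, 2 ≤ l →
        ∑ m ∈ latticeBall d (2 * l), χ ((‖latticePt m‖ ^ 2 - l ^ 2) / l) ≤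
          C₀ * (∫ τ in (-1 : ℝ)..1, χ τ) * l ^ ((d : ℝ) - 1) + C * l ^ (((d : ℝ) - 1) / 2) := by
  have hd1 : (1 : ℝ) ≤ d := by exact_mod_cast hd
  set κ : ℝ := (d : ℝ) / 2 - 1 with hκ
  have hG : 0 < (Real.Gamma ((d : ℝ) / 2))⁻¹ := inv_pos.2 (Real.Gamma_pos_of_pos (by linarith))
  set P : ℝ := Real.pi ^ ((d : ℝ) / 2) with hP
  have hP0 : 0 < P := by positivity
  refine ⟨P * (2 ^ |κ| * (Real.Gamma ((d : ℝ) / 2))⁻¹), by positivity, fun χ hχ hχ0 => ?_⟩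
  obtain ⟨C, hC0, hC⟩ := exists_smoothedLam_bound one_amplitude_bound (d + 1) 0 κ χ hχ
  have hsum := summable_lattice_rpow d
  have hS0 : 0 ≤ ∑' n : Fin d → ℤ, ‖latticePt n‖ ^ (-((d : ℝ) + 1)) :=
    tsum_nonneg fun n => by positivity
  refine ⟨P * C * (∑' n : Fin d → ℤ, ‖latticePt n‖ ^ (-((d : ℝ) + 1))) + 1, by positivity,
    fun l hl => ?_⟩
  have hl0 : 0 < l := by linarith
  have hb : ∀ n : Fin d → ℤ, n ≠ 0 →
      |∫ x : E d, χ ((‖x‖ ^ 2 - l ^ 2) / l) * Real.cos (2 * Real.pi * inner ℝ x (latticePt n))| ≤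
        P * C * l ^ (((d : ℝ) - 1) / 2) * ‖latticePt n‖ ^ (-((d : ℝ) + 1)) := by
    intro n hn
    have hn1 := one_le_norm_latticePt hn
    rw [integral_annulus_mul_cos hd hχ hl, abs_mul, abs_mul, abs_of_pos hP0, abs_of_pos hl0]
    have h1 := hC l hl _ (one_le_pi_sq_mul hn1)
    have h2 := rpow_pi_sq_mul_le (x := κ / 2 + 1 / 4 + ((d + 1 : ℕ) : ℝ) / 2) (D := (d : ℝ) + 1) hn1
      (by push_cast; rw [hκ]; linarith) (by push_cast; rw [hκ]; linarith)
    rw [show -(κ / 2 + 1 / 4 + ((d + 1 : ℕ) : ℝ) / 2) = -κ / 2 - 1 / 4 - ((d + 1 : ℕ) : ℝ) / 2 by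
      ring] at h2
    have h3 : l * l ^ ((0 : ℝ) - (0 : ℕ) + κ - 1 / 2) = l ^ (((d : ℝ) - 1) / 2) := by
      rw [mul_comm, ← Real.rpow_add_one hl0.ne']
      congr 1; rw [hκ]; push_cast; ring
    calc P * (l * _) ≤ P * (l * (C * l ^ ((0 : ℝ) - (0 : ℕ) + κ - 1 / 2) *
          ‖latticePt n‖ ^ (-((d : ℝ) + 1)))) := by
          gcongr
          exact h1.trans (by gcongr)
      _ = P * C * (l * l ^ ((0 : ℝ) - (0 : ℕ) + κ - 1 / 2)) *
          ‖latticePt n‖ ^ (-((d : ℝ) + 1)) := by ring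
      _ = _ := by rw [h3]
  set w : (Fin d → ℤ) → ℝ := fun n =>
    ∫ x : E d, χ ((‖x‖ ^ 2 - l ^ 2) / l) * Real.cos (2 * Real.pi * inner ℝ x (latticePt n)) with hw
  have hw1 : Summable w := by
    refine Summable.of_norm_bounded_eventually
      (hsum.mul_left (P * C * l ^ (((d : ℝ) - 1) / 2))) ?_
    refine (Set.finite_singleton (0 : Fin d → ℤ)).subset fun n hn => ?_
    by_contra h
    exact hn (hb n h)
  have hp := poisson_summation (f := fun x : E d => χ ((‖x‖ ^ 2 - l ^ 2) / l)) (R := 2 * l)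
    (hχ.continuous.comp (by fun_prop)) (fun x => by simp only [norm_neg])
    (fun x hx => hχ.comp_annulus_eq_zero hl hx) hw1
  rw [← hp, hw1.tsum_eq_add_tsum_ite 0]
  have hrest : ∑' n, (if n = 0 then 0 else w n) ≤
      (P * C * l ^ (((d : ℝ) - 1) / 2)) * ∑' n : Fin d → ℤ, ‖latticePt n‖ ^ (-((d : ℝ) + 1)) := by
    rw [← tsum_mul_left]
    refine Summable.tsum_le_tsum (fun n => ?_) ?_ (hsum.mul_left _)
    · split_ifs with h
      · positivity
      · exact (le_abs_self _).trans (hb n h)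
    · exact (hw1.hasSum.update 0 0).summable.congr fun n => by
        simp [Function.update_apply]
  have hzero : w 0 ≤ P * (2 ^ |κ| * (Real.Gamma ((d : ℝ) / 2))⁻¹) * (∫ τ in (-1 : ℝ)..1, χ τ) *
      l ^ ((d : ℝ) - 1) := by
    simp only [hw]
    rw [integral_annulus_mul_cos hd hχ hl, latticePt_zero, norm_zero, smoothedLam]
    have h4 : l ^ ((d : ℝ) - 1) = l * l ^ (2 * κ) := by
      rw [mul_comm, ← Real.rpow_add_one hl0.ne']
      congr 1; rw [hκ]; ring
    rw [h4]
    have h5 : ∫ τ in (-1 : ℝ)..1, χ τ * ((0 : ℝ) ^ 0 * besselLam (0 + (0 : ℕ)) (0 * sqRad l τ)) *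
        (sqRad l τ ^ κ * besselLam κ (Real.pi ^ 2 * 0 ^ 2 * sqRad l τ)) ≤
        ∫ τ in (-1 : ℝ)..1, χ τ * (2 ^ |κ| * l ^ (2 * κ) * (Real.Gamma ((d : ℝ) / 2))⁻¹) := by
      refine intervalIntegral.integral_mono_on (by norm_num) ?_ ?_ fun τ hτ => ?_
      · refine ContinuousOn.intervalIntegrable ?_
        rw [Set.uIcc_of_le (by norm_num)]
        exact (hχ.continuous.mul (continuous_const.mul ((continuous_besselLam _).comp
          (continuous_const.mul (continuous_sqRad l))))).continuousOn.mul
          (((continuous_sqRad l).continuousOn.rpow_const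
            fun τ hτ => Or.inl (sqRad_pos hl hτ).ne').mul ((continuous_besselLam κ).comp
          (continuous_const.mul (continuous_sqRad l))).continuousOn)
      · exact (hχ.continuous.mul continuous_const).intervalIntegrable _ _
      · have h6 := sqRad_rpow_le hl hτ κ
        have e : besselLam κ (Real.pi ^ 2 * 0 ^ 2 * sqRad l τ) = (Real.Gamma ((d : ℝ) / 2))⁻¹ := by
          rw [show Real.pi ^ 2 * 0 ^ 2 * sqRad l τ = 0 by ring, besselLam_zero_right, hκ]
          congr 2; ring
        rw [e]
        have e2 : (0 : ℝ) ^ 0 * besselLam (0 + (0 : ℕ)) (0 * sqRad l τ) = 1 := by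
          simp [besselLam_zero_right]
        rw [e2, mul_one]
        have := hχ0 τ
        gcongr
    rw [intervalIntegral.integral_mul_const] at h5
    refine (mul_le_mul_of_nonneg_left (mul_le_mul_of_nonneg_left h5 hl0.le) hP0.le).trans_eq ?_
    ring
  have : 0 < l ^ (((d : ℝ) - 1) / 2) := by positivity
  linarith [hzero, hrest]

theorem exists_annulus_count {d : ℕ} (hd : 1 ≤ d) :
    ∃ C₀ : ℝ, 0 < C₀ ∧ ∀ ε : ℝ, 0 < ε → ε ≤ 1 / 2 → ∃ C : ℝ, 0 < C ∧ ∀ l : ℝ, 2 ≤ l →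
      (((latticeBall d (√(sqRad l ε))).filter fun m => l ≤ ‖latticePt m‖).card : ℝ) ≤
        C₀ * ε * l ^ ((d : ℝ) - 1) + C * l ^ (((d : ℝ) - 1) / 2) := by
  obtain ⟨C₀, hC₀, h⟩ := exists_annulus_sum_bound hd
  refine ⟨C₀ * 2, by positivity, fun ε hε hε2 => ?_⟩
  -- This bump is 1 on `[0, ε]` and lives on `[-ε/2, 3ε/2]`, which lies in `(-1, 1)` since `ε ≤
  -- 1/2`; its mass is at most `2ε`.
  let χ : ContDiffBump (ε / 2 : ℝ) := ⟨ε / 2, ε, by positivity, by linarith⟩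
  have hχ : IsTest χ := by
    refine ⟨χ.contDiff, ?_⟩
    rw [χ.tsupport_eq, Real.closedBall_eq_Icc]
    refine Set.Icc_subset_Ioo ?_ ?_ <;> simp only [χ] <;> linarith
  obtain ⟨C, hC0, hC⟩ := h χ hχ fun τ => χ.nonneg
  refine ⟨C, hC0, fun l hl => ?_⟩
  have hl0 : 0 < l := by linarith
  have h1 : ∫ τ in (-1 : ℝ)..1, χ τ ≤ 2 * ε := by
    rw [intervalIntegral.integral_of_le (by norm_num)]
    refine (setIntegral_le_integral χ.integrable (ae_of_all _ fun τ => χ.nonneg)).trans ?_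
    refine (χ.integral_le_measure_closedBall volume).trans ?_
    rw [Real.volume_real_closedBall (by positivity)]
  have h2 := hC l hl
  have h3 : (((latticeBall d (√(sqRad l ε))).filter fun m => l ≤ ‖latticePt m‖).card : ℝ) ≤
      ∑ m ∈ latticeBall d (2 * l), χ ((‖latticePt m‖ ^ 2 - l ^ 2) / l) := by
    rw [Finset.card_eq_sum_ones, Nat.cast_sum]
    have hε1 : ε ∈ Set.Icc (-1 : ℝ) 1 := ⟨by linarith, by linarith⟩
    have hs := sqRad_le hl hε1
    have hs0 := sqRad_pos hl hε1
    calc ∑ m ∈ (latticeBall d (√(sqRad l ε))).filter fun m => l ≤ ‖latticePt m‖, ((1 : ℕ) : ℝ)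
        = ∑ m ∈ (latticeBall d (√(sqRad l ε))).filter fun m => l ≤ ‖latticePt m‖,
            χ ((‖latticePt m‖ ^ 2 - l ^ 2) / l) := by
          refine Finset.sum_congr rfl fun m hm => ?_
          rw [Finset.mem_filter, mem_latticeBall] at hm
          rw [χ.one_of_mem_closedBall, Nat.cast_one]
          have h5 := (Real.lt_sqrt (norm_nonneg _)).1 hm.1
          rw [sqRad] at h5
          rw [Real.closedBall_eq_Icc]
          simp only [χ]
          constructor
          · rw [sub_self]
            have := hm.2
            apply div_nonneg _ hl0.le
            nlinarith
          · rw [div_le_iff₀ hl0]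
            nlinarith
      _ ≤ _ := by
          refine Finset.sum_le_sum_of_subset_of_nonneg ?_ fun m _ _ => χ.nonneg
          intro m hm
          rw [Finset.mem_filter, mem_latticeBall] at hm
          rw [mem_latticeBall]
          refine hm.1.trans_le ((Real.sqrt_le_sqrt hs).trans ?_)
          rw [Real.sqrt_le_left (by positivity)]
          nlinarith
  refine h3.trans (h2.trans ?_)
  have : 0 < l ^ ((d : ℝ) - 1) := by positivity
  have h4 : C₀ * (∫ τ in (-1 : ℝ)..1, χ τ) ≤ C₀ * 2 * ε := by nlinarith
  gcongr


/-! ### The error term of the spherical partial sums -/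

/-- A mollified indicator function of `{y | y < l ^ 2}`. -/
noncomputable def radCutoff (ψ : ℝ → ℝ) (l y : ℝ) : ℝ :=
  ∫ τ in (max (-1) (min 1 ((y - l ^ 2) / l)))..1, ψ τ

theorem lt_sqRad_iff {l y τ : ℝ} (hl : 0 < l) : y < sqRad l τ ↔ (y - l ^ 2) / l < τ := by
  rw [div_lt_iff₀ hl, sqRad]
  constructor <;> intro h <;> linarith

theorem integral_mul_ite_eq_radCutoff (ψ : ℝ → ℝ) {l : ℝ} (hl : 0 < l) (y : ℝ) :
    ∫ τ in (-1 : ℝ)..1, ψ τ * (if y < sqRad l τ then 1 else 0) = radCutoff ψ l y := by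
  rw [radCutoff, intervalIntegral.integral_of_le (by norm_num),
    intervalIntegral.integral_of_le (max_le (by norm_num) (min_le_left _ _))]
  have h1 : ∀ τ, ψ τ * (if y < sqRad l τ then 1 else 0) =
      (Set.Ioi ((y - l ^ 2) / l)).indicator ψ τ := by
    intro τ
    simp only [Set.indicator_apply, Set.mem_Ioi, lt_sqRad_iff hl, mul_ite, mul_one, mul_zero]
  simp_rw [h1]
  rw [setIntegral_indicator measurableSet_Ioi]
  congr 2
  ext τ
  simp only [Set.mem_inter_iff, Set.mem_Ioc, Set.mem_Ioi, max_lt_iff, min_lt_iff]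
  constructor
  · rintro ⟨⟨h1, h2⟩, h3⟩
    exact ⟨⟨h1, Or.inr h3⟩, h2⟩
  · rintro ⟨⟨h1, h2 | h2⟩, h3⟩
    · linarith
    · exact ⟨⟨h1, h3⟩, h2⟩

theorem continuous_radCutoff {ψ : ℝ → ℝ} (hψ : IsTest ψ) (l : ℝ) : Continuous (radCutoff ψ l) := by
  have h : Continuous fun c => ∫ τ in (1 : ℝ)..c, ψ τ :=
    intervalIntegral.continuous_primitive (fun a b => hψ.continuous.intervalIntegrable a b) 1
  have h2 : radCutoff ψ l = fun y =>
      -((fun c => ∫ τ in (1 : ℝ)..c, ψ τ) (max (-1) (min 1 ((y - l ^ 2) / l)))) := by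
    funext y
    rw [radCutoff, intervalIntegral.integral_symm]
  rw [h2]
  exact (h.comp (by fun_prop)).neg

theorem radCutoff_eq_zero (ψ : ℝ → ℝ) {l y : ℝ} (hl : 2 ≤ l) (hy : 2 * l ≤ y) :
    radCutoff ψ l (y ^ 2) = 0 := by
  rw [radCutoff, min_eq_left, max_eq_right (by norm_num), intervalIntegral.integral_same]
  rw [le_div_iff₀ (by linarith)]
  nlinarith

theorem measurable_ite_lt_sqRad (l y : ℝ) :
    Measurable fun τ => if y < sqRad l τ then (1 : ℝ) else 0 :=
  Measurable.ite (measurableSet_lt measurable_const (continuous_sqRad l).measurable)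
    measurable_const measurable_const

theorem intervalIntegrable_mul_ite {ψ : ℝ → ℝ} (hψ : IsTest ψ) (l y : ℝ) :
    IntervalIntegrable (fun τ => ψ τ * (if y < sqRad l τ then 1 else 0)) volume (-1) 1 := by
  refine (hψ.continuous.intervalIntegrable (-1) 1).mono_fun
    (hψ.continuous.measurable.mul (measurable_ite_lt_sqRad l y)).aestronglyMeasurable
    (ae_of_all _ fun τ => ?_)
  simp only
  split_ifs <;> simp

/-- By Fubini, averaging the indicators of the balls of radius `√(l² + lτ)` gives the cutoff. The
cutoff is continuous, so Poisson summation applies to the averaged partial sum although it does not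
apply to the sharp one directly. -/
theorem integral_radCutoff_mul_cos {d : ℕ} (hd : 1 ≤ d) {ψ : ℝ → ℝ} (hψ : IsTest ψ) (β a : ℝ)
    {l : ℝ} (hl : 2 ≤ l) (y : E d) :
    ∫ x : E d, bumpHat d β a ‖x‖ * radCutoff ψ l (‖x‖ ^ 2) *
        Real.cos (2 * Real.pi * inner ℝ x y) =
      radAvg ψ l (sigmaBall d β a ‖y‖) := by
  have hl0 : 0 < l := by linarith
  set g : E d → ℝ := fun x => bumpHat d β a ‖x‖ * Real.cos (2 * Real.pi * inner ℝ x y) with hg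
  have hgc : Continuous g := by
    refine ((continuous_bumpHat d β a).comp continuous_norm).mul (Real.continuous_cos.comp ?_)
    exact continuous_const.mul (continuous_id.inner continuous_const)
  set K : ℝ → E d → ℝ := fun τ x => ψ τ * (if ‖x‖ ^ 2 < sqRad l τ then g x else 0) with hK
  have hmeas : Measurable (Function.uncurry K) := by
    refine (hψ.continuous.measurable.comp measurable_fst).mul ?_
    refine Measurable.ite ?_ (hgc.measurable.comp measurable_snd) measurable_const
    exact measurableSet_lt (by fun_prop)
      ((continuous_sqRad l).measurable.comp measurable_fst)
  have hInt : Integrable (Function.uncurry K)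
      ((volume.restrict (Set.Ioc (-1 : ℝ) 1)).prod volume) := by
    have h1 : Integrable ψ (volume.restrict (Set.Ioc (-1 : ℝ) 1)) :=
      (hψ.continuous.integrableOn_Icc).mono_set Set.Ioc_subset_Icc_self
    have h2 : Integrable ((Metric.closedBall (0 : E d) (2 * l)).indicator g) :=
      (hgc.continuousOn.integrableOn_compact (isCompact_closedBall _ _)).integrable_indicator
        measurableSet_closedBall
    refine (h1.mul_prod h2).mono hmeas.aestronglyMeasurable (ae_of_all _ ?_)
    rintro ⟨τ, x⟩
    simp only [Function.uncurry_apply_pair, hK, norm_mul]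
    by_cases hτ : τ ∈ Set.Ioo (-1 : ℝ) 1
    · refine mul_le_mul_of_nonneg_left ?_ (norm_nonneg _)
      split_ifs with h
      · rw [Set.indicator_of_mem]
        rw [mem_closedBall_zero_iff]
        have h3 := sqRad_le hl (Set.Ioo_subset_Icc_self hτ)
        nlinarith [norm_nonneg x]
      · simp
    · rw [hψ.eq_zero hτ]; simp
  have hswap := integral_integral_swap (f := K) hInt
  have hleft : ∫ τ in Set.Ioc (-1 : ℝ) 1, ∫ x, K τ x = radAvg ψ l (sigmaBall d β a ‖y‖) := by
    rw [radAvg, intervalIntegral.integral_of_le (by norm_num)]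
    refine setIntegral_congr_fun measurableSet_Ioc fun τ hτ => ?_
    simp only [hK]
    rw [integral_const_mul, ← setIntegral_ball_bumpHat_mul_cos hd β a (Real.sqrt_nonneg _) y,
      ← integral_indicator measurableSet_ball]
    congr 2
    funext x
    by_cases h : ‖x‖ ^ 2 < sqRad l τ
    · rw [if_pos h, Set.indicator_of_mem]
      rwa [mem_ball_zero_iff, Real.lt_sqrt (norm_nonneg _)]
    · rw [if_neg h, Set.indicator_of_notMem]
      rwa [mem_ball_zero_iff, Real.lt_sqrt (norm_nonneg _)]
  rw [← hleft, hswap]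
  congr 1
  funext x
  have h5 : ∀ τ, K τ x = (ψ τ * (if ‖x‖ ^ 2 < sqRad l τ then 1 else 0)) * g x := by
    intro τ
    simp only [hK]
    split_ifs <;> ring
  simp_rw [h5]
  rw [integral_mul_const, ← intervalIntegral.integral_of_le (by norm_num),
    integral_mul_ite_eq_radCutoff ψ hl0]
  simp only [hg]
  ring

/-- The spherical partial sum at the origin. -/
noncomputable def bumpSum (d : ℕ) (β a t : ℝ) : ℝ :=
  ∑ m ∈ latticeBall d t, bumpHat d β a ‖latticePt m‖

/-- All radii in play are at most `2l`, so the sum runs over one fixed finite set and the dependence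
on `τ` sits in indicators, which can be integrated. -/
theorem bumpSum_sqrt_sqRad {d : ℕ} (β a : ℝ) {l τ : ℝ} (hl : 2 ≤ l)
    (hτ : τ ∈ Set.Icc (-1 : ℝ) 1) :
    bumpSum d β a √(sqRad l τ) = ∑ m ∈ latticeBall d (2 * l), bumpHat d β a ‖latticePt m‖ *
      (if ‖latticePt m‖ ^ 2 < sqRad l τ then 1 else 0) := by
  have h3 := sqRad_le hl hτ
  simp only [mul_ite, mul_one, mul_zero]
  rw [← Finset.sum_filter, bumpSum]
  refine Finset.sum_congr ?_ fun _ _ => rfl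
  ext m
  rw [Finset.mem_filter, mem_latticeBall, mem_latticeBall, Real.lt_sqrt (norm_nonneg _)]
  refine ⟨fun h => ⟨?_, h⟩, fun h => h.2⟩
  nlinarith [norm_nonneg (latticePt m)]

theorem intervalIntegrable_mul_bumpSum {d : ℕ} {ψ : ℝ → ℝ} (hψ : IsTest ψ) (β a : ℝ) {l : ℝ}
    (hl : 2 ≤ l) :
    IntervalIntegrable (fun τ => ψ τ * bumpSum d β a √(sqRad l τ)) volume (-1) 1 := by
  have h : IntervalIntegrable (fun τ => ∑ m ∈ latticeBall d (2 * l), bumpHat d β a ‖latticePt m‖ *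
      (ψ τ * (if ‖latticePt m‖ ^ 2 < sqRad l τ then 1 else 0))) volume (-1) 1 := by
    have := IntervalIntegrable.sum (μ := volume) (a := -1) (b := 1) (latticeBall d (2 * l))
      (f := fun m τ => bumpHat d β a ‖latticePt m‖ *
        (ψ τ * (if ‖latticePt m‖ ^ 2 < sqRad l τ then 1 else 0)))
      fun m _ => (intervalIntegrable_mul_ite hψ l _).const_mul _
    refine this.congr fun τ _ => ?_
    simp [Finset.sum_apply]
  refine h.congr fun τ hτ => ?_
  rw [Set.uIoc_of_le (by norm_num)] at hτ
  rw [bumpSum_sqrt_sqRad β a hl (Set.Ioc_subset_Icc_self hτ), Finset.mul_sum]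
  exact Finset.sum_congr rfl fun m _ => by ring

theorem radAvg_bumpSum {d : ℕ} {ψ : ℝ → ℝ} (hψ : IsTest ψ) (β a : ℝ) {l : ℝ} (hl : 2 ≤ l) :
    radAvg ψ l (bumpSum d β a) = ∑ m ∈ latticeBall d (2 * l),
      bumpHat d β a ‖latticePt m‖ * radCutoff ψ l (‖latticePt m‖ ^ 2) := by
  have hl0 : 0 < l := by linarith
  simp_rw [← integral_mul_ite_eq_radCutoff ψ hl0, ← intervalIntegral.integral_const_mul]
  rw [← intervalIntegral.integral_finsetSum
    fun m _ => (intervalIntegrable_mul_ite hψ l _).const_mul _, radAvg]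
  refine intervalIntegral.integral_congr fun τ hτ => ?_
  rw [Set.uIcc_of_le (by norm_num)] at hτ
  rw [bumpSum_sqrt_sqRad β a hl hτ, Finset.mul_sum]
  exact Finset.sum_congr rfl fun m _ => by ring

theorem finite_lattice_sphere (d : ℕ) (a : ℝ) :
    {m : Fin d → ℤ | ‖latticePt m‖ = a}.Finite :=
  (finite_lattice_ball d (a + 1)).subset fun m hm => by
    have : ‖latticePt m‖ = a := hm
    show ‖latticePt m‖ < a + 1
    linarith

theorem perBump_zero (d : ℕ) (β a : ℝ) :
    perBump β a (0 : E d) = ∑ m ∈ latticeBall d a, bumpProfile β a ‖latticePt m‖ := by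
  rw [perBump, periodization_eq_sum (R := a) (r := 0) (fun x hx => by
    rw [bump, if_neg (not_lt.2 hx)]) (by simp), add_zero]
  refine Finset.sum_congr rfl fun m _ => ?_
  rw [zero_add, bump_eq_profile]

theorem sphereCount_zero (d : ℕ) (a : ℝ) :
    sphereCount a (0 : E d) = (finite_lattice_sphere d a).toFinset.card := by
  rw [sphereCount, ← Set.ncard_eq_toFinset_card _ (finite_lattice_sphere d a)]
  simp only [zero_sub, norm_neg]

/-- The part of the error of the spherical partial sum at the origin that comes from the lattice
points off the origin and off the sphere of radius `a`. -/
noncomputable def sumErr (d : ℕ) (β a t : ℝ) : ℝ :=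
  bumpSum d β a t - perBump β a (0 : E d) - sigmaErr d β a 0 t -
    sphereCount a (0 : E d) * sigmaBall d β a a t

theorem radAvg_const {ψ : ℝ → ℝ} (h1 : ∫ τ in (-1 : ℝ)..1, ψ τ = 1) (l c : ℝ) :
    radAvg ψ l (fun _ => c) = c := by
  rw [radAvg, intervalIntegral.integral_mul_const, h1, one_mul]

theorem intervalIntegrable_mul_sumErr {d : ℕ} {ψ : ℝ → ℝ} (hψ : IsTest ψ) (β a : ℝ) {l : ℝ}
    (hl : 2 ≤ l) :
    IntervalIntegrable (fun τ => ψ τ * sumErr d β a √(sqRad l τ)) volume (-1) 1 := by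
  have h1 := intervalIntegrable_mul_bumpSum (d := d) hψ β a hl
  have h2 : IntervalIntegrable (fun τ => ψ τ * (perBump β a (0 : E d) +
      sigmaErr d β a 0 √(sqRad l τ) + sphereCount a (0 : E d) * sigmaBall d β a a √(sqRad l τ)))
      volume (-1) 1 :=
    intervalIntegrable_radAvg hψ l (F := fun t => perBump β a (0 : E d) +
      sigmaErr d β a 0 t + sphereCount a (0 : E d) * sigmaBall d β a a t)
      ((continuous_const.add (continuous_sigmaErr d β a 0)).add
        (continuous_const.mul (continuous_sigmaBall d β a a))) _ _
  refine (h1.sub h2).congr fun τ _ => ?_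
  simp only [sumErr]
  ring

theorem radAvg_sumErr {d : ℕ} {ψ : ℝ → ℝ} (hψ : IsTest ψ) (h1 : ∫ τ in (-1 : ℝ)..1, ψ τ = 1)
    (β a : ℝ) {l : ℝ} (hl : 2 ≤ l) :
    radAvg ψ l (sumErr d β a) = radAvg ψ l (bumpSum d β a) - perBump β a (0 : E d) -
      radAvg ψ l (sigmaErr d β a 0) -
        sphereCount a (0 : E d) * radAvg ψ l (sigmaBall d β a a) := by
  have e1 := intervalIntegrable_mul_bumpSum (d := d) hψ β a hl
  have e2 : IntervalIntegrable (fun τ => ψ τ * perBump β a (0 : E d)) volume (-1) 1 :=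
    (hψ.continuous.mul continuous_const).intervalIntegrable _ _
  have e3 := intervalIntegrable_radAvg hψ l (continuous_sigmaErr d β a 0) (-1) 1
  have e4 := intervalIntegrable_radAvg hψ l (continuous_sigmaBall d β a a) (-1) 1
  have e5 : ∫ τ in (-1 : ℝ)..1, ψ τ * perBump β a (0 : E d) = perBump β a (0 : E d) :=
    radAvg_const h1 l _
  conv_rhs => rw [← e5]
  rw [radAvg, radAvg, radAvg, radAvg, ← intervalIntegral.integral_const_mul,
    ← intervalIntegral.integral_sub e1 e2, ← intervalIntegral.integral_sub (e1.sub e2) e3,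
    ← intervalIntegral.integral_sub ((e1.sub e2).sub e3) (e4.const_mul _)]
  refine intervalIntegral.integral_congr fun τ _ => ?_
  simp only [sumErr]
  ring

/-- Poisson summation for the mollified transform. The terms subtracted in `sumErr` are those of the
profile, the origin and the sphere, so only lattice points covered by `exists_radAvg_sigmaErr_bound`
remain. -/
theorem exists_radAvg_sumErr_bound {d : ℕ} (hd : 1 ≤ d) {ψ : ℝ → ℝ} (hψ : IsTest ψ)
    (h1 : ∫ τ in (-1 : ℝ)..1, ψ τ = 1) {β a : ℝ} (hβ : -1 < β) (ha : 0 < a) :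
    ∃ C : ℝ, 0 < C ∧ ∀ l : ℝ, 2 ≤ l → |radAvg ψ l (sumErr d β a)| ≤ C * l ^ (-β - 1) := by
  obtain ⟨C, hC0, hC⟩ := exists_radAvg_sigmaErr_bound hd hψ hβ ha
  have hsum := summable_lattice_rpow d
  have hS0 : 0 ≤ ∑' n : Fin d → ℤ, ‖latticePt n‖ ^ (-((d : ℝ) + 1)) :=
    tsum_nonneg fun n => by positivity
  refine ⟨C * (∑' n : Fin d → ℤ, ‖latticePt n‖ ^ (-((d : ℝ) + 1))) + 1, by positivity,
    fun l hl => ?_⟩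
  have hl0 : 0 < l := by linarith
  classical
  set A : Finset (Fin d → ℤ) := (finite_lattice_sphere d a).toFinset with hA
  have hmA : ∀ n, n ∈ A ↔ ‖latticePt n‖ = a := fun n => by simp [hA]
  have h0A : (0 : Fin d → ℤ) ∉ A := by
    rw [hmA, latticePt_zero, norm_zero]; exact ha.ne
  set v : (Fin d → ℤ) → ℝ := fun n => radAvg ψ l (sigmaErr d β a ‖latticePt n‖) with hv
  have hb : ∀ n, n ∉ insert 0 A →
      |v n| ≤ C * l ^ (-β - 1) * ‖latticePt n‖ ^ (-((d : ℝ) + 1)) := by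
    intro n hn
    rw [Finset.mem_insert, not_or, hmA] at hn
    exact hC l hl n hn.1 hn.2
  have hv1 : Summable v := by
    refine Summable.of_norm_bounded_eventually (hsum.mul_left (C * l ^ (-β - 1))) ?_
    refine (insert 0 A).finite_toSet.subset fun n hn => ?_
    by_contra h
    exact hn (hb n h)
  have hprof : ∀ n ∉ latticeBall d a, bumpProfile β a ‖latticePt n‖ = 0 := by
    intro n hn
    rw [mem_latticeBall] at hn
    rw [bumpProfile, if_neg hn]
  have hball : ∀ n : Fin d → ℤ, radAvg ψ l (sigmaBall d β a ‖latticePt n‖) =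
      v n + bumpProfile β a ‖latticePt n‖ := by
    intro n
    simp only [hv]
    conv_rhs => rw [← radAvg_const h1 l (bumpProfile β a ‖latticePt n‖)]
    rw [radAvg, radAvg, radAvg, ← intervalIntegral.integral_add
      (intervalIntegrable_radAvg hψ l (continuous_sigmaErr _ _ _ _) _ _)
      (intervalIntegrable_radAvg hψ l
        (continuous_const : Continuous fun _ : ℝ => bumpProfile β a ‖latticePt n‖) _ _)]
    refine intervalIntegral.integral_congr fun τ _ => ?_
    simp only [sigmaErr]
    ring
  have hp1 : Summable fun n : Fin d → ℤ => bumpProfile β a ‖latticePt n‖ :=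
    summable_of_ne_finset_zero hprof
  have hp := poisson_summation
    (f := fun x : E d => bumpHat d β a ‖x‖ * radCutoff ψ l (‖x‖ ^ 2)) (R := 2 * l)
    (((continuous_bumpHat d β a).comp continuous_norm).mul
      ((continuous_radCutoff hψ l).comp (continuous_norm.pow 2)))
    (fun x => by simp only [norm_neg])
    (fun x hx => by rw [radCutoff_eq_zero ψ hl hx, mul_zero])
    (by
      simp_rw [integral_radCutoff_mul_cos hd hψ β a hl, hball]
      exact hv1.add hp1)
  simp_rw [integral_radCutoff_mul_cos hd hψ β a hl, hball] at hp
  rw [← radAvg_bumpSum hψ β a hl, hv1.tsum_add hp1, tsum_eq_sum hprof, ← perBump_zero,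
    ← hv1.sum_add_tsum_subtype_compl (insert 0 A), Finset.sum_insert h0A] at hp
  -- On the sphere the profile is 0, so the error there is the whole partial integral.
  have hsphere : ∑ n ∈ A, v n = sphereCount a (0 : E d) * radAvg ψ l (sigmaBall d β a a) := by
    rw [sphereCount_zero, ← nsmul_eq_mul, ← hA]
    refine Finset.sum_eq_card_nsmul fun n hn => ?_
    simp only [hv]
    rw [(hmA n).1 hn]
    congr 1
    funext t
    rw [sigmaErr, bumpProfile, if_neg (lt_irrefl _), sub_zero]
  have hzero : v 0 = radAvg ψ l (sigmaErr d β a 0) := by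
    simp only [hv]; rw [latticePt_zero, norm_zero]
  have hE : radAvg ψ l (sumErr d β a) =
      ∑' n : {n // n ∉ insert 0 A}, v n := by
    rw [radAvg_sumErr hψ h1 β a hl, ← hp, hsphere, hzero]
    ring
  rw [hE, ← Real.norm_eq_abs]
  have hsub : Summable fun n : {n // n ∉ insert 0 A} =>
      C * l ^ (-β - 1) * ‖latticePt (n : Fin d → ℤ)‖ ^ (-((d : ℝ) + 1)) :=
    (hsum.mul_left (C * l ^ (-β - 1))).comp_injective Subtype.val_injective
  have h6 : ‖∑' n : {n // n ∉ insert 0 A}, v n‖ ≤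
      ∑' n : {n // n ∉ insert 0 A},
        C * l ^ (-β - 1) * ‖latticePt (n : Fin d → ℤ)‖ ^ (-((d : ℝ) + 1)) :=
    tsum_of_norm_bounded hsub.hasSum fun n => hb n.1 n.2
  refine h6.trans ?_
  have h7 := Summable.tsum_subtype_le
    (fun n : Fin d → ℤ => C * l ^ (-β - 1) * ‖latticePt n‖ ^ (-((d : ℝ) + 1)))
    {n | n ∉ insert 0 A} (fun n => by positivity)
    (hsum.mul_left (C * l ^ (-β - 1)))
  refine h7.trans ?_
  rw [tsum_mul_left]
  have : 0 < l ^ (-β - 1) := by positivity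
  nlinarith


/-! ### From averaged radii back to sharp radii. -/

theorem exists_besselLam_bounded {ν : ℝ} (hν : -1 / 2 ≤ ν) :
    ∃ B : ℝ, 0 < B ∧ ∀ x : ℝ, 0 ≤ x → |besselLam ν x| ≤ B := by
  obtain ⟨C, hC0, hC⟩ := exists_besselLam_bound ν one_pos
  obtain ⟨B, hB⟩ := isCompact_Icc.exists_bound_of_continuousOn (s := Set.Icc (0 : ℝ) 1)
    (continuous_besselLam ν).continuousOn
  refine ⟨max B C, lt_max_of_lt_right hC0, fun x hx => ?_⟩
  rcases le_total x 1 with h | h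
  · exact (hB x ⟨hx, h⟩).trans (le_max_left _ _)
  · refine (hC x h).trans (le_trans ?_ (le_max_right _ _))
    exact mul_le_of_le_one_right hC0.le (Real.rpow_le_one_of_one_le_of_nonpos h (by linarith))

theorem le_sqrt_sqRad {l τ : ℝ} (hl : 2 ≤ l) (hτ : 0 ≤ τ) : l ≤ √(sqRad l τ) := by
  refine Real.le_sqrt_of_sq_le ?_
  rw [sqRad]; nlinarith

theorem sqrt_sqRad_le {l τ : ℝ} (hl : 2 ≤ l) (hτ : 0 ≤ τ) : √(sqRad l τ) ≤ l + τ := by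
  rw [Real.sqrt_le_left (by linarith), sqRad]
  nlinarith

theorem rpow_le_of_mem_Icc_two_mul {l r : ℝ} (hl : 0 < l) (h1 : l ≤ r) (h2 : r ≤ 2 * l) (e : ℝ) :
    r ^ e ≤ 2 ^ |e| * l ^ e := by
  have hr : 0 < r := hl.trans_le h1
  have h3 : r = (r / l) * l := by field_simp
  rw [h3, Real.mul_rpow (by positivity) hl.le]
  gcongr
  refine rpow_le_of_mem_Icc ?_ ?_ e
  · rw [le_div_iff₀ hl]; linarith
  · rw [div_le_iff₀ hl]; linarith

/-- The radius moves by at most `τ`, and the radial integrand has size `l^{d-1} · l^{-d/2-β-1/2}`.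
-/
theorem exists_sigmaBall_sub_bound {d : ℕ} (hd : 1 ≤ d) (β : ℝ) {a : ℝ} (ha : 0 < a) (ρ : ℝ) :
    ∃ C : ℝ, 0 < C ∧ ∀ l : ℝ, 2 ≤ l → ∀ τ : ℝ, 0 ≤ τ → τ ≤ 1 →
      |sigmaBall d β a ρ √(sqRad l τ) - sigmaBall d β a ρ l| ≤
        C * τ * l ^ (((d : ℝ) - 3) / 2 - β) := by
  have hd1 : (1 : ℝ) ≤ d := by exact_mod_cast hd
  set μ : ℝ := (d : ℝ) / 2 with hμ
  set p : ℝ := Real.pi ^ 2 * a ^ 2 with hp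
  have hp0 : 0 < p := by have := Real.pi_pos; positivity
  set K : ℝ := |hatConst d β a * Real.pi ^ μ| with hK
  obtain ⟨C, hC0, hC⟩ := exists_besselLam_bound (μ + β) hp0
  obtain ⟨B, hB0, hB⟩ := exists_besselLam_bounded (ν := μ - 1) (by rw [hμ]; linarith)
  set e : ℝ := ((d : ℝ) - 3) / 2 - β with he
  set C' : ℝ := 2 * (C * p ^ (-(μ + β) / 2 - 1 / 4)) * B * 2 ^ |e| with hC'
  have hC'0 : 0 < C' := by positivity
  refine ⟨K * C' + 1, by positivity, fun l hl τ hτ0 hτ1 => ?_⟩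
  have hl0 : 0 < l := by linarith
  have h1 := le_sqrt_sqRad hl hτ0
  have h2 := sqrt_sqRad_le hl hτ0
  rw [sigmaBall, sigmaBall, ← mul_sub, abs_mul, lamInt, lamInt,
    intervalIntegral.integral_interval_sub_left
      ((continuous_lamInt_integrand d _ _ _).intervalIntegrable _ _)
      ((continuous_lamInt_integrand d _ _ _).intervalIntegrable _ _)]
  have h3 := intervalIntegral.norm_integral_le_of_norm_le_const (a := l) (b := √(sqRad l τ))
    (C := C' * l ^ e)
    (f := fun r : ℝ => 2 * (r ^ (d - 1) * (besselLam (μ + β) (p * r ^ 2) *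
      besselLam (μ - 1) (Real.pi ^ 2 * ρ ^ 2 * r ^ 2)))) ?_
  · rw [Real.norm_eq_abs, abs_of_nonneg (by linarith : 0 ≤ √(sqRad l τ) - l)] at h3
    have h4 : C' * l ^ e * (√(sqRad l τ) - l) ≤ C' * l ^ e * τ := by gcongr; linarith
    have hK0 : 0 ≤ K := abs_nonneg _
    calc K * _ ≤ K * (C' * l ^ e * τ) := by gcongr; exact h3.trans h4
      _ ≤ (K * C' + 1) * τ * l ^ e := by
        have : 0 ≤ τ * l ^ e := by positivity
        nlinarith
  · intro r hr
    rw [Set.uIoc_of_le h1] at hr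
    have hr0 : 0 < r := hl0.trans hr.1
    have hr1 : 1 ≤ r := by linarith [hr.1]
    have g1 := hC (p * r ^ 2) (le_mul_of_one_le_right hp0.le (by nlinarith))
    have g2 := hB (Real.pi ^ 2 * ρ ^ 2 * r ^ 2) (by positivity)
    rw [Real.mul_rpow hp0.le (by positivity), ← Real.rpow_natCast r 2, ← Real.rpow_mul hr0.le]
      at g1
    rw [Real.rpow_natCast] at g1
    have g3 := rpow_le_of_mem_Icc_two_mul hl0 hr.1.le (by linarith [hr.2]) e
    have g4 : r ^ (d - 1) * r ^ (((2 : ℕ) : ℝ) * (-(μ + β) / 2 - 1 / 4)) = r ^ e := by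
      rw [← Real.rpow_natCast, Nat.cast_sub hd, ← Real.rpow_add hr0]
      congr 1; rw [he, hμ]; push_cast; ring
    rw [Real.norm_eq_abs, abs_mul, abs_mul, abs_mul, abs_two, abs_of_pos (pow_pos hr0 _)]
    calc 2 * (r ^ (d - 1) * (|besselLam (μ + β) (p * r ^ 2)| *
          |besselLam (μ - 1) (Real.pi ^ 2 * ρ ^ 2 * r ^ 2)|))
        ≤ 2 * (r ^ (d - 1) * (C * (p ^ (-(μ + β) / 2 - 1 / 4) *
            r ^ (((2 : ℕ) : ℝ) * (-(μ + β) / 2 - 1 / 4))) * B)) := by gcongr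
      _ = 2 * (C * p ^ (-(μ + β) / 2 - 1 / 4)) * B *
          (r ^ (d - 1) * r ^ (((2 : ℕ) : ℝ) * (-(μ + β) / 2 - 1 / 4))) := by ring
      _ ≤ 2 * (C * p ^ (-(μ + β) / 2 - 1 / 4)) * B * (2 ^ |e| * l ^ e) := by
          rw [g4]; gcongr
      _ = C' * l ^ e := by rw [hC']; ring

/-- The increment involves only lattice points of the shell from `l` to `√(l² + lε)`. Multiplying
their number by the coefficient size `l^{-(d+1)/2-β}` gives the two exponents. -/
theorem exists_bumpSum_sub_bound {d : ℕ} (hd : 1 ≤ d) (β : ℝ) {a : ℝ} (ha : 0 < a) :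
    ∃ C₀ : ℝ, 0 < C₀ ∧ ∀ ε : ℝ, 0 < ε → ε ≤ 1 / 2 → ∃ C : ℝ, 0 < C ∧ ∀ l : ℝ, 2 ≤ l →
      ∀ τ ∈ Set.Icc 0 ε, |bumpSum d β a √(sqRad l τ) - bumpSum d β a l| ≤
        C₀ * ε * l ^ (((d : ℝ) - 3) / 2 - β) + C * l ^ (-β - 1) := by
  obtain ⟨C₀, hC₀0, hC₀⟩ := exists_annulus_count hd
  obtain ⟨D, hD0, hD⟩ := exists_bumpHat_bound d β ha
  set e : ℝ := -((d : ℝ) + 1) / 2 - β with he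
  refine ⟨D * 2 ^ |e| * C₀, by positivity, fun ε hε0 hε1 => ?_⟩
  obtain ⟨C, hC0, hC⟩ := hC₀ ε hε0 hε1
  refine ⟨D * 2 ^ |e| * C, by positivity, fun l hl τ hτ => ?_⟩
  have hl0 : 0 < l := by linarith
  have h1 := le_sqrt_sqRad hl hτ.1
  set N := (latticeBall d √(sqRad l ε)).filter fun m => l ≤ ‖latticePt m‖ with hN
  have hsub : latticeBall d l ⊆ latticeBall d √(sqRad l τ) := fun m hm => by
    rw [mem_latticeBall] at hm ⊢
    exact hm.trans_le h1
  have hsd : latticeBall d √(sqRad l τ) \ latticeBall d l ⊆ N := by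
    intro m hm
    rw [Finset.mem_sdiff, mem_latticeBall, mem_latticeBall, not_lt] at hm
    rw [hN, Finset.mem_filter, mem_latticeBall]
    refine ⟨hm.1.trans_le (Real.sqrt_le_sqrt ?_), hm.2⟩
    rw [sqRad, sqRad]
    nlinarith [hτ.2]
  rw [bumpSum, bumpSum, ← Finset.sum_sdiff hsub, add_sub_cancel_right]
  have hterm : ∀ m ∈ N, |bumpHat d β a ‖latticePt m‖| ≤ D * (2 ^ |e| * l ^ e) := by
    intro m hm
    rw [hN, Finset.mem_filter, mem_latticeBall] at hm
    refine (hD _ (by linarith [hm.2])).trans ?_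
    gcongr
    refine rpow_le_of_mem_Icc_two_mul hl0 hm.2 ?_ e
    linarith [hm.1, sqrt_sqRad_le hl hε0.le]
  calc |∑ m ∈ latticeBall d √(sqRad l τ) \ latticeBall d l, bumpHat d β a ‖latticePt m‖|
      ≤ ∑ m ∈ latticeBall d √(sqRad l τ) \ latticeBall d l, |bumpHat d β a ‖latticePt m‖| :=
        Finset.abs_sum_le_sum_abs _ _
    _ ≤ ∑ m ∈ N, |bumpHat d β a ‖latticePt m‖| :=
        Finset.sum_le_sum_of_subset_of_nonneg hsd fun _ _ _ => abs_nonneg _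
    _ ≤ N.card • (D * (2 ^ |e| * l ^ e)) := Finset.sum_le_card_nsmul _ _ _ hterm
    _ = N.card * (D * (2 ^ |e| * l ^ e)) := nsmul_eq_mul _ _
    _ ≤ (C₀ * ε * l ^ ((d : ℝ) - 1) + C * l ^ (((d : ℝ) - 1) / 2)) * (D * (2 ^ |e| * l ^ e)) := by
        gcongr; exact hC l hl
    _ = D * 2 ^ |e| * C₀ * ε * (l ^ ((d : ℝ) - 1) * l ^ e) +
          D * 2 ^ |e| * C * (l ^ (((d : ℝ) - 1) / 2) * l ^ e) := by ring
    _ = _ := by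
        rw [← Real.rpow_add hl0, ← Real.rpow_add hl0]
        congr 3
        · rw [he]; ring
        · rw [he]; ring

theorem exists_sumErr_sub_bound {d : ℕ} (hd : 1 ≤ d) (β : ℝ) {a : ℝ} (ha : 0 < a) :
    ∃ C₀ : ℝ, 0 < C₀ ∧ ∀ ε : ℝ, 0 < ε → ε ≤ 1 / 2 → ∃ C : ℝ, 0 < C ∧ ∀ l : ℝ, 2 ≤ l →
      ∀ τ ∈ Set.Icc 0 ε, |sumErr d β a √(sqRad l τ) - sumErr d β a l| ≤
        C₀ * ε * l ^ (((d : ℝ) - 3) / 2 - β) + C * l ^ (-β - 1) := by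
  obtain ⟨C₁, hC₁0, hC₁⟩ := exists_bumpSum_sub_bound hd β ha
  obtain ⟨C₂, hC₂0, hC₂⟩ := exists_sigmaBall_sub_bound hd β ha 0
  obtain ⟨C₃, hC₃0, hC₃⟩ := exists_sigmaBall_sub_bound hd β ha a
  refine ⟨C₁ + C₂ + sphereCount a (0 : E d) * C₃, by positivity, fun ε hε0 hε1 => ?_⟩
  obtain ⟨C, hC0, hC⟩ := hC₁ ε hε0 hε1
  refine ⟨C, hC0, fun l hl τ hτ => ?_⟩
  have hl0 : 0 < l := by linarith
  have h1 := hC l hl τ hτ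
  have h2 := hC₂ l hl τ hτ.1 (by linarith [hτ.2])
  have h3 := hC₃ l hl τ hτ.1 (by linarith [hτ.2])
  have h2' : C₂ * τ * l ^ (((d : ℝ) - 3) / 2 - β) ≤ C₂ * ε * l ^ (((d : ℝ) - 3) / 2 - β) := by
    have := hτ.2
    gcongr
  have h3' : C₃ * τ * l ^ (((d : ℝ) - 3) / 2 - β) ≤ C₃ * ε * l ^ (((d : ℝ) - 3) / 2 - β) := by
    have := hτ.2
    gcongr
  have hsplit : sumErr d β a √(sqRad l τ) - sumErr d β a l =
      (bumpSum d β a √(sqRad l τ) - bumpSum d β a l) -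
      (sigmaBall d β a 0 √(sqRad l τ) - sigmaBall d β a 0 l) -
      sphereCount a (0 : E d) * (sigmaBall d β a a √(sqRad l τ) - sigmaBall d β a a l) := by
    simp only [sumErr, sigmaErr]; ring
  rw [hsplit]
  have h4 : |(sphereCount a (0 : E d) : ℝ) *
      (sigmaBall d β a a √(sqRad l τ) - sigmaBall d β a a l)| ≤
      sphereCount a (0 : E d) * (C₃ * ε * l ^ (((d : ℝ) - 3) / 2 - β)) := by
    rw [abs_mul, Nat.abs_cast]
    gcongr
    exact h3.trans h3'
  refine (abs_sub _ _).trans ((add_le_add (abs_sub _ _) h4).trans ?_)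
  linarith

theorem exists_sumErr_bound {d : ℕ} (hd : 1 ≤ d) {β a : ℝ} (hβ : -1 < β) (ha : 0 < a) :
    ∃ C₀ : ℝ, 0 < C₀ ∧ ∀ ε : ℝ, 0 < ε → ε ≤ 1 / 2 → ∃ C : ℝ, 0 < C ∧ ∀ l : ℝ, 2 ≤ l →
      |sumErr d β a l| ≤ C₀ * ε * l ^ (((d : ℝ) - 3) / 2 - β) + C * l ^ (-β - 1) := by
  obtain ⟨C₀, hC₀0, hC₀⟩ := exists_sumErr_sub_bound hd β ha
  refine ⟨C₀, hC₀0, fun ε hε0 hε1 => ?_⟩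
  obtain ⟨C₁, hC₁0, hC₁⟩ := hC₀ ε hε0 hε1
  -- The weight sits inside `[0, ε]`, so every averaged radius lies between `l` and `√(l² + lε)`.
  -- Smoothness costs a constant depending on `ε`, but only in front of `l^{-β-1}`.
  let χ : ContDiffBump (ε / 2 : ℝ) := ⟨ε / 8, ε / 4, by positivity, by linarith⟩
  set ψ : ℝ → ℝ := χ.normed volume with hψdef
  have hsupp : tsupport ψ ⊆ Set.Icc 0 ε := by
    rw [hψdef, χ.tsupport_normed_eq, Real.closedBall_eq_Icc]
    refine Set.Icc_subset_Icc ?_ ?_ <;> simp only [χ] <;> linarith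
  have hψ : IsTest ψ :=
    ⟨χ.contDiff_normed, hsupp.trans (Set.Icc_subset_Ioo (by norm_num) (by linarith))⟩
  have hψ0 : ∀ τ, 0 ≤ ψ τ := fun τ => χ.nonneg_normed τ
  have hψ1 : ∫ τ in (-1 : ℝ)..1, ψ τ = 1 := by
    rw [intervalIntegral.integral_eq_integral_of_support_subset, hψdef, χ.integral_normed]
    exact (subset_tsupport ψ).trans
      (hsupp.trans (Set.Icc_subset_Ioc_iff hε0.le |>.2 ⟨by norm_num, by linarith⟩))
  obtain ⟨C₂, hC₂0, hC₂⟩ := exists_radAvg_sumErr_bound hd hψ hψ1 hβ ha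
  refine ⟨C₁ + C₂, by positivity, fun l hl => ?_⟩
  have hl0 : 0 < l := by linarith
  set M : ℝ := C₀ * ε * l ^ (((d : ℝ) - 3) / 2 - β) + C₁ * l ^ (-β - 1) with hM
  have hM0 : 0 ≤ M := by positivity
  have hdiff : radAvg ψ l (sumErr d β a) - sumErr d β a l =
      ∫ τ in (-1 : ℝ)..1, ψ τ * (sumErr d β a √(sqRad l τ) - sumErr d β a l) := by
    conv_lhs => rw [← radAvg_const hψ1 l (sumErr d β a l)]
    rw [radAvg, radAvg, ← intervalIntegral.integral_sub (intervalIntegrable_mul_sumErr hψ β a hl)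
      (intervalIntegrable_radAvg hψ l
        (continuous_const : Continuous fun _ : ℝ => sumErr d β a l) _ _)]
    refine intervalIntegral.integral_congr fun τ _ => ?_
    ring
  have hb : ‖∫ τ in (-1 : ℝ)..1, ψ τ * (sumErr d β a √(sqRad l τ) - sumErr d β a l)‖ ≤
      ∫ τ in (-1 : ℝ)..1, ψ τ * M := by
    refine intervalIntegral.norm_integral_le_of_norm_le (by norm_num) (ae_of_all _ fun τ _ => ?_)
      ((hψ.continuous.mul continuous_const).intervalIntegrable _ _)
    rw [norm_mul, Real.norm_of_nonneg (hψ0 τ)]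
    by_cases h : τ ∈ Set.Icc 0 ε
    · exact mul_le_mul_of_nonneg_left (hC₁ l hl τ h) (hψ0 τ)
    · rw [image_eq_zero_of_notMem_tsupport fun h' => h (hsupp h'), zero_mul, zero_mul]
  rw [← hdiff, intervalIntegral.integral_mul_const, hψ1, one_mul, Real.norm_eq_abs] at hb
  have h5 := hC₂ l hl
  have h6 : |sumErr d β a l| ≤ |radAvg ψ l (sumErr d β a)| +
      |radAvg ψ l (sumErr d β a) - sumErr d β a l| := by
    have := abs_sub (radAvg ψ l (sumErr d β a)) (radAvg ψ l (sumErr d β a) - sumErr d β a l)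
    rwa [sub_sub_cancel] at this
  linarith

theorem sumErr_isBigO {d : ℕ} (hd : 1 ≤ d) {β a : ℝ} (hβ : -1 < β) (ha : 0 < a) :
    sumErr d β a =O[atTop] fun t : ℝ => t ^ (((d : ℝ) - 3) / 2 - β) := by
  have hd1 : (1 : ℝ) ≤ d := by exact_mod_cast hd
  obtain ⟨C₀, hC₀0, h⟩ := exists_sumErr_bound hd hβ ha
  obtain ⟨C, hC0, hC⟩ := h (1 / 2) (by norm_num) le_rfl
  refine IsBigO.of_bound (C₀ * (1 / 2) + C) ?_
  filter_upwards [eventually_ge_atTop 2] with l hl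
  have hl0 : 0 < l := by linarith
  rw [Real.norm_eq_abs, Real.norm_of_nonneg (by positivity), add_mul]
  refine (hC l hl).trans (add_le_add le_rfl (mul_le_mul_of_nonneg_left ?_ hC0.le))
  exact Real.rpow_le_rpow_of_exponent_le (by linarith) (by linarith)

theorem sumErr_isLittleO {d : ℕ} (hd : 2 ≤ d) {β a : ℝ} (hβ : -1 < β) (ha : 0 < a) :
    sumErr d β a =o[atTop] fun t : ℝ => t ^ (((d : ℝ) - 3) / 2 - β) := by
  have hd1 : (2 : ℝ) ≤ d := by exact_mod_cast hd
  obtain ⟨C₀, hC₀0, h⟩ := exists_sumErr_bound (by omega : 1 ≤ d) hβ ha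
  refine IsLittleO.of_bound fun c hc => ?_
  -- This `ε` makes the leading term at most `c/2`; the other term is relatively `O(l^{-(d-1)/2})`,
  -- which tends to 0 because `d ≥ 2`.
  obtain ⟨C, hC0, hC⟩ := h (min (1 / 2) (c / (2 * C₀))) (by positivity) (min_le_left _ _)
  have hlim : Tendsto (fun l : ℝ => C * l ^ (-(((d : ℝ) - 1) / 2))) atTop (𝓝 (C * 0)) :=
    (tendsto_rpow_neg_atTop (by linarith)).const_mul C
  rw [mul_zero] at hlim
  filter_upwards [eventually_ge_atTop 2, hlim.eventually (ge_mem_nhds (half_pos hc))] with l hl h2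
  have hl0 : 0 < l := by linarith
  rw [Real.norm_eq_abs, Real.norm_of_nonneg (by positivity)]
  refine (hC l hl).trans ?_
  have h3 : l ^ (-β - 1) = l ^ (-(((d : ℝ) - 1) / 2)) * l ^ (((d : ℝ) - 3) / 2 - β) := by
    rw [← Real.rpow_add hl0]; congr 1; ring
  have h4 : C₀ * min (1 / 2) (c / (2 * C₀)) ≤ c / 2 := by
    calc C₀ * min (1 / 2) (c / (2 * C₀)) ≤ C₀ * (c / (2 * C₀)) := by gcongr; exact min_le_right _ _
      _ = c / 2 := by field_simp
  rw [h3, ← mul_assoc, ← add_mul]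
  gcongr
  linarith


/-! ### Asymptotics of the spherical partial integrals -/

/-- The Bessel function `J_ν (2πat)`, rescaled to be bounded. -/
noncomputable def normLam (ν a t : ℝ) : ℝ :=
  t ^ (ν + 1 / 2) * besselLam ν (Real.pi ^ 2 * a ^ 2 * t ^ 2)

/-- The leading term of `normLam`. -/
noncomputable def normMain (ν a t : ℝ) : ℝ :=
  (√Real.pi)⁻¹ * (Real.pi * a) ^ (-ν - 1 / 2) *
    Real.cos (2 * Real.pi * a * t - ν * Real.pi / 2 - Real.pi / 4)

theorem normLam_sub_normMain_isBigO (ν : ℝ) {a : ℝ} (ha : 0 < a) :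
    (fun t => normLam ν a t - normMain ν a t) =O[atTop] fun t : ℝ => t ^ (-1 : ℝ) := by
  have hc : 0 < 2 * Real.pi * a := by have := Real.pi_pos; positivity
  have h := (besselLam_asymptotics ν).comp_tendsto
    (tendsto_id.const_mul_atTop hc : Tendsto (fun t : ℝ => 2 * Real.pi * a * t) atTop atTop)
  have h2 := (isBigO_refl (fun t : ℝ => t ^ (ν + 1 / 2)) atTop).mul h
  refine (h2.congr' ?_ EventuallyEq.rfl).trans ?_
  · filter_upwards [eventually_gt_atTop 0] with t ht
    simp only [Function.comp_apply, normLam, normMain, lamMain]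
    rw [show (2 * Real.pi * a * t) ^ 2 / 4 = Real.pi ^ 2 * a ^ 2 * t ^ 2 by ring,
      show 2 * Real.pi * a * t / 2 = Real.pi * a * t by ring,
      Real.mul_rpow (by have := Real.pi_pos; positivity) ht.le, mul_sub]
    congr 1
    have e : t ^ (ν + 1 / 2) * t ^ (-ν - 1 / 2) = 1 := by
      rw [← Real.rpow_add ht, show ν + 1 / 2 + (-ν - 1 / 2) = 0 by ring, Real.rpow_zero]
    linear_combination ((√Real.pi)⁻¹ * (Real.pi * a) ^ (-ν - 1 / 2) *
      Real.cos (2 * Real.pi * a * t - ν * Real.pi / 2 - Real.pi / 4)) * e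
  · refine IsBigO.of_bound ((2 * Real.pi * a) ^ (-ν - 3 / 2)) ?_
    filter_upwards [eventually_gt_atTop 0] with t ht
    simp only [Function.comp_apply]
    rw [Real.norm_of_nonneg (by positivity), Real.norm_of_nonneg (by positivity),
      Real.mul_rpow hc.le ht.le, mul_left_comm, ← Real.rpow_add ht]
    apply le_of_eq
    congr 2; ring

theorem tendsto_normLam_sub_normMain (ν : ℝ) {a : ℝ} (ha : 0 < a) :
    Tendsto (fun t => normLam ν a t - normMain ν a t) atTop (𝓝 0) :=
  (normLam_sub_normMain_isBigO ν ha).trans_tendsto (tendsto_rpow_neg_atTop one_pos)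

theorem normMain_isBigO (ν : ℝ) {a : ℝ} (ha : 0 < a) :
    normMain ν a =O[atTop] fun _ : ℝ => (1 : ℝ) := by
  refine IsBigO.of_bound ((√Real.pi)⁻¹ * (Real.pi * a) ^ (-ν - 1 / 2)) (Eventually.of_forall ?_)
  intro t
  have hc : 0 < Real.pi * a := by have := Real.pi_pos; positivity
  rw [normMain, norm_mul, Real.norm_of_nonneg (by positivity), norm_one]
  gcongr
  exact Real.abs_cos_le_one _

theorem normLam_isBigO (ν : ℝ) {a : ℝ} (ha : 0 < a) :
    normLam ν a =O[atTop] fun _ : ℝ => (1 : ℝ) := by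
  have h := ((tendsto_normLam_sub_normMain ν ha).isBigO_one ℝ).add (normMain_isBigO ν ha)
  simpa using h

theorem tendsto_normLam_mul_sub (ν κ : ℝ) {a : ℝ} (ha : 0 < a) :
    Tendsto (fun t => normLam ν a t * normLam κ a t - normMain ν a t * normMain κ a t) atTop
      (𝓝 0) := by
  have h1 := (isLittleO_one_iff ℝ).2 (tendsto_normLam_sub_normMain ν ha)
  have h2 := (isLittleO_one_iff ℝ).2 (tendsto_normLam_sub_normMain κ ha)
  have h3 := (h1.mul_isBigO (normLam_isBigO κ ha)).add ((normMain_isBigO ν ha).mul_isLittleO h2)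
  rw [← isLittleO_one_iff ℝ]
  refine h3.congr (fun t => ?_) fun t => by ring
  ring

/-- The two products have phases that differ by quarter turns, so the addition formula for the sine
cancels all dependence on `t` and leaves the sine of `βπ/2`. -/
theorem normMain_mul_sub (μ β : ℝ) {a : ℝ} (ha : 0 < a) (t : ℝ) :
    normMain (μ + β - 1) a t * normMain μ a t - normMain (μ + β) a t * normMain (μ - 1) a t =
      Real.pi⁻¹ * (Real.pi * a) ^ (-2 * μ - β) * Real.sin (β * Real.pi / 2) := by
  have hc : 0 < Real.pi * a := by have := Real.pi_pos; positivity
  set θ := 2 * Real.pi * a * t - μ * Real.pi / 2 - Real.pi / 4 with hθ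
  set b := β * Real.pi / 2 with hb
  simp only [normMain]
  rw [show 2 * Real.pi * a * t - (μ + β - 1) * Real.pi / 2 - Real.pi / 4 =
      (θ - b) + Real.pi / 2 by rw [hθ, hb]; ring,
    show 2 * Real.pi * a * t - (μ + β) * Real.pi / 2 - Real.pi / 4 = θ - b by rw [hθ, hb]; ring,
    show 2 * Real.pi * a * t - (μ - 1) * Real.pi / 2 - Real.pi / 4 = θ + Real.pi / 2 by
      rw [hθ]; ring, Real.cos_add_pi_div_two, Real.cos_add_pi_div_two]
  have e1 : (Real.pi * a) ^ (-(μ + β - 1) - 1 / 2) * (Real.pi * a) ^ (-μ - 1 / 2) =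
      (Real.pi * a) ^ (-2 * μ - β) := by
    rw [← Real.rpow_add hc]; congr 1; ring
  have e2 : (Real.pi * a) ^ (-(μ + β) - 1 / 2) * (Real.pi * a) ^ (-(μ - 1) - 1 / 2) =
      (Real.pi * a) ^ (-2 * μ - β) := by
    rw [← Real.rpow_add hc]; congr 1; ring
  have e3 : (√Real.pi)⁻¹ * (√Real.pi)⁻¹ = Real.pi⁻¹ := by
    rw [← mul_inv, Real.mul_self_sqrt Real.pi_pos.le]
  have e4 : Real.sin b = Real.sin θ * Real.cos (θ - b) - Real.cos θ * Real.sin (θ - b) := by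
    rw [← Real.sin_sub]; congr 1; ring
  rw [e4]
  generalize (Real.pi * a) ^ (-2 * μ - β) = Z at *
  generalize (Real.pi * a) ^ (-(μ + β - 1) - 1 / 2) = z1 at *
  generalize (Real.pi * a) ^ (-μ - 1 / 2) = z2 at *
  generalize (Real.pi * a) ^ (-(μ + β) - 1 / 2) = z3 at *
  generalize (Real.pi * a) ^ (-(μ - 1) - 1 / 2) = z4 at *
  generalize (√Real.pi)⁻¹ = s at *
  linear_combination (-(s * s) * Real.sin (θ - b) * Real.cos θ) * e1 +
    (s * s * Real.cos (θ - b) * Real.sin θ) * e2 +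
    (Z * (Real.cos (θ - b) * Real.sin θ - Real.sin (θ - b) * Real.cos θ)) * e3

/-- With `p = q` the Green identity gives `β` times the integral in closed form, as a cross product
of Bessel functions. This determines the integral only for `β ≠ 0`. -/
theorem tendsto_rpow_mul_lamInt {d : ℕ} (hd : 1 ≤ d) {β a : ℝ} (hβ : β ≠ 0) (ha : 0 < a) :
    Tendsto (fun t => lamInt d ((d : ℝ) / 2 + β) (Real.pi ^ 2 * a ^ 2) (Real.pi ^ 2 * a ^ 2) t *
      t ^ β) atTop
      (𝓝 (Real.pi⁻¹ * (Real.pi * a) ^ (-(d : ℝ) - β) * Real.sin (β * Real.pi / 2) / β)) := by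
  set μ : ℝ := (d : ℝ) / 2 with hμ
  set p : ℝ := Real.pi ^ 2 * a ^ 2 with hp
  have hp0 : 0 < p := by have := Real.pi_pos; positivity
  have h1 := (tendsto_normLam_mul_sub (μ + β - 1) μ ha).sub
    (tendsto_normLam_mul_sub (μ + β) (μ - 1) ha)
  rw [sub_zero] at h1
  have h2 := (h1.add_const
    (Real.pi⁻¹ * (Real.pi * a) ^ (-2 * μ - β) * Real.sin (β * Real.pi / 2))).div_const β
  rw [zero_add, show -2 * μ - β = -(d : ℝ) - β by rw [hμ]; ring] at h2
  refine h2.congr' ?_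
  filter_upwards [eventually_gt_atTop 0] with t ht
  have h3 := normMain_mul_sub μ β ha t
  rw [show -2 * μ - β = -(d : ℝ) - β by rw [hμ]; ring] at h3
  have h4 := lamInt_green hd (μ + β - 1) p p t
  rw [lamX, lamY, sub_self, zero_mul, add_zero, show μ + β - 1 + 1 = μ + β by ring,
    ← hμ] at h4
  have h5 : β * lamInt d (μ + β) p p t = t ^ d *
      (besselLam (μ + β - 1) (p * t ^ 2) * besselLam μ (p * t ^ 2)) -
      t ^ d * (besselLam (μ + β) (p * t ^ 2) * besselLam (μ - 1) (p * t ^ 2)) := by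
    refine mul_left_cancel₀ hp0.ne' ?_
    linear_combination -h4
  rw [div_eq_iff hβ]
  have e1 : t ^ (μ + β - 1 + 1 / 2) * t ^ (μ + 1 / 2) = t ^ d * t ^ β := by
    rw [← Real.rpow_natCast, ← Real.rpow_add ht, ← Real.rpow_add ht]
    congr 1; rw [hμ]; ring
  have e2 : t ^ (μ + β + 1 / 2) * t ^ (μ - 1 + 1 / 2) = t ^ d * t ^ β := by
    rw [← Real.rpow_natCast, ← Real.rpow_add ht, ← Real.rpow_add ht]
    congr 1; rw [hμ]; ring
  have h6 : normLam (μ + β - 1) a t * normLam μ a t -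
      normLam (μ + β) a t * normLam (μ - 1) a t = β * lamInt d (μ + β) p p t * t ^ β := by
    rw [h5]
    simp only [normLam, ← hp]
    linear_combination (besselLam (μ + β - 1) (p * t ^ 2) * besselLam μ (p * t ^ 2)) * e1 -
      (besselLam (μ + β) (p * t ^ 2) * besselLam (μ - 1) (p * t ^ 2)) * e2
  linear_combination h6 - h3

/-! ### The partial integrals at the origin -/

/-- At `ρ = 0` the second boundary term disappears and the factor `Λ_{d/2-1}(0) = 1/Γ(d/2)` is
constant, so a single Bessel function is left. -/
theorem sigmaErr_zero_eq {d : ℕ} (hd : 1 ≤ d) {β a : ℝ} (hβ : -1 < β) (ha : 0 < a) {l : ℝ}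
    (hl : 0 < l) :
    sigmaErr d β a 0 l = (a ^ 2)⁻¹ * sigmaErr d (β + 1) a 0 l +
      hatConst d β a * Real.pi ^ ((d : ℝ) / 2) / Real.Gamma ((d : ℝ) / 2) *
        (l ^ (((d : ℝ) - 3) / 2 - β) * normLam ((d : ℝ) / 2 + β + 1) a l) := by
  have h := sigmaErr_green hd hβ ha le_rfl l
  rw [sigmaBdry, lamX, show Real.pi ^ 2 * (0 : ℝ) ^ 2 * l ^ 2 = 0 by ring,
    besselLam_zero_right, sub_add_cancel] at h
  have e : l ^ (((d : ℝ) - 3) / 2 - β) * normLam ((d : ℝ) / 2 + β + 1) a l =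
      l ^ d * besselLam ((d : ℝ) / 2 + β + 1) (Real.pi ^ 2 * a ^ 2 * l ^ 2) := by
    rw [normLam, ← mul_assoc, ← Real.rpow_add hl, ← Real.rpow_natCast l d]
    congr 2; ring
  have ha2 : a ^ 2 ≠ 0 := by positivity
  rw [e]
  refine mul_left_cancel₀ ha2 ?_
  rw [mul_add, mul_inv_cancel_left₀ ha2]
  rw [show (0 : ℝ) ^ 2 = 0 by norm_num, sub_zero, zero_mul, sub_zero] at h
  rw [h]
  ring

theorem rpow_mul_normLam_isBigO (e ν : ℝ) {a : ℝ} (ha : 0 < a) :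
    (fun t => t ^ e * normLam ν a t) =O[atTop] fun t : ℝ => t ^ e := by
  simpa using (isBigO_refl (fun t : ℝ => t ^ e) atTop).mul (normLam_isBigO ν ha)

theorem sigmaErr_zero_isBigO {d : ℕ} (hd : 1 ≤ d) {β a : ℝ} (hβ : -1 < β) (ha : 0 < a) :
    sigmaErr d β a 0 =O[atTop] fun t : ℝ => t ^ (((d : ℝ) - 3) / 2 - β) := by
  have hd1 : (1 : ℝ) ≤ d := by exact_mod_cast hd
  have step : ∀ β : ℝ, -1 < β →
      (sigmaErr d (β + 1) a 0 =O[atTop] fun t : ℝ => t ^ (((d : ℝ) - 3) / 2 - β)) →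
      sigmaErr d β a 0 =O[atTop] fun t : ℝ => t ^ (((d : ℝ) - 3) / 2 - β) := by
    intro β hβ h
    have h2 := (h.const_mul_left (a ^ 2)⁻¹).add ((rpow_mul_normLam_isBigO
      (((d : ℝ) - 3) / 2 - β) ((d : ℝ) / 2 + β + 1) ha).const_mul_left
        (hatConst d β a * Real.pi ^ ((d : ℝ) / 2) / Real.Gamma ((d : ℝ) / 2)))
    refine h2.congr' ?_ EventuallyEq.rfl
    filter_upwards [eventually_gt_atTop 0] with l hl
    exact (sigmaErr_zero_eq hd hβ ha hl).symm
  -- The induction raises `β` above `d/2`. There the tail bound for `β + 1` has exponent `(d-1)/2 -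
  -- (β+1)`, exactly the one required; each step back down only weakens it.
  have H : ∀ n : ℕ, ∀ β : ℝ, -1 < β → (d : ℝ) / 2 < β + n →
      sigmaErr d β a 0 =O[atTop] fun t : ℝ => t ^ (((d : ℝ) - 3) / 2 - β) := by
    intro n
    induction n with
    | zero =>
      intro β hβ h
      rw [Nat.cast_zero, add_zero] at h
      refine step β hβ ?_
      obtain ⟨C, hC0, hC⟩ := exists_sigmaErr_bound_of_large hd (β := β + 1) ha (by linarith)
        (by linarith)
      refine IsBigO.of_bound C ?_
      filter_upwards [eventually_ge_atTop 1] with l hl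
      have := hC 0 l hl
      rw [norm_zero] at this
      rw [Real.norm_eq_abs, Real.norm_of_nonneg (by positivity)]
      convert this using 3
      ring
    | succ n ih =>
      intro β hβ h
      refine step β hβ ((ih (β + 1) (by linarith) (by push_cast at h; linarith)).trans ?_)
      exact isBigO_rpow_of_le (by linarith)
  obtain ⟨n, hn⟩ := exists_nat_gt ((d : ℝ) / 2 + 1)
  exact H n β hβ (by linarith)

/-- Both the error for `β + 1` and the correction to the Bessel asymptotics are smaller by one power
of `t`. The order `d/2 + β + 1` puts an extra `π` in the phase, the source of the minus sign. -/
theorem sigmaErr_zero_asymptotics {d : ℕ} (hd : 1 ≤ d) {β a : ℝ} (hβ : -1 < β) (ha : 0 < a) :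
    (fun t => sigmaErr d β a 0 t - -(pinskyConst d β a) *
      Real.cos (2 * Real.pi * a * t - ((d : ℝ) - 1 + 2 * β) / 4 * Real.pi) *
        t ^ (((d : ℝ) - 3) / 2 - β)) =O[atTop] fun t : ℝ => t ^ (((d : ℝ) - 5) / 2 - β) := by
  set K : ℝ := hatConst d β a * Real.pi ^ ((d : ℝ) / 2) / Real.Gamma ((d : ℝ) / 2) with hK
  set ν : ℝ := (d : ℝ) / 2 + β + 1 with hν
  have h1 := sigmaErr_zero_isBigO hd (by linarith : -1 < β + 1) ha
  have h2 := ((isBigO_refl (fun t : ℝ => t ^ (((d : ℝ) - 3) / 2 - β)) atTop).mul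
    (normLam_sub_normMain_isBigO ν ha)).const_mul_left K
  have h2' : (fun t => K * (t ^ (((d : ℝ) - 3) / 2 - β) * (normLam ν a t - normMain ν a t)))
      =O[atTop] fun t : ℝ => t ^ (((d : ℝ) - 5) / 2 - β) := by
    refine h2.congr' EventuallyEq.rfl ?_
    filter_upwards [eventually_gt_atTop 0] with t ht
    rw [← Real.rpow_add ht]
    congr 1; ring
  have h1' : (fun t => (a ^ 2)⁻¹ * sigmaErr d (β + 1) a 0 t) =O[atTop]
      fun t : ℝ => t ^ (((d : ℝ) - 5) / 2 - β) := by
    refine (h1.const_mul_left (a ^ 2)⁻¹).congr (fun _ => rfl) fun t => ?_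
    congr 1; ring
  have hmain : ∀ t, K * normMain ν a t = -(pinskyConst d β a) *
      Real.cos (2 * Real.pi * a * t - ((d : ℝ) - 1 + 2 * β) / 4 * Real.pi) := by
    intro t
    rw [normMain, show 2 * Real.pi * a * t - ν * Real.pi / 2 - Real.pi / 4 =
      2 * Real.pi * a * t - ((d : ℝ) - 1 + 2 * β) / 4 * Real.pi - Real.pi by rw [hν]; ring,
      Real.cos_sub_pi]
    have e1 : hatConst d β a * Real.pi ^ ((d : ℝ) / 2) * ((√Real.pi)⁻¹ *
        (Real.pi * a) ^ (-ν - 1 / 2)) = Real.Gamma (β + 1) *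
          a ^ (((d : ℝ) - 3) / 2 + β) * Real.pi ^ (((d : ℝ) - 4) / 2 - β) := by
      have hpi := Real.pi_pos
      have e2 : a ^ (2 * β + (d : ℝ)) * a ^ (-ν - 1 / 2) = a ^ (((d : ℝ) - 3) / 2 + β) := by
        rw [← Real.rpow_add ha]; congr 1; rw [hν]; ring
      have e3 : Real.pi ^ ((d : ℝ) / 2) * Real.pi ^ ((d : ℝ) / 2) * (√Real.pi)⁻¹ *
          Real.pi ^ (-ν - 1 / 2) = Real.pi ^ (((d : ℝ) - 4) / 2 - β) := by
        rw [Real.sqrt_eq_rpow, ← Real.rpow_neg hpi.le, ← Real.rpow_add hpi, ← Real.rpow_add hpi,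
          ← Real.rpow_add hpi]
        congr 1; rw [hν]; ring
      rw [hatConst, Real.mul_rpow hpi.le ha.le, ← e2, ← e3]
      ring
    rw [hK, pinskyConst]
    linear_combination (-(Real.Gamma ((d : ℝ) / 2))⁻¹ *
      Real.cos (2 * Real.pi * a * t - ((d : ℝ) - 1 + 2 * β) / 4 * Real.pi)) * e1
  refine (h1'.add h2').congr' ?_ EventuallyEq.rfl
  filter_upwards [eventually_gt_atTop 0] with t ht
  rw [sigmaErr_zero_eq hd hβ ha ht]
  linear_combination (-t ^ (((d : ℝ) - 3) / 2 - β)) * hmain t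


/-! ### The partial integrals on the sphere for `β = 0` -/

/-- For `β = 0` the Green identity on the sphere degenerates. Instead, the derivative of `r^d
Λ_{d/2}²` links dimensions `d` and `d + 2`, and the boundary value tends to 0. -/
theorem lamInt_sub_lamInt_add_two {d : ℕ} (hd : 1 ≤ d) (p t : ℝ) :
    lamInt d ((d : ℝ) / 2) p p t - p * lamInt (d + 2) (((d + 2 : ℕ) : ℝ) / 2) p p t =
      t ^ d * besselLam ((d : ℝ) / 2) (p * t ^ 2) ^ 2 := by
  set μ : ℝ := (d : ℝ) / 2 with hμ
  have e1 : ((d + 2 : ℕ) : ℝ) / 2 = μ + 1 := by rw [hμ]; push_cast; ring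
  have hderiv : ∀ r : ℝ, HasDerivAt (fun r => r ^ d * besselLam μ (p * r ^ 2) ^ 2)
      (2 * (r ^ (d - 1) * (besselLam μ (p * r ^ 2) * besselLam (μ - 1) (p * r ^ 2))) -
        p * (2 * (r ^ (d + 2 - 1) * (besselLam (μ + 1) (p * r ^ 2) *
          besselLam (μ + 1 - 1) (p * r ^ 2))))) r := by
    intro r
    have h := (hasDerivAt_pow d r).mul ((hasDerivAt_besselLam_mul_sq μ p r).pow 2)
    refine h.congr_deriv ?_
    rw [besselLam_pred μ (p * r ^ 2), add_sub_cancel_right]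
    obtain ⟨k, rfl⟩ := Nat.exists_eq_add_of_le' hd
    have e3 : (((k + 1 : ℕ) : ℝ)) = 2 * μ := by rw [hμ]; ring
    rw [e3]
    simp only [Pi.pow_apply, Nat.add_sub_cancel, show k + 1 + 2 - 1 = k + 2 by omega]
    push_cast
    ring
  have c1 : IntervalIntegrable (fun r : ℝ => 2 * (r ^ (d - 1) * (besselLam μ (p * r ^ 2) *
      besselLam (μ - 1) (p * r ^ 2)))) volume 0 t :=
    (continuous_lamInt_integrand d μ p p).intervalIntegrable _ _
  have c2 : IntervalIntegrable (fun r : ℝ => p * (2 * (r ^ (d + 2 - 1) *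
      (besselLam (μ + 1) (p * r ^ 2) * besselLam (μ + 1 - 1) (p * r ^ 2))))) volume 0 t := by
    have := continuous_lamInt_integrand (d + 2) (μ + 1) p p
    rw [e1] at this
    exact (this.intervalIntegrable _ _).const_mul p
  have h := intervalIntegral.integral_eq_sub_of_hasDerivAt (a := 0) (b := t)
    (fun r _ => hderiv r) (c1.sub c2)
  rw [zero_pow (by omega), zero_mul, sub_zero] at h
  rw [← h, intervalIntegral.integral_sub c1 c2, lamInt, lamInt, e1,
    ← intervalIntegral.integral_const_mul p]

theorem tendsto_pow_mul_besselLam_sq (d : ℕ) {a : ℝ} (ha : 0 < a) :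
    Tendsto (fun t : ℝ => t ^ d * besselLam ((d : ℝ) / 2) (Real.pi ^ 2 * a ^ 2 * t ^ 2) ^ 2) atTop
      (𝓝 0) := by
  have h := ((isBigO_refl (fun t : ℝ => t ^ (-1 : ℝ)) atTop).mul
    ((normLam_isBigO ((d : ℝ) / 2) ha).mul (normLam_isBigO ((d : ℝ) / 2) ha)))
  simp only [mul_one] at h
  refine (h.trans_tendsto (tendsto_rpow_neg_atTop one_pos)).congr' ?_
  filter_upwards [eventually_gt_atTop 0] with t ht
  have e : t ^ (-1 : ℝ) * (t ^ ((d : ℝ) / 2 + 1 / 2) * t ^ ((d : ℝ) / 2 + 1 / 2)) = t ^ d := by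
    rw [← Real.rpow_add ht, ← Real.rpow_add ht, ← Real.rpow_natCast]
    congr 1; ring
  rw [normLam, ← e]
  ring

theorem mul_besselLam_half (z : ℝ) :
    z / 2 * besselLam (1 / 2) (z ^ 2 / 4) = Real.sin z / √Real.pi := by
  have h1 : HasDerivAt (fun z : ℝ => besselLam (-1 / 2) (z ^ 2 / 4))
      (-Real.sin z / √Real.pi) z :=
    ((Real.hasDerivAt_cos z).div_const _).congr_of_eventuallyEq
      (Eventually.of_forall besselLam_neg_half)
  have h2 := hasDerivAt_besselLam_mul_sq (-1 / 2) (1 / 4) z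
  have h3 : HasDerivAt (fun z : ℝ => besselLam (-1 / 2) (z ^ 2 / 4))
      (-besselLam (-1 / 2 + 1) (1 / 4 * z ^ 2) * (2 * (1 / 4) * z)) z :=
    h2.congr_of_eventuallyEq (Eventually.of_forall fun z => by
      show besselLam (-1 / 2) (z ^ 2 / 4) = besselLam (-1 / 2) (1 / 4 * z ^ 2)
      congr 1; ring)
  have h4 := h3.unique h1
  rw [show (-1 / 2 + 1 : ℝ) = 1 / 2 by norm_num, show 1 / 4 * z ^ 2 = z ^ 2 / 4 by ring] at h4
  linear_combination -h4

/-- The duplication formula for the sine, written for the orders `±1/2`. -/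
theorem besselLam_half_mul_neg_half (z : ℝ) :
    besselLam (1 / 2) (z ^ 2 / 4) * besselLam (-1 / 2) (z ^ 2 / 4) =
      besselLam (1 / 2) (4 * (z ^ 2 / 4)) * besselLam (-1 / 2) 0 := by
  have h0 : besselLam (-1 / 2) 0 = (√Real.pi)⁻¹ := by
    have := besselLam_neg_half 0
    rw [show (0 : ℝ) ^ 2 / 4 = 0 by norm_num, Real.cos_zero] at this
    rw [this, one_div]
  rcases eq_or_ne z 0 with rfl | hz
  · simp
  · have h1 := mul_besselLam_half z
    have h2 := mul_besselLam_half (2 * z)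
    rw [Real.sin_two_mul, show (2 * z) ^ 2 / 4 = 4 * (z ^ 2 / 4) by ring] at h2
    have h3 := besselLam_neg_half z
    refine mul_left_cancel₀ hz ?_
    rw [h0, h3]
    linear_combination (2 * Real.cos z / √Real.pi) * h1 - (√Real.pi)⁻¹ * h2

theorem lamInt_one_eq {a : ℝ} (t : ℝ) :
    lamInt 1 (1 / 2) (Real.pi ^ 2 * a ^ 2) (Real.pi ^ 2 * a ^ 2) t =
      lamInt 1 (1 / 2) (Real.pi ^ 2 * (2 * a) ^ 2) (Real.pi ^ 2 * 0 ^ 2) t := by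
  rw [lamInt, lamInt]
  congr 1
  funext r
  have h := besselLam_half_mul_neg_half (2 * Real.pi * a * r)
  rw [show (2 * Real.pi * a * r) ^ 2 / 4 = Real.pi ^ 2 * a ^ 2 * r ^ 2 by ring,
    show 4 * (Real.pi ^ 2 * a ^ 2 * r ^ 2) = Real.pi ^ 2 * (2 * a) ^ 2 * r ^ 2 by ring] at h
  rw [show ((1 : ℕ) : ℝ) / 2 - 1 = -1 / 2 by norm_num, h,
    show Real.pi ^ 2 * (0 : ℝ) ^ 2 * r ^ 2 = 0 by ring]

/-- By that duplication, the integral at the end of an interval of radius `a` equals the one at the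
centre of an interval of radius `2a`, where the partial integral tends to 1; the constant `2πa` is
divided out. -/
theorem tendsto_lamInt_one {a : ℝ} (ha : 0 < a) :
    Tendsto (lamInt 1 (1 / 2) (Real.pi ^ 2 * a ^ 2) (Real.pi ^ 2 * a ^ 2)) atTop
      (𝓝 ((Real.pi * a)⁻¹ / 2)) := by
  have hpi := Real.pi_pos
  have h1 := (sigmaErr_zero_isBigO le_rfl (by norm_num : (-1 : ℝ) < 0)
    (by positivity : 0 < 2 * a)).trans_tendsto (by
      have := tendsto_rpow_neg_atTop (one_pos (α := ℝ))
      norm_num at this ⊢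
      exact this)
  have h2 := (h1.add_const 1).const_mul ((Real.pi * a)⁻¹ / 2)
  rw [zero_add, mul_one] at h2
  refine h2.congr fun t => ?_
  have e : hatConst 1 0 (2 * a) * Real.pi ^ (((1 : ℕ) : ℝ) / 2) = 2 * (Real.pi * a) := by
    rw [hatConst, mul_right_comm, mul_assoc (Real.Gamma _), ← Real.rpow_add hpi]
    norm_num
    ring
  rw [sigmaErr, sigmaBall, bumpProfile, if_pos (by positivity), Real.rpow_zero, e,
    lamInt_one_eq, sub_add_cancel, show ((1 : ℕ) : ℝ) / 2 + 0 = 1 / 2 by norm_num]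
  field_simp

/-- In dimension 2 the integrand is an exact derivative of a multiple of `Λ_0²`, and `Λ_0` tends to
0. -/
theorem tendsto_lamInt_two {a : ℝ} (ha : 0 < a) :
    Tendsto (lamInt 2 1 (Real.pi ^ 2 * a ^ 2) (Real.pi ^ 2 * a ^ 2)) atTop
      (𝓝 ((Real.pi * a)⁻¹ ^ 2 / 2)) := by
  set p : ℝ := Real.pi ^ 2 * a ^ 2 with hp
  have hp0 : 0 < p := by have := Real.pi_pos; positivity
  have hderiv : ∀ r : ℝ, HasDerivAt (fun r => -(besselLam 0 (p * r ^ 2) ^ 2) / (2 * p))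
      (2 * (r ^ (2 - 1) * (besselLam 1 (p * r ^ 2) * besselLam (((2 : ℕ) : ℝ) / 2 - 1)
        (p * r ^ 2)))) r := by
    intro r
    have h := (((hasDerivAt_besselLam_mul_sq 0 p r).pow 2).neg).div_const (2 * p)
    refine h.congr_deriv ?_
    rw [show ((2 : ℕ) : ℝ) / 2 - 1 = 0 by norm_num, zero_add]
    field_simp
    norm_num
    ring
  have hI : ∀ t, lamInt 2 1 p p t = (1 - besselLam 0 (p * t ^ 2) ^ 2) / (2 * p) := by
    intro t
    have h := intervalIntegral.integral_eq_sub_of_hasDerivAt (a := 0) (b := t)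
      (fun r _ => hderiv r) ((continuous_lamInt_integrand 2 1 p p).intervalIntegrable _ _)
    rw [lamInt, h, show p * (0 : ℝ) ^ 2 = 0 by ring, besselLam_zero_right, zero_add,
      Real.Gamma_one]
    ring
  have h0 := tendsto_pow_mul_besselLam_sq 0 ha
  simp only [pow_zero, one_mul, Nat.cast_zero, zero_div] at h0
  have h1 := (h0.const_sub 1).div_const (2 * p)
  rw [sub_zero, show 1 / (2 * p) = (Real.pi * a)⁻¹ ^ 2 / 2 by
    rw [hp, inv_pow, mul_pow]; field_simp] at h1
  exact h1.congr fun t => (hI t).symm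

theorem tendsto_lamInt_diag {a : ℝ} (ha : 0 < a) {d : ℕ} (hd : 1 ≤ d) :
    Tendsto (lamInt d ((d : ℝ) / 2) (Real.pi ^ 2 * a ^ 2) (Real.pi ^ 2 * a ^ 2)) atTop
      (𝓝 ((Real.pi * a)⁻¹ ^ d / 2)) := by
  have hp0 : Real.pi ^ 2 * a ^ 2 ≠ 0 := by have := Real.pi_pos; positivity
  induction d using Nat.twoStepInduction with
  | zero => omega
  | one => simpa using tendsto_lamInt_one ha
  | more d ih _ =>
    rcases Nat.eq_zero_or_pos d with rfl | hd0
    · simpa using tendsto_lamInt_two ha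
    · have h := ((ih hd0).sub (tendsto_pow_mul_besselLam_sq d ha)).div_const
        (Real.pi ^ 2 * a ^ 2)
      rw [sub_zero, show (Real.pi * a)⁻¹ ^ d / 2 / (Real.pi ^ 2 * a ^ 2) =
        (Real.pi * a)⁻¹ ^ (d + 2) / 2 by
          rw [pow_add, inv_pow _ 2, mul_pow]; field_simp] at h
      refine h.congr fun t => ?_
      rw [div_eq_iff hp0]
      linear_combination lamInt_sub_lamInt_add_two hd0 (Real.pi ^ 2 * a ^ 2) t

theorem tendsto_sigmaBall_mul_rpow {d : ℕ} (hd : 1 ≤ d) (β : ℝ) {a : ℝ} (ha : 0 < a) :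
    Tendsto (fun t => sigmaBall d β a a t * t ^ β) atTop (𝓝 (sphereConst β a)) := by
  have hpi := Real.pi_pos
  have hc : 0 < Real.pi * a := by positivity
  rcases eq_or_ne β 0 with rfl | hβ
  · have h := (tendsto_lamInt_diag ha hd).const_mul (hatConst d 0 a * Real.pi ^ ((d : ℝ) / 2))
    have e : hatConst d 0 a * Real.pi ^ ((d : ℝ) / 2) * ((Real.pi * a)⁻¹ ^ d / 2) =
        sphereConst 0 a := by
      rw [hatConst, sphereConst]
      have e1 : Real.pi ^ ((d : ℝ) / 2) * Real.pi ^ ((d : ℝ) / 2) = Real.pi ^ d := by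
        rw [← Real.rpow_add hpi, add_halves, Real.rpow_natCast]
      have e2 : a ^ (2 * 0 + (d : ℝ)) = a ^ d := by rw [mul_zero, zero_add, Real.rpow_natCast]
      rw [e2, inv_pow, mul_pow]
      simp only [zero_add, Real.Gamma_one, zero_mul, zero_div, Real.sinc_zero, Real.rpow_zero]
      rw [← e1]
      field_simp
    rw [e] at h
    refine h.congr fun t => ?_
    rw [Real.rpow_zero, mul_one, sigmaBall, add_zero]
  · have h := (tendsto_rpow_mul_lamInt hd hβ ha).const_mul
      (hatConst d β a * Real.pi ^ ((d : ℝ) / 2))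
    have e : hatConst d β a * Real.pi ^ ((d : ℝ) / 2) *
        (Real.pi⁻¹ * (Real.pi * a) ^ (-(d : ℝ) - β) * Real.sin (β * Real.pi / 2) / β) =
        sphereConst β a := by
      have e1 : Real.pi ^ ((d : ℝ) / 2) * Real.pi ^ ((d : ℝ) / 2) * Real.pi ^ (-(d : ℝ) - β) *
          Real.pi ^ β = 1 := by
        rw [← Real.rpow_add hpi, ← Real.rpow_add hpi, ← Real.rpow_add hpi]
        rw [show (d : ℝ) / 2 + (d : ℝ) / 2 + (-(d : ℝ) - β) + β = 0 by ring, Real.rpow_zero]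
      have e2 : a ^ (2 * β + (d : ℝ)) * a ^ (-(d : ℝ) - β) = a ^ β := by
        rw [← Real.rpow_add ha]; congr 1; ring
      have hb : β * Real.pi / 2 ≠ 0 := by positivity
      have hpb : Real.pi ^ β ≠ 0 := by positivity
      have e1' : Real.pi ^ ((d : ℝ) / 2) * Real.pi ^ ((d : ℝ) / 2) * Real.pi ^ (-(d : ℝ) - β) =
          (Real.pi ^ β)⁻¹ := eq_inv_of_mul_eq_one_left e1
      rw [hatConst, sphereConst, Real.sinc_of_ne_zero hb, Real.mul_rpow hpi.le ha.le,
        Real.div_rpow ha.le hpi.le, ← e2, div_eq_mul_inv (a ^ _ * a ^ _), ← e1']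
      field_simp
    rw [e] at h
    refine h.congr fun t => ?_
    rw [sigmaBall]; ring


/-! ### Divergence at the origin -/

theorem bumpSum_eq (d : ℕ) (β a t : ℝ) :
    bumpSum d β a t = perBump β a (0 : E d) + sigmaErr d β a 0 t +
      sphereCount a (0 : E d) * sigmaBall d β a a t + sumErr d β a t := by
  rw [sumErr]; ring

theorem not_tendsto_cos {c : ℝ} (hc : 0 < c) (b x : ℝ) :
    ¬ Tendsto (fun t : ℝ => Real.cos (c * t - b)) atTop (𝓝 x) := by
  intro h
  have h1 : Tendsto (fun n : ℕ => (b + n * (2 * Real.pi)) / c) atTop atTop :=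
    (tendsto_atTop_add_const_left _ b
      (tendsto_natCast_atTop_atTop.atTop_mul_const Real.two_pi_pos)).atTop_div_const hc
  have h2 : Tendsto (fun n : ℕ => (b + Real.pi + n * (2 * Real.pi)) / c) atTop atTop :=
    (tendsto_atTop_add_const_left _ (b + Real.pi)
      (tendsto_natCast_atTop_atTop.atTop_mul_const Real.two_pi_pos)).atTop_div_const hc
  have e1 : x = 1 := by
    refine tendsto_nhds_unique (h.comp h1) (tendsto_const_nhds.congr fun n => ?_)
    rw [Function.comp_apply, mul_div_cancel₀ _ hc.ne', add_sub_cancel_left,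
      Real.cos_nat_mul_two_pi]
  have e2 : x = -1 := by
    refine tendsto_nhds_unique (h.comp h2) (tendsto_const_nhds.congr fun n => ?_)
    rw [Function.comp_apply, mul_div_cancel₀ _ hc.ne',
      show b + Real.pi + n * (2 * Real.pi) - b = n * (2 * Real.pi) + Real.pi by ring,
      Real.cos_nat_mul_two_pi_add_pi]
  linarith

theorem exists_tendsto_rpow_of_nonpos {e : ℝ} (he : e ≤ 0) :
    ∃ x : ℝ, Tendsto (fun t : ℝ => t ^ e) atTop (𝓝 x) := by
  rcases he.lt_or_eq with h | rfl
  · refine ⟨0, ?_⟩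
    have := tendsto_rpow_neg_atTop (neg_pos.2 h)
    rwa [neg_neg] at this
  · exact ⟨1, by simp⟩

theorem pinskyConst_pos {d : ℕ} (hd : 1 ≤ d) {β a : ℝ} (hβ : -1 < β) (ha : 0 < a) :
    0 < pinskyConst d β a := by
  have hd1 : (1 : ℝ) ≤ d := by exact_mod_cast hd
  have := Real.Gamma_pos_of_pos (by linarith : 0 < β + 1)
  have := Real.Gamma_pos_of_pos (by linarith : 0 < (d : ℝ) / 2)
  have := Real.pi_pos
  rw [pinskyConst]
  positivity

theorem sphereConst_pos {β a : ℝ} (hβ : -1 < β) (hβ0 : β < 0) (ha : 0 < a) :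
    0 < sphereConst β a := by
  have h1 := Real.Gamma_pos_of_pos (by linarith : 0 < β + 1)
  have hpi := Real.pi_pos
  have h2 : β * Real.pi / 2 < 0 := by nlinarith
  have h3 : -Real.pi < β * Real.pi / 2 := by nlinarith
  have h4 : 0 < Real.sinc (β * Real.pi / 2) := by
    rw [Real.sinc_of_ne_zero h2.ne]
    exact div_pos_of_neg_of_neg (Real.sin_neg_of_neg_of_neg_pi_lt h2 h3) h2
  rw [sphereConst]
  positivity

/-- After multiplication by `t^{-e}` with `e = (d-3)/2 - β ≥ 0`, every term other than the cosine
converges, so a limit of the partial sums would force the cosine to converge. -/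
theorem not_tendsto_of_tendsto_sphere {d : ℕ} (hd : 2 ≤ d) {β a : ℝ} (hβ : -1 < β) (ha : 0 < a)
    (hβd : β ≤ ((d : ℝ) - 3) / 2) {y : ℝ}
    (hy : Tendsto (fun t => sphereCount a (0 : E d) * sigmaBall d β a a t *
      t ^ (-(((d : ℝ) - 3) / 2 - β))) atTop (𝓝 y)) (x : ℝ) :
    ¬ Tendsto (bumpSum d β a) atTop (𝓝 x) := by
  intro hx
  have hP := pinskyConst_pos (by omega : 1 ≤ d) hβ ha
  set e : ℝ := ((d : ℝ) - 3) / 2 - β with he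
  obtain ⟨w, hw⟩ := exists_tendsto_rpow_of_nonpos (by linarith : -e ≤ 0)
  have hcancel : ∀ t : ℝ, 0 < t → t ^ e * t ^ (-e) = 1 := fun t ht => by
    rw [← Real.rpow_add ht, add_neg_cancel, Real.rpow_zero]
  have h1 : Tendsto (fun t => sumErr d β a t * t ^ (-e)) atTop (𝓝 0) := by
    have h := (sumErr_isLittleO hd hβ ha).mul_isBigO (isBigO_refl (fun t : ℝ => t ^ (-e)) atTop)
    refine (isLittleO_one_iff ℝ).1 (h.congr' EventuallyEq.rfl ?_)
    filter_upwards [eventually_gt_atTop 0] with t ht using hcancel t ht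
  set Q : ℝ → ℝ := fun t => sigmaErr d β a 0 t - -(pinskyConst d β a) *
      Real.cos (2 * Real.pi * a * t - ((d : ℝ) - 1 + 2 * β) / 4 * Real.pi) * t ^ e with hQ
  have h2 : Tendsto (fun t => Q t * t ^ (-e)) atTop (𝓝 0) := by
    have h := (sigmaErr_zero_asymptotics (by omega : 1 ≤ d) hβ ha).mul
      (isBigO_refl (fun t : ℝ => t ^ (-e)) atTop)
    refine (h.congr' EventuallyEq.rfl ?_).trans_tendsto (tendsto_rpow_neg_atTop one_pos)
    filter_upwards [eventually_gt_atTop 0] with t ht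
    rw [← Real.rpow_add ht]
    congr 1; rw [he]; ring
  have h3 := ((((hw.const_mul (perBump β a (0 : E d))).add hy).add h1).add h2).sub (hx.mul hw)
  have h4 := h3.div_const (pinskyConst d β a)
  have hc : 0 < 2 * Real.pi * a := by have := Real.pi_pos; positivity
  refine not_tendsto_cos hc (((d : ℝ) - 1 + 2 * β) / 4 * Real.pi) _ (h4.congr' ?_)
  filter_upwards [eventually_gt_atTop 0] with t ht
  rw [div_eq_iff hP.ne', bumpSum_eq]
  simp only [hQ]
  linear_combination (pinskyConst d β a *
    Real.cos (2 * Real.pi * a * t - ((d : ℝ) - 1 + 2 * β) / 4 * Real.pi)) * hcancel t ht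

theorem bumpSum_not_tendsto {d : ℕ} (hd : 2 ≤ d) {β a : ℝ} (hβ : -1 < β) (ha : 0 < a)
    (hβd : β ≤ ((d : ℝ) - 3) / 2) (x : ℝ) : ¬ Tendsto (bumpSum d β a) atTop (𝓝 x) := by
  have hJ := tendsto_sigmaBall_mul_rpow (by omega : 1 ≤ d) β ha
  rcases Nat.eq_zero_or_pos (sphereCount a (0 : E d)) with hr | hr
  · exact not_tendsto_of_tendsto_sphere hd hβ ha hβd (y := 0) (by simp [hr]) x
  rcases Nat.lt_or_ge 2 d with hd3 | hd2
  -- For `d ≥ 3` the rescaled sphere term is of order `t^{-(d-3)/2}`, so it converges.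
  · have hd3' : (3 : ℝ) ≤ d := by exact_mod_cast hd3
    obtain ⟨w, hw⟩ := exists_tendsto_rpow_of_nonpos
      (by linarith : -(((d : ℝ) - 3) / 2) ≤ 0)
    refine not_tendsto_of_tendsto_sphere hd hβ ha hβd
      (((hJ.const_mul (sphereCount a (0 : E d) : ℝ)).mul hw).congr' ?_) x
    filter_upwards [eventually_gt_atTop 0] with t ht
    have e : t ^ β * t ^ (-(((d : ℝ) - 3) / 2)) = t ^ (-(((d : ℝ) - 3) / 2 - β)) := by
      rw [← Real.rpow_add ht]; congr 1; ring
    rw [← e]; ring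
  -- In dimension 2 the sphere term exceeds the Pinsky term by `t^{1/2}`. Rescaling by `t^β`, which
  -- tends to 0 as `β ≤ -1/2`, would give the limit 0 on one side and a positive multiple of the
  -- sphere constant on the other.
  · obtain rfl : d = 2 := le_antisymm hd2 hd
    intro hx
    have hβ2 : β ≤ -1 / 2 := by norm_num at hβd; linarith
    have hL := sphereConst_pos hβ (by linarith : β < 0) ha
    have hw : Tendsto (fun t : ℝ => t ^ β) atTop (𝓝 0) := by
      have := tendsto_rpow_neg_atTop (by linarith : 0 < -β)
      rwa [neg_neg] at this
    have hO : ∀ f : ℝ → ℝ, (f =O[atTop] fun t : ℝ => t ^ ((((2 : ℕ) : ℝ) - 3) / 2 - β)) →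
        Tendsto (fun t => f t * t ^ β) atTop (𝓝 0) := by
      intro f hf
      have h := hf.mul (isBigO_refl (fun t : ℝ => t ^ β) atTop)
      refine (h.congr' EventuallyEq.rfl ?_).trans_tendsto
        (tendsto_rpow_neg_atTop (by norm_num : (0 : ℝ) < 1 / 2))
      filter_upwards [eventually_gt_atTop 0] with t ht
      rw [← Real.rpow_add ht]
      congr 1; push_cast; ring
    have h1 := hO _ (sumErr_isBigO (by norm_num) hβ ha)
    have h2 := hO _ (sigmaErr_zero_isBigO (by norm_num) hβ ha)
    have h3 := (((hw.const_mul (perBump β a (0 : E 2))).add h2).add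
      (hJ.const_mul (sphereCount a (0 : E 2) : ℝ))).add h1
    have h4 := tendsto_nhds_unique (hx.mul hw) (h3.congr fun t => by rw [bumpSum_eq]; ring)
    have hr' : (0 : ℝ) < sphereCount a (0 : E 2) := by exact_mod_cast hr
    have := mul_pos hr' hL
    linarith

end BallFourier

/-! ### Assembly of the two regimes. -/

theorem theorem1 (d : ℕ) (β a : ℝ) (hβ : -1 < β) (ha : 0 < a) :
    (1 ≤ d → ((d : ℝ) - 3) / 2 < β →
      ∃ ε R : ℝ → ℂ,
        Tendsto ε atTop (𝓝 0) ∧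
        R =O[atTop] (fun t : ℝ => t ^ (((d : ℝ) - 3) / 2 - β)) ∧
        ∀ t : ℝ, 0 < t →
          BallFourier.partialSum t (BallFourier.perBump β a) (0 : BallFourier.E d) =
            (BallFourier.perBump β a (0 : BallFourier.E d) : ℂ)
            + (BallFourier.sphereCount a (0 : BallFourier.E d) : ℂ)
              * ((BallFourier.sphereConst β a : ℂ) + ε t) * ((t ^ (-β) : ℝ) : ℂ)
            + R t) ∧
    (2 ≤ d → β ≤ ((d : ℝ) - 3) / 2 →
      (¬ ∃ l : ℂ, Tendsto (fun t : ℝ =>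
          BallFourier.partialSum t (BallFourier.perBump β a) (0 : BallFourier.E d))
        atTop (𝓝 l)) ∧
      (∃ ε R : ℝ → ℂ,
        Tendsto ε atTop (𝓝 0) ∧
        R =o[atTop] (fun t : ℝ => t ^ (((d : ℝ) - 3) / 2 - β)) ∧
        ∀ t : ℝ, 0 < t →
          BallFourier.partialSum t (BallFourier.perBump β a) (0 : BallFourier.E d) =
            (BallFourier.perBump β a (0 : BallFourier.E d) : ℂ)
            + (BallFourier.partialIntegral t (BallFourier.bump β a) (0 : BallFourier.E d)
                - (BallFourier.bump β a (0 : BallFourier.E d) : ℂ))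
            + (BallFourier.sphereCount a (0 : BallFourier.E d) : ℂ)
              * ((BallFourier.sphereConst β a : ℂ) + ε t) * ((t ^ (-β) : ℝ) : ℂ)
            + R t) ∧
      (∃ Q : ℝ → ℂ,
        Q =O[atTop] (fun t : ℝ => t ^ (((d : ℝ) - 5) / 2 - β)) ∧
        ∀ t : ℝ, 0 < t →
          BallFourier.partialIntegral t (BallFourier.bump β a) (0 : BallFourier.E d)
              - (BallFourier.bump β a (0 : BallFourier.E d) : ℂ) =
            ((-(BallFourier.pinskyConst d β a)
              * Real.cos (2 * Real.pi * a * t - ((d : ℝ) - 1 + 2 * β) / 4 * Real.pi)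
              * t ^ (((d : ℝ) - 3) / 2 - β) : ℝ) : ℂ)
            + Q t)) := by
  have key : 1 ≤ d → ∀ t : ℝ, BallFourier.partialSum t (BallFourier.perBump β a)
      (0 : BallFourier.E d) = ((BallFourier.bumpSum d β a t : ℝ) : ℂ) :=
    fun hd t => BallFourier.partialSum_perBump hd hβ ha t
  -- With `ε(t) = σ t^β - L`, where `σ` is the partial integral on the sphere, the factor `(L + ε)
  -- t^{-β}` is exactly `σ`. The expansions therefore hold as identities for every `t > 0`.
  have sphere : ∀ t : ℝ, 0 < t → (BallFourier.sphereConst β a +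
      (BallFourier.sigmaBall d β a a t * t ^ β - BallFourier.sphereConst β a)) * t ^ (-β) =
        BallFourier.sigmaBall d β a a t := by
    intro t ht
    rw [add_sub_cancel, mul_assoc, ← Real.rpow_add ht, add_neg_cancel, Real.rpow_zero, mul_one]
  have small : 1 ≤ d → Tendsto (fun t : ℝ => ((BallFourier.sigmaBall d β a a t * t ^ β -
      BallFourier.sphereConst β a : ℝ) : ℂ)) atTop (𝓝 0) := by
    intro hd
    have h := (BallFourier.tendsto_sigmaBall_mul_rpow hd β ha).sub_const
      (BallFourier.sphereConst β a)
    rw [sub_self] at h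
    exact_mod_cast (Complex.continuous_ofReal.tendsto 0).comp h
  have atZero : 1 ≤ d → ∀ t : ℝ, 0 < t →
      BallFourier.partialIntegral t (BallFourier.bump β a) (0 : BallFourier.E d) -
        (BallFourier.bump β a (0 : BallFourier.E d) : ℂ) =
          ((BallFourier.sigmaErr d β a 0 t : ℝ) : ℂ) := by
    intro hd t ht
    rw [BallFourier.partialIntegral_bump_zero hd hβ ha ht.le, BallFourier.bump_eq_profile,
      norm_zero, BallFourier.sigmaErr, Complex.ofReal_sub]
  refine ⟨fun hd _ => ?_, fun hd hβd => ⟨?_, ?_, ?_⟩⟩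
  -- In this regime the Pinsky term is itself within the allowed error, so it is merged with
  -- `sumErr`; the first witness is read off from `small`.
  · refine ⟨_, fun t => ((BallFourier.sigmaErr d β a 0 t + BallFourier.sumErr d β a t : ℝ) : ℂ),
      small hd, ?_, fun t ht => ?_⟩
    · exact Complex.isBigO_ofReal_left.2 ((BallFourier.sigmaErr_zero_isBigO hd hβ ha).add
        (BallFourier.sumErr_isBigO hd hβ ha))
    · rw [key hd, BallFourier.bumpSum_eq]
      conv_lhs => rw [← sphere t ht]
      push_cast
      ring
  · rintro ⟨l, hl⟩
    refine BallFourier.bumpSum_not_tendsto hd hβ ha hβd l.re ?_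
    refine ((Complex.continuous_re.tendsto l).comp hl).congr fun t => ?_
    rw [Function.comp_apply, key (by omega), Complex.ofReal_re]
  · refine ⟨_, fun t => ((BallFourier.sumErr d β a t : ℝ) : ℂ), small (by omega), ?_,
      fun t ht => ?_⟩
    · exact Complex.isLittleO_ofReal_left.2 (BallFourier.sumErr_isLittleO hd hβ ha)
    · rw [key (by omega), atZero (by omega) t ht, BallFourier.bumpSum_eq]
      conv_lhs => rw [← sphere t ht]
      push_cast
      ring
  · refine ⟨fun t => ((BallFourier.sigmaErr d β a 0 t - -(BallFourier.pinskyConst d β a) *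
      Real.cos (2 * Real.pi * a * t - ((d : ℝ) - 1 + 2 * β) / 4 * Real.pi) *
        t ^ (((d : ℝ) - 3) / 2 - β) : ℝ) : ℂ), ?_, fun t ht => ?_⟩
    · exact Complex.isBigO_ofReal_left.2
        (BallFourier.sigmaErr_zero_asymptotics (by omega) hβ ha)
    · rw [atZero (by omega) t ht, ← Complex.ofReal_add, add_sub_cancel]
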